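/- Let $\Bbbk$ be an algebraically closed field. $1$-morphisms are composed as $(\mathrm F,\mathrm G)\mapsto \mathrm F\circ \mathrm G$ ($\mathrm G$ first). **Fiat $2$-categories.** A strict $2$-category $\mathcal C$ is *$\Bbbk$-finitary* if it has finitely many objects; every $\mathcal C(\mathtt i,\mathtt j)$ is an additive, idempotent split $\Bbbk$-linear category with finite dimensional morphism spaces and finitely many isomorphism classes of indecomposable objects; horizontal composition is $\Bbbk$-bilinear; and every identity $\mathbb 1_{\mathtt i}$ is indecomposable. It is *fiat* if moreover it has an involution $*$ (fixing objects, reversing $1$- and $2$-morphisms, with natural isomorphisms $(\mathrm G\circ\mathrm F)^*\cong \mathrm F^*\circ \mathrm G^*$, $\mathbb 1_{\mathtt i}^*\cong\mathbb 1_{\mathtt i}$, $\mathrm F^{**}\cong \mathrm F$) such that for each $\mathrm F\in\mathcal C(\mathtt i,\mathtt j)$ there are $2$-morphisms $\mathrm F\circ \mathrm F^*\to \mathbb 1_{\mathtt j}$ and $\mathbb 1_{\mathtt i}\to \mathrm F^*\circ \mathrm F$ satisfying the adjunction identities. **Cells.** For indecomposable $1$-morphisms write $\mathrm F\le_R \mathrm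 G$ (resp. $\mathrm F\le_L \mathrm G$, $\mathrm F\le_{LR}\mathrm G$) if $\mathrm G$ is a direct summand of $\mathrm H\circ \mathrm F$ (resp. $\mathrm F\circ \mathrm H$, $\mathrm H_2\circ \mathrm F\circ \mathrm H_1$) for some $1$-morphisms $\mathrm H,\mathrm H_1,\mathrm H_2$. The equivalence classes of these preorders are the right, left and two-sided cells (isomorphic $1$-morphisms are identified). A two-sided cell $\mathcal Q$ is *strongly regular* if different right cells inside $\mathcal Q$ are not comparable with respect to $\le_R$ and $|\mathcal L\cap \mathcal R|=1$ for every left cell $\mathcal L$ and right cell $\mathcal R$ in $\mathcal Q$. For $\mathrm F\in\mathcal Q$ let $m_{\mathrm F,\mathrm F}$ be the number with $\mathrm F^*\circ \mathrm F\cong \mathrm G^{\oplus m_{\mathrm F,\mathrm F}}$ modulo the $2$-morphisms that factor through direct sums of indecomposables $\not\le_{LR}\mathcal Q$, where $\mathrm G$ is the element in the right cell of $\mathrm F$ and in the left cell of $\mathrm F^*$. **Cell $2$-representations.** A *$2$-representation* $\mathbf M$ of $\mathcal C$ assigns to each $\mathtt i$ a $\Bbbk$-linear category $\mathbf M(\mathtt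 i)$ equivalent to the category of finite dimensional modules over some finite dimensional $\Bbbk$-algebra, with a $2$-functorial $\Bbbk$-linear action of $1$- and $2$-morphisms. An *equivalence* of $2$-representations is a collection of $\Bbbk$-linear equivalences $\mathbf M(\mathtt i)\to\mathbf N(\mathtt i)$ commuting with the action up to coherent natural isomorphism. Let $\mathbf P_{\mathtt i}(\mathtt j)$ be the category with objects the $2$-morphisms $\alpha:\mathrm F\to \mathrm G$ in $\mathcal C(\mathtt i,\mathtt j)$ and morphisms the commutative squares $(\beta,\beta')$ from $\alpha$ to $\alpha'$ modulo those for which $\beta'=\alpha'\xi$ for some $\xi$; $\mathcal C$ acts on it by composition. Let $P_{\mathrm F}$ be the object $0\to \mathrm F$ and, for $\mathrm F$ indecomposable, $L_{\mathrm F}$ its simple top. Let $\mathcal R$ be a right cell, $\mathtt i$ the common source of its elements. There is a unique subobject $K$ of $P_{\mathbb 1_{\mathtt i}}$ such that every $\mathrm F\in\mathcal R$ annihilates every simple subquotient of $P_{\mathbb 1_{\mathtt i}}/K$, and $K$ has a simple top $L=L_{\mathrm G}$ ($\mathrm G$ indecomposable) with $\mathrm F L\ne0$ for all $\mathrm F\in\mathcal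 R$. The *cell $2$-representation* $\mathbf C_{\mathcal R}$ is the restriction of the action to the full subcategories $\mathbf C_{\mathcal R}(\mathtt j)\subseteq\mathbf P_{\mathtt i}(\mathtt j)$ of objects $M$ having a presentation $X_1\to X_0\to M\to 0$ with $X_0,X_1$ direct summands of finite direct sums of objects $\mathrm F L$, $\mathrm F\in\mathcal R\cap\mathcal C(\mathtt i,\mathtt j)$; this is a $2$-representation. **Strong simplicity.** An object $M\in\mathbf M(\mathtt i)$ *generates* $\mathbf M$ if for all $\mathtt j$ and $X,Y\in \mathbf M(\mathtt j)$ there are $2$-morphisms $\alpha:\mathrm F\to\mathrm G$, $\alpha':\mathrm F'\to\mathrm G'$ in $\mathcal C(\mathtt i,\mathtt j)$ with $X\cong\mathrm{Coker}(\alpha_M:\mathrm F M\to \mathrm G M)$ and $Y\cong\mathrm{Coker}(\alpha'_M)$ such that every morphism $X\to Y$ is induced by a commutative square of $2$-morphisms from $\alpha$ to $\alpha'$. $\mathbf M$ is *strongly simple* if it is nonzero, generated by some object, and generated by every simple object of every $\mathbf M(\mathtt i)$. **Theorem.** Let $\mathcal Q$ be a strongly regular two-sided cell of a fiat $2$-category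 $\mathcal C$ and assume that the function $\mathrm F\mapsto m_{\mathrm F,\mathrm F}$ is constant on the left cells of $\mathcal Q$. Then: (a) for every right cell $\mathcal R$ in $\mathcal Q$ the cell $2$-representation $\mathbf C_{\mathcal R}$ is (well defined and) strongly simple; (b) for any two right cells $\mathcal R,\mathcal R'$ in $\mathcal Q$ the cell $2$-representations $\mathbf C_{\mathcal R}$ and $\mathbf C_{\mathcal R'}$ are equivalent. -/

import Mathlib

open CategoryTheory Bicategory Limits

universe w v u w' v' u' uk

noncomputable section

namespace Fiat

/-! ### Linear structure and functoriality of the right Freyd category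

`Preadditive.RightFreyd V` is the category of arrows `a : F ⟶ G` of `V`; its morphisms are
commutative squares, modulo those whose `G`-component `b` factors as `b = x ≫ a'` through the
target arrow `a'`. The arrow `a` is to be thought of as the cokernel of the projective objects
`0 → F` and `0 → G`. -/

section Freyd

variable {V : Type u} [Category.{v} V] [Preadditive V]
variable {W : Type u'} [Category.{v'} W] [Preadditive W]

instance arrowModule (k : Type uk) [Semiring k] [Linear k V] (a b : Arrow V) :
    Module k (a ⟶ b) where
  smul c f := Arrow.homMk (c • f.left) (c • f.right) (by
    have := f.w
    simp_all [Linear.smul_comp, Linear.comp_smul])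
  one_smul f := by ext <;> exact one_smul _ _
  mul_smul c d f := by ext <;> exact mul_smul _ _ _
  smul_zero c := by ext <;> exact smul_zero _
  smul_add c f g := by ext <;> exact smul_add _ _ _
  add_smul c d f := by ext <;> exact add_smul _ _ _
  zero_smul f := by ext <;> exact zero_smul _ _

instance arrowLinear (k : Type uk) [Semiring k] [Linear k V] : Linear k (Arrow V) where
  smul_comp X Y Z r f g := by
    ext
    · exact Linear.smul_comp _ _ _ _ _ _
    · exact Linear.smul_comp _ _ _ _ _ _
  comp_smul X Y Z f r g := by
    ext
    · exact Linear.comp_smul _ _ _ _ _ _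
    · exact Linear.comp_smul _ _ _ _ _ _

instance freydLinear (k : Type uk) [Semiring k] [Linear k V] :
    Linear k (Preadditive.RightFreyd V) :=
  letI : Preadditive (Quotient (Arrow.rightHomotopic V)) :=
    inferInstanceAs (Preadditive (Preadditive.RightFreyd V))
  letI : (Quotient.functor (Arrow.rightHomotopic V)).Additive :=
    inferInstanceAs (Preadditive.RightFreyd.quotient V).Additive
  Quotient.linear k (Arrow.rightHomotopic V) (by
    rintro c X Y f g ⟨h⟩
    refine ⟨⟨c • h.hom, ?_⟩⟩
    have := h.comm
    change c • f.right - c • g.right = _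
    rw [← smul_sub, this, Linear.smul_comp])

/-- The arrow presenting an object. -/
def arr (X : Preadditive.RightFreyd V) : Arrow V := CategoryTheory.Quotient.as X

/-- The class of a commutative square. -/
def cls {X Y : Preadditive.RightFreyd V} (f : arr X ⟶ arr Y) : X ⟶ Y :=
  (Preadditive.RightFreyd.quotient V).map f

lemma cls_surj {X Y : Preadditive.RightFreyd V} (f : X ⟶ Y) : ∃ g, cls g = f :=
  (Preadditive.RightFreyd.quotient V).map_surjective f

lemma cls_comp {X Y Z : Preadditive.RightFreyd V} (f : arr X ⟶ arr Y) (g : arr Y ⟶ arr Z) :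
    cls f ≫ cls g = cls (f ≫ g) := rfl

lemma cls_id (X : Preadditive.RightFreyd V) : cls (𝟙 (arr X)) = 𝟙 X := rfl

lemma cls_add {X Y : Preadditive.RightFreyd V} (f g : arr X ⟶ arr Y) :
    cls f + cls g = cls (f + g) := rfl

lemma cls_smul (k : Type uk) [Semiring k] [Linear k V]
    {X Y : Preadditive.RightFreyd V} (c : k) (f : arr X ⟶ arr Y) :
    c • cls f = cls (c • f) := rfl

/-- The functor on right Freyd categories induced by an additive functor. -/
def freydMap (F : V ⥤ W) [F.Additive] :
    Preadditive.RightFreyd V ⥤ Preadditive.RightFreyd W :=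
  CategoryTheory.Quotient.lift _ (F.mapArrow ⋙ Preadditive.RightFreyd.quotient W) (by
    rintro X Y f g ⟨h⟩
    refine Preadditive.RightFreyd.eq_of_rightHomotopy _ _ ⟨F.map h.hom, ?_⟩
    have := congrArg F.map h.comm
    rw [F.map_sub, F.map_comp] at this
    exact this)

lemma freydMap_cls (F : V ⥤ W) [F.Additive] {X Y : Preadditive.RightFreyd V}
    (f : arr X ⟶ arr Y) :
    (freydMap F).map (cls f) =
      cls (X := (freydMap F).obj X) (Y := (freydMap F).obj Y) (F.mapArrow.map f) := rfl

instance (F : V ⥤ W) [F.Additive] : (freydMap F).Additive where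
  map_add {X Y f g} := by
    obtain ⟨f, rfl⟩ := cls_surj f
    obtain ⟨g, rfl⟩ := cls_surj g
    refine congrArg (cls (X := (freydMap F).obj X) (Y := (freydMap F).obj Y))
      (?_ : F.mapArrow.map (f + g) = F.mapArrow.map f + F.mapArrow.map g)
    ext
    · exact F.map_add
    · exact F.map_add

instance (k : Type uk) [Semiring k] [Linear k V] [Linear k W] (F : V ⥤ W) [F.Additive]
    [F.Linear k] : (freydMap F).Linear k where
  map_smul {X Y} f c := by
    obtain ⟨f, rfl⟩ := cls_surj f
    refine congrArg (cls (X := (freydMap F).obj X) (Y := (freydMap F).obj Y))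
      (?_ : F.mapArrow.map (c • f) = c • F.mapArrow.map f)
    ext
    · exact F.map_smul _ _
    · exact F.map_smul _ _

/-- The square given by a natural transformation. -/
def natSq {F G : V ⥤ W} (α : F ⟶ G) (a : Arrow V) : F.mapArrow.obj a ⟶ G.mapArrow.obj a where
  left := α.app a.left
  right := α.app a.right
  w := (α.naturality a.hom).symm

/-- The natural transformation on right Freyd categories induced by a natural transformation. -/
def freydNat {F G : V ⥤ W} [F.Additive] [G.Additive] (α : F ⟶ G) : freydMap F ⟶ freydMap G where
  app X := cls (X := (freydMap F).obj X) (Y := (freydMap G).obj X) (natSq α (arr X))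
  naturality X Y f := by
    obtain ⟨f, rfl⟩ := cls_surj f
    refine congrArg (cls (X := (freydMap F).obj X) (Y := (freydMap G).obj Y))
      (?_ : F.mapArrow.map f ≫ natSq α (arr Y) = natSq α (arr X) ≫ G.mapArrow.map f)
    ext
    · exact α.naturality _
    · exact α.naturality _

lemma freydNat_app {F G : V ⥤ W} [F.Additive] [G.Additive] (α : F ⟶ G)
    (X : Preadditive.RightFreyd V) : (freydNat α).app X =
      cls (X := (freydMap F).obj X) (Y := (freydMap G).obj X) (natSq α (arr X)) := rfl

end Freyd

/-- Preadditive categories of `1`-morphisms, biadditive horizontal composition. -/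
class PreadditiveBicategory (C : Type u) [Bicategory.{w, v} C] where
  homPreadditive (i j : C) : Preadditive (i ⟶ j)
  whiskerLeft_add {i j l : C} (F : i ⟶ j) {G H : j ⟶ l} (a b : G ⟶ H) :
    F ◁ (a + b) = F ◁ a + F ◁ b
  add_whiskerRight {i j l : C} {F G : i ⟶ j} (a b : F ⟶ G) (H : j ⟶ l) :
    (a + b) ▷ H = a ▷ H + b ▷ H

attribute [reducible, instance] PreadditiveBicategory.homPreadditive

/-- `k`-linear categories of `1`-morphisms, `k`-bilinear horizontal composition. -/
class LinearBicategory (k : Type uk) [Semiring k] (C : Type u) [Bicategory.{w, v} C]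
    [PreadditiveBicategory C] where
  homLinear (i j : C) : Linear k (i ⟶ j)
  whiskerLeft_smul {i j l : C} (F : i ⟶ j) {G H : j ⟶ l} (c : k) (a : G ⟶ H) :
    F ◁ (c • a) = c • F ◁ a
  smul_whiskerRight {i j l : C} {F G : i ⟶ j} (c : k) (a : F ⟶ G) (H : j ⟶ l) :
    (c • a) ▷ H = c • a ▷ H

attribute [reducible, instance] LinearBicategory.homLinear

variable {C : Type u} [Bicategory.{w, v} C] [PreadditiveBicategory C]

instance (i : C) {j l : C} (H : j ⟶ l) : (postcomp i H).Additive where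
  map_add := PreadditiveBicategory.add_whiskerRight _ _ _

instance (k : Type uk) [Semiring k] [LinearBicategory k C] (i : C) {j l : C} (H : j ⟶ l) :
    (postcomp i H).Linear k where
  map_smul _ _ := LinearBicategory.smul_whiskerRight _ _ _

/-- The action of `H : j ⟶ l` on the right Freyd categories: composition `F ↦ H ∘ F`. -/
abbrev act (i : C) {j l : C} (H : j ⟶ l) :
    Preadditive.RightFreyd (i ⟶ j) ⥤ Preadditive.RightFreyd (i ⟶ l) :=
  freydMap (postcomp i H)

/-- Composition with a `2`-morphism. -/
def postcompNat (i : C) {j l : C} {H H' : j ⟶ l} (α : H ⟶ H') : postcomp i H ⟶ postcomp i H' where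
  app F := F ◁ α
  naturality _ _ β := (whisker_exchange β α).symm

/-- The action of a `2`-morphism on the right Freyd categories. -/
abbrev actNat (i : C) {j l : C} {H H' : j ⟶ l} (α : H ⟶ H') : act i H ⟶ act i H' :=
  freydNat (postcompNat i α)


lemma cls_congr {V : Type u} [Category.{v} V] [Preadditive V] {X Y : Preadditive.RightFreyd V}
    {f g : arr X ⟶ arr Y} (hl : f.left = g.left) (hr : f.right = g.right) : cls f = cls g :=
  congrArg cls (Arrow.hom_ext _ _ hl hr)

/-- The isomorphism given by a square of isomorphisms. -/
def isoSq {V : Type u} [Category.{v} V] [Preadditive V] (X Y : Preadditive.RightFreyd V)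
   (l : (arr X).left ≅ (arr Y).left) (r : (arr X).right ≅ (arr Y).right)
   (h : l.hom ≫ (arr Y).hom = (arr X).hom ≫ r.hom) : X ≅ Y :=
  (Preadditive.RightFreyd.quotient V).mapIso (X := arr X) (Y := arr Y) (Arrow.isoMk l r h)

/-- Identities act by the identity, up to unitors. -/
def actId (i j : C) : act i (𝟙 j) ≅ 𝟭 (Preadditive.RightFreyd (i ⟶ j)) :=
  NatIso.ofComponents
    (fun X => isoSq ((act i (𝟙 j)).obj X) X (ρ_ (arr X).left) (ρ_ (arr X).right)
      (rightUnitor_naturality (arr X).hom).symm)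
    (by
      intro X Y f
      obtain ⟨f, rfl⟩ := cls_surj f
      refine cls_congr (X := (act i (𝟙 j)).obj X) (Y := Y) ?_ ?_
      · exact rightUnitor_naturality _
      · exact rightUnitor_naturality _)

/-- Compositions act by compositions, up to associators. -/
def actComp (i : C) {j l m : C} (F : j ⟶ l) (G : l ⟶ m) : act i (F ≫ G) ≅ act i F ⋙ act i G :=
  NatIso.ofComponents
    (fun X => isoSq ((act i (F ≫ G)).obj X) ((act i F ⋙ act i G).obj X)
      (α_ (arr X).left F G).symm (α_ (arr X).right F G).symm
      (associator_inv_naturality_left (arr X).hom F G).symm)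
    (by
      intro X Y f
      obtain ⟨f, rfl⟩ := cls_surj f
      refine cls_congr (X := (act i (F ≫ G)).obj X) (Y := (act i F ⋙ act i G).obj Y) ?_ ?_
      · exact associator_inv_naturality_left _ _ _
      · exact associator_inv_naturality_left _ _ _)

/-- The principal `2`-representation `P_i`: it sends `j` to the right Freyd category of `i ⟶ j`,
on which `1`-morphisms and `2`-morphisms act by composition. -/
def principal (i : C) : Pseudofunctor C Cat.{w, max v w} where
  obj j := Cat.of (Preadditive.RightFreyd (i ⟶ j))
  map H := (act i H).toCatHom
  map₂ α := (actNat i α).toCatHom₂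
  map₂_id H := by
    ext X
    refine cls_congr (X := (act i H).obj X) (Y := (act i H).obj X) ?_ ?_
    · exact whiskerLeft_id _ _
    · exact whiskerLeft_id _ _
  map₂_comp {j l F G H} α β := by
    ext X
    refine cls_congr (X := (act i F).obj X) (Y := (act i H).obj X) ?_ ?_
    · exact whiskerLeft_comp _ _ _
    · exact whiskerLeft_comp _ _ _
  mapId j := Cat.Hom.isoMk (actId i j)
  mapComp F G := Cat.Hom.isoMk (actComp i F G)
  map₂_whisker_left {j l m} F {G H} η := by
    have key (A : i ⟶ j) : A ◁ F ◁ η = (α_ A F G).inv ≫ (A ≫ F) ◁ η ≫ (α_ A F H).hom := by simp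
    ext X
    exact cls_congr (X := (act i (F ≫ G)).obj X) (Y := (act i (F ≫ H)).obj X) (key _) (key _)
  map₂_whisker_right {j l m} {F G} η H := by
    have key (A : i ⟶ j) : A ◁ η ▷ H = (α_ A F H).inv ≫ (A ◁ η) ▷ H ≫ (α_ A G H).hom := by simp
    ext X
    exact cls_congr (X := (act i (F ≫ H)).obj X) (Y := (act i (G ≫ H)).obj X) (key _) (key _)
  map₂_associator {j l m n} F G H := by
    have key (A : i ⟶ j) : A ◁ (α_ F G H).hom = (α_ A (F ≫ G) H).inv ≫ (α_ A F G).inv ▷ H ≫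
        𝟙 _ ≫ (α_ (A ≫ F) G H).hom ≫ (α_ A F (G ≫ H)).hom := by simp
    ext X
    exact cls_congr (X := (act i ((F ≫ G) ≫ H)).obj X) (Y := (act i (F ≫ G ≫ H)).obj X)
      (key _) (key _)
  map₂_left_unitor {j l} F := by
    have key (A : i ⟶ j) : A ◁ (λ_ F).hom = (α_ A (𝟙 j) F).inv ≫ (ρ_ A).hom ▷ F ≫ 𝟙 _ := by simp
    ext X
    exact cls_congr (X := (act i (𝟙 j ≫ F)).obj X) (Y := (act i F).obj X) (key _) (key _)
  map₂_right_unitor {j l} F := by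
    have key (A : i ⟶ j) : A ◁ (ρ_ F).hom = (α_ A F (𝟙 l)).inv ≫ (ρ_ (A ≫ F)).hom ≫ 𝟙 _ := by simp
    ext X
    exact cls_congr (X := (act i (F ≫ 𝟙 l)).obj X) (Y := (act i F).obj X) (key _) (key _)

/-- Restriction to full subcategories which are stable under the action. -/
def restrict (M : Pseudofunctor C Cat.{w', u'}) (P : ∀ j, ObjectProperty (M.obj j))
    (h : ∀ {j l : C} (H : j ⟶ l) (X : M.obj j), P j X → P l ((M.map H).toFunctor.obj X)) :
    Pseudofunctor C Cat.{w', u'} where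
  obj j := Cat.of (P j).FullSubcategory
  map {j l} H := ((P l).lift ((P j).ι ⋙ (M.map H).toFunctor) (fun X => h H X.obj X.property)).toCatHom
  map₂ {j l F G} α := NatTrans.toCatHom₂
    { app X := ObjectProperty.homMk ((M.map₂ α).toNatTrans.app X.obj)
      naturality X Y f := ObjectProperty.hom_ext _ ((M.map₂ α).toNatTrans.naturality f.hom) }
  map₂_id {j l} F := by
    ext X
    apply ObjectProperty.hom_ext
    exact congrArg (fun t => t.toNatTrans.app X.obj) (M.map₂_id F)
  map₂_comp {j l F G H} α β := by
    ext X
    apply ObjectProperty.hom_ext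
    exact congrArg (fun t => t.toNatTrans.app X.obj) (M.map₂_comp α β)
  mapId j := Cat.Hom.isoMk (NatIso.ofComponents
    (fun X => ObjectProperty.isoMk _ ((Cat.Hom.toNatIso (M.mapId j)).app X.obj))
    (fun f => ObjectProperty.hom_ext _ ((M.mapId j).hom.toNatTrans.naturality f.hom)))
  mapComp F G := Cat.Hom.isoMk (NatIso.ofComponents
    (fun X => ObjectProperty.isoMk _ ((Cat.Hom.toNatIso (M.mapComp F G)).app X.obj))
    (fun f => ObjectProperty.hom_ext _ ((M.mapComp F G).hom.toNatTrans.naturality f.hom)))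
  map₂_whisker_left F G H η := by
    ext X
    apply ObjectProperty.hom_ext
    exact congrArg (fun t => t.toNatTrans.app X.obj) (M.map₂_whisker_left F η)
  map₂_whisker_right η H := by
    ext X
    apply ObjectProperty.hom_ext
    exact congrArg (fun t => t.toNatTrans.app X.obj) (M.map₂_whisker_right η H)
  map₂_associator F G H := by
    ext X
    apply ObjectProperty.hom_ext
    exact congrArg (fun t => t.toNatTrans.app X.obj) (M.map₂_associator F G H)
  map₂_left_unitor F := by
    ext X
    apply ObjectProperty.hom_ext
    exact congrArg (fun t => t.toNatTrans.app X.obj) (M.map₂_left_unitor F)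
  map₂_right_unitor F := by
    ext X
    apply ObjectProperty.hom_ext
    exact congrArg (fun t => t.toNatTrans.app X.obj) (M.map₂_right_unitor F)


/-! ### Finitary bicategories, involutions -/

/-- All categories of `1`-morphisms are additive. -/
class AdditiveBicategory (C : Type u) [Bicategory.{w, v} C] [PreadditiveBicategory C] : Prop where
  hasFiniteBiproducts (i j : C) : HasFiniteBiproducts (i ⟶ j)

instance [AdditiveBicategory C] (i j : C) : HasFiniteBiproducts (i ⟶ j) :=
  AdditiveBicategory.hasFiniteBiproducts i j

instance [AdditiveBicategory C] (i j : C) : HasBinaryBiproducts (i ⟶ j) :=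
  hasBinaryBiproducts_of_finite_biproducts _

/-- `k`-finitary `2`-categories: finitely many objects; each category of `1`-morphisms is
`k`-linear, additive, idempotent split, with finite dimensional spaces of `2`-morphisms and
finitely many indecomposable objects up to isomorphism; identities are indecomposable. -/
class IsFinitary (k : Type uk) [Field k] (C : Type u) [Bicategory.{w, v} C]
    [PreadditiveBicategory C] [AdditiveBicategory C] [LinearBicategory k C] : Prop where
  strict : Bicategory.Strict C
  finite_objects : Finite C
  isIdempotentComplete (i j : C) : IsIdempotentComplete (i ⟶ j)
  finite_hom {i j : C} (F G : i ⟶ j) : Module.Finite k (F ⟶ G)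
  finite_indecomposables (i j : C) : ∃ (n : ℕ) (F : Fin n → (i ⟶ j)),
    ∀ G : i ⟶ j, Indecomposable G → ∃ a, Nonempty (G ≅ F a)
  indecomposable_id (i : C) : Indecomposable (𝟙 i)

/-- An involution `F ↦ F*`: it fixes objects, reverses `1`-morphisms and `2`-morphisms, is
compatible with composition and identities up to (natural) isomorphism, and `F** ≅ F`
naturally. No further coherence between these isomorphisms is required. -/
structure Involution (C : Type u) [Bicategory.{w, v} C] where
  star (i j : C) : (i ⟶ j)ᵒᵖ ⥤ (j ⟶ i)
  starComp {i j l : C} (F : i ⟶ j) (G : j ⟶ l) :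
    (star i l).obj (.op (F ≫ G)) ≅ (star j l).obj (.op G) ≫ (star i j).obj (.op F)
  starComp_left {i j l : C} {F F' : i ⟶ j} (a : F ⟶ F') (G : j ⟶ l) :
    (star i l).map (a ▷ G).op ≫ (starComp F G).hom =
      (starComp F' G).hom ≫ (star j l).obj (.op G) ◁ (star i j).map a.op
  starComp_right {i j l : C} (F : i ⟶ j) {G G' : j ⟶ l} (b : G ⟶ G') :
    (star i l).map (F ◁ b).op ≫ (starComp F G).hom =
      (starComp F G').hom ≫ (star j l).map b.op ▷ (star i j).obj (.op F)
  starId (i : C) : (star i i).obj (.op (𝟙 i)) ≅ 𝟙 i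
  starStar {i j : C} (F : i ⟶ j) : (star j i).obj (.op ((star i j).obj (.op F))) ≅ F
  starStar_natural {i j : C} {F G : i ⟶ j} (a : F ⟶ G) :
    (starStar F).hom ≫ a = (star j i).map ((star i j).map a.op).op ≫ (starStar G).hom

/-- The `1`-morphism `F*`. -/
abbrev Involution.dual (I : Involution C) {i j : C} (F : i ⟶ j) : j ⟶ i :=
  (I.star i j).obj (.op F)

/-- Adjunctions: unit `𝟙 → F* ∘ F`, counit `F ∘ F* → 𝟙`. -/
def Involution.HasAdjunctions (I : Involution C) : Prop :=
  ∀ {i j : C} (F : i ⟶ j), Nonempty (Bicategory.Adjunction F (I.dual F))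

/-! ### Cells -/

/-- A `1`-morphism together with its source and target. Recall that `F ≫ G` is `G ∘ F`. -/
structure OneMor (C : Type u) [Bicategory.{w, v} C] where
  {src tgt : C}
  mor : src ⟶ tgt

/-- Isomorphic `1`-morphisms (with the same source and the same target). -/
inductive Iso₁ : OneMor C → OneMor C → Prop
  | mk {i j : C} {F G : i ⟶ j} (e : F ≅ G) : Iso₁ ⟨F⟩ ⟨G⟩

/-- `F ≤_R G`: `G` is a direct summand of some `H ∘ F`. -/
inductive RightLE : OneMor C → OneMor C → Prop
  | mk {i j l : C} {F : i ⟶ j} {G : i ⟶ l} (H : j ⟶ l) (r : Retract G (F ≫ H)) : RightLE ⟨F⟩ ⟨G⟩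

/-- `F ≤_L G`: `G` is a direct summand of some `F ∘ H`. -/
inductive LeftLE : OneMor C → OneMor C → Prop
  | mk {i j l : C} {F : i ⟶ j} {G : l ⟶ j} (H : l ⟶ i) (r : Retract G (H ≫ F)) : LeftLE ⟨F⟩ ⟨G⟩

/-- `F ≤_LR G`: `G` is a direct summand of some `H₂ ∘ F ∘ H₁`. -/
inductive TwoSidedLE : OneMor C → OneMor C → Prop
  | mk {i j l m : C} {F : i ⟶ j} {G : l ⟶ m} (H₁ : l ⟶ i) (H₂ : j ⟶ m)
      (r : Retract G (H₁ ≫ F ≫ H₂)) : TwoSidedLE ⟨F⟩ ⟨G⟩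

section Cells

variable [AdditiveBicategory C]

/-- The cell of `F` for the preorder `le`, as a class of indecomposable `1`-morphisms
closed under isomorphism. -/
def cellOf (le : OneMor C → OneMor C → Prop) (F : OneMor C) : Set (OneMor C) :=
  {G | Indecomposable G.mor ∧ le F G ∧ le G F}

/-- Cells for the preorder `le` on indecomposable `1`-morphisms. -/
def IsCell (le : OneMor C → OneMor C → Prop) (S : Set (OneMor C)) : Prop :=
  ∃ F : OneMor C, Indecomposable F.mor ∧ S = cellOf le F

abbrev IsRightCell (R : Set (OneMor C)) : Prop := IsCell RightLE R

abbrev IsLeftCell (L : Set (OneMor C)) : Prop := IsCell LeftLE L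

abbrev IsTwoSidedCell (Q : Set (OneMor C)) : Prop := IsCell TwoSidedLE Q

/-- Different right cells inside `Q` are not comparable with respect to `≤_R`. -/
def IsRegularCell (Q : Set (OneMor C)) : Prop :=
  ∀ R R' : Set (OneMor C), IsRightCell R → IsRightCell R' → R ⊆ Q → R' ⊆ Q → R ≠ R' →
    ∀ F ∈ R, ∀ G ∈ R', ¬ RightLE F G

/-- `Q` is regular, and any left cell and any right cell inside `Q` meet in exactly one
isomorphism class. -/
def IsStronglyRegularCell (Q : Set (OneMor C)) : Prop :=
  IsRegularCell Q ∧
    ∀ L R : Set (OneMor C), IsLeftCell L → IsRightCell R → L ⊆ Q → R ⊆ Q →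
      ∃ F ∈ L ∩ R, ∀ G ∈ L ∩ R, Iso₁ G F

/-- The ideal of `2`-morphisms which factor through a `1`-morphism none of whose
indecomposable summands is `≤_LR` an element of `Q`. -/
def InCellIdeal (Q : Set (OneMor C)) {i j : C} {X Y : i ⟶ j} (f : X ⟶ Y) : Prop :=
  ∃ (Z : i ⟶ j) (a : X ⟶ Z) (b : Z ⟶ Y), f = a ≫ b ∧
    ∀ S : i ⟶ j, Indecomposable S → Nonempty (Retract S Z) → ∀ A ∈ Q, ¬ TwoSidedLE ⟨S⟩ A

/-- `m_{F,F} = m`: modulo the ideal of `Q`, the `1`-morphism `F* ∘ F` is isomorphic to the direct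
sum of `m` copies of `G`, where `G` is in the right cell of `F` and in the left cell of `F*`. -/
def HasMult (I : Involution C) (Q : Set (OneMor C)) {i j : C} (F : i ⟶ j) (m : ℕ) : Prop :=
  ∃ G : i ⟶ i, (⟨G⟩ : OneMor C) ∈ cellOf RightLE ⟨F⟩ ∩ cellOf LeftLE ⟨I.dual F⟩ ∧
    ∃ (f : F ≫ I.dual F ⟶ ⨁ fun _ : Fin m => G) (g : (⨁ fun _ : Fin m => G) ⟶ F ≫ I.dual F),
      InCellIdeal Q (f ≫ g - 𝟙 _) ∧ InCellIdeal Q (g ≫ f - 𝟙 _)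

/-- The function `F ↦ m_{F,F}` is constant on the left cells of `Q`. -/
def MultConstant (I : Involution C) (Q : Set (OneMor C)) : Prop :=
  ∀ L : Set (OneMor C), IsLeftCell L → L ⊆ Q → ∀ F ∈ L, ∀ G ∈ L, ∀ m n : ℕ,
    HasMult I Q F.mor m → HasMult I Q G.mor n → m = n

end Cells

/-! ### `2`-representations -/

/-- Categories equivalent to finite dimensional modules over a finite dimensional algebra. -/
def IsModuleCategory (k : Type uk) [Field k] (D : Type u') [Category.{w} D] [Preadditive D]
    [Linear k D] : Prop :=
  ∃ (A : Type w) (_ : Ring A) (_ : Algebra k A) (_ : Module.Finite k A)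
    (e : D ≌ FGModuleCat.{w} A), e.functor.Additive ∧ e.functor.Linear k

/-- `2`-representations, that is, `2`-functors to categories of the form `A`-mod, `k`-linear
functors and natural transformations. -/
structure TwoRep (k : Type uk) [Field k] (C : Type u) [Bicategory.{w, v} C]
    [PreadditiveBicategory C] [LinearBicategory k C] where
  functor : Pseudofunctor C Cat.{w, u'}
  preadditive (i : C) : Preadditive (functor.obj i)
  linear (i : C) : Linear k (functor.obj i)
  map_additive {i j : C} (F : i ⟶ j) : (functor.map F).toFunctor.Additive
  map_linear {i j : C} (F : i ⟶ j) : (functor.map F).toFunctor.Linear k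
  map₂_add {i j : C} {F G : i ⟶ j} (a b : F ⟶ G) (X : functor.obj i) :
    (functor.map₂ (a + b)).toNatTrans.app X =
      (functor.map₂ a).toNatTrans.app X + (functor.map₂ b).toNatTrans.app X
  map₂_smul {i j : C} {F G : i ⟶ j} (c : k) (a : F ⟶ G) (X : functor.obj i) :
    (functor.map₂ (c • a)).toNatTrans.app X = c • (functor.map₂ a).toNatTrans.app X
  isModuleCategory (i : C) : IsModuleCategory k (functor.obj i)

attribute [instance] TwoRep.preadditive TwoRep.linear

namespace TwoRep

variable {k : Type uk} [Field k] [LinearBicategory k C]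

/-- The category `M(i)`. -/
abbrev obj (M : TwoRep.{w, v, u, u', uk} k C) (i : C) : Type u' := M.functor.obj i

/-- The action `F X` of a `1`-morphism on an object. -/
abbrev actObj (M : TwoRep.{w, v, u, u', uk} k C) {i j : C} (F : i ⟶ j) (X : M.obj i) : M.obj j :=
  (M.functor.map F).toFunctor.obj X

/-- The evaluation `F X → G X` of a `2`-morphism. -/
abbrev eval (M : TwoRep.{w, v, u, u', uk} k C) {i j : C} {F G : i ⟶ j} (a : F ⟶ G) (X : M.obj i) :
    M.actObj F X ⟶ M.actObj G X :=
  (M.functor.map₂ a).toNatTrans.app X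

/-- `p` exhibits `X` as `Coker(α) M₀`, the value at `M₀` of the `1`-morphism `Coker(α)` of the
abelian envelope. -/
def IsCokerValue (M : TwoRep.{w, v, u, u', uk} k C) {i j : C} (M₀ : M.obj i) (α : Arrow (i ⟶ j))
    {X : M.obj j} (p : M.actObj α.right M₀ ⟶ X) : Prop :=
  ∃ h : M.eval α.hom M₀ ≫ p = 0, Nonempty (IsColimit (CokernelCofork.ofπ p h))

/-- `M₀` generates `M`: any two objects `X`, `Y` of any `M(j)` are values `Coker(α) M₀`,
`Coker(β) M₀` of `1`-morphisms of the abelian envelope such that each morphism `X → Y` is the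
evaluation at `M₀` of a `2`-morphism `Coker(α) → Coker(β)`, that is, of a commutative square
`α → β` of `2`-morphisms. -/
def Generates (M : TwoRep.{w, v, u, u', uk} k C) {i : C} (M₀ : M.obj i) : Prop :=
  ∀ (j : C) (X Y : M.obj j), ∃ (α β : Arrow (i ⟶ j))
    (p : M.actObj α.right M₀ ⟶ X) (q : M.actObj β.right M₀ ⟶ Y),
      M.IsCokerValue M₀ α p ∧ M.IsCokerValue M₀ β q ∧
        ∀ φ : X ⟶ Y, ∃ ξ : α ⟶ β, p ≫ φ = M.eval ξ.right M₀ ≫ q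

def IsNontrivial (M : TwoRep.{w, v, u, u', uk} k C) : Prop :=
  ∃ (i : C) (X : M.obj i), ¬ IsZero X

def IsCyclic (M : TwoRep.{w, v, u, u', uk} k C) : Prop :=
  ∃ (i : C) (X : M.obj i), M.Generates X

/-- Strong simplicity: nontrivial, cyclic, and generated by any simple object. -/
def StronglySimple (M : TwoRep.{w, v, u, u', uk} k C) : Prop :=
  M.IsNontrivial ∧ M.IsCyclic ∧ ∀ (i : C) (X : M.obj i), Simple X → M.Generates X

/-- Equivalence of `2`-representations: a pseudonatural transformation all of whose components
are `k`-linear equivalences. -/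
def Equivalent (M N : TwoRep.{w, v, u, u', uk} k C) : Prop :=
  ∃ η : Pseudofunctor.StrongTrans M.functor N.functor, ∀ i : C,
    (η.app i).toFunctor.Additive ∧ Functor.Linear k (C := M.obj i) (D := N.obj i)
      (η.app i).toFunctor ∧ (η.app i).toFunctor.IsEquivalence

end TwoRep

/-! ### Cell `2`-representations -/

section CellRep

variable [AdditiveBicategory C]

/-- The projective object `0 → F`. -/
abbrev proj {i j : C} (F : i ⟶ j) : Preadditive.RightFreyd (i ⟶ j) :=
  (Preadditive.RightFreyd.functor (i ⟶ j)).obj F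

/-- The data from which the cell `2`-representation of the right cell `R` is built: the common
source `i` of the elements of `R`, a subobject `K` of `P_{𝟙 i}` which has simple top `L`, the
top of `P_G` for an indecomposable `G` (so `L = L_G`), such that every simple subquotient of
`P_{𝟙 i} / K` is annihilated by every element of `R` and no element of `R` annihilates `L`. -/
structure CellDatum (R : Set (OneMor C)) where
  i : C
  src_eq : ∀ F ∈ R, F.src = i
  K : Preadditive.RightFreyd (i ⟶ i)
  ι : K ⟶ proj (𝟙 i)
  mono_ι : Mono ι
  annihilates : ∀ (Z : Preadditive.RightFreyd (i ⟶ i)) (c : proj (𝟙 i) ⟶ Z) (h : ι ≫ c = 0),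
    Nonempty (IsColimit (CokernelCofork.ofπ c h)) →
    ∀ (Y S : Preadditive.RightFreyd (i ⟶ i)) (a : Y ⟶ Z) (b : Y ⟶ S), Mono a → Epi b → Simple S →
    ∀ {j : C} (F : i ⟶ j), (⟨F⟩ : OneMor C) ∈ R → IsZero ((act i F).obj S)
  G : i ⟶ i
  indecomposable_G : Indecomposable G
  L : Preadditive.RightFreyd (i ⟶ i)
  simple_L : Simple L
  p : proj G ⟶ L
  epi_p : Epi p
  π : K ⟶ L
  epi_π : Epi π
  simple_top : ∀ (S : Preadditive.RightFreyd (i ⟶ i)) (f : K ⟶ S), Simple S → ∃ g : L ⟶ S, f = π ≫ g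
  not_annihilates : ∀ {j : C} (F : i ⟶ j), (⟨F⟩ : OneMor C) ∈ R → ¬ IsZero ((act i F).obj L)

namespace CellDatum

variable {R : Set (OneMor C)} (d : CellDatum R)

/-- `X` lies in `add {F L : F ∈ R}`. -/
def IsAddQ {j : C} (X : Preadditive.RightFreyd (d.i ⟶ j)) : Prop :=
  ∃ (n : ℕ) (F : Fin n → (d.i ⟶ j)) (b : Bicone fun a => (act d.i (F a)).obj d.L),
    (∀ a, (⟨F a⟩ : OneMor C) ∈ R) ∧ Nonempty b.IsBilimit ∧ Nonempty (Retract X b.pt)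

/-- Objects with a presentation `X₁ → X₀ → M → 0` with `X₁`, `X₀` in `add {F L : F ∈ R}`. -/
def cellObj (j : C) : ObjectProperty (Preadditive.RightFreyd (d.i ⟶ j)) := fun M =>
  ∃ (X₁ X₀ : Preadditive.RightFreyd (d.i ⟶ j)) (f : X₁ ⟶ X₀) (p : X₀ ⟶ M) (h : f ≫ p = 0),
    d.IsAddQ X₁ ∧ d.IsAddQ X₀ ∧ Nonempty (IsColimit (CokernelCofork.ofπ p h))

variable (k : Type uk) [Field k] [LinearBicategory k C]

/-- The subcategories of the principal `2`-representation given by `cellObj` form a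
`2`-representation: they are stable under the action and are module categories. -/
structure IsTwoRep : Prop where
  stable {j l : C} (H : j ⟶ l) (X : Preadditive.RightFreyd (d.i ⟶ j)) :
    d.cellObj j X → d.cellObj l ((act d.i H).obj X)
  isModuleCategory (j : C) : IsModuleCategory k (d.cellObj j).FullSubcategory

variable {k}

/-- Restriction of the action to the categories `cellObj`. -/
abbrev cellFunctor (h : d.IsTwoRep k) : Pseudofunctor C Cat.{w, max v w} :=
  restrict (principal d.i) d.cellObj (fun H X hX => h.stable H X hX)

instance (h : d.IsTwoRep k) (j : C) : Preadditive ((d.cellFunctor h).obj j) :=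
  inferInstanceAs (Preadditive (d.cellObj j).FullSubcategory)

instance (h : d.IsTwoRep k) (j : C) : Linear k ((d.cellFunctor h).obj j) :=
  inferInstanceAs (Linear k (d.cellObj j).FullSubcategory)

/-- The cell `2`-representation, by restriction from the principal `2`-representation. -/
def cellRep (h : d.IsTwoRep k) : TwoRep.{w, v, u, max v w, uk} k C where
  functor := d.cellFunctor h
  preadditive j := inferInstance
  linear j := inferInstance
  map_additive {j l} H := ⟨fun {X Y f g} =>
    ObjectProperty.hom_ext _ ((act d.i H).map_add (f := f.hom) (g := g.hom))⟩
  map_linear {j l} H := ⟨fun f c =>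
    ObjectProperty.hom_ext _ ((act d.i H).map_smul c f.hom)⟩
  map₂_add {j l F G} a b X := by
    apply ObjectProperty.hom_ext
    exact cls_congr (X := (act d.i F).obj X.obj) (Y := (act d.i G).obj X.obj)
      (PreadditiveBicategory.whiskerLeft_add _ a b) (PreadditiveBicategory.whiskerLeft_add _ a b)
  map₂_smul {j l F G} c a X := by
    apply ObjectProperty.hom_ext
    exact cls_congr (X := (act d.i F).obj X.obj) (Y := (act d.i G).obj X.obj)
      (LinearBicategory.whiskerLeft_smul _ c a) (LinearBicategory.whiskerLeft_smul _ c a)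
  isModuleCategory j := h.isModuleCategory j

end CellDatum

end CellRep

end Fiat

end

noncomputable section

namespace Fiat

/-! ### Local endomorphism rings and decompositions -/

section Krull

/-! The principal 2-representation is controlled by one support criterion. By the adjunction between
`F*` and `F`, `F X ≠ 0` exactly when some `P_J` with `J` indecomposable and `F* ≤_L J` maps
nontrivially to `X` (`not_isZero_act_iff`). Hence `K` can be taken to be the trace in `P_𝟙` of these
projectives: then `F K ≅ F P_𝟙 ≅ P_F` is projective with local endomorphism ring, which forces `K`
to have a simple top `L = L_G`. Strong regularity gives `G ∈ R` and `G* ≅ G`, and the map `P_G → K →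
P_𝟙` is a 2-morphism `c : G → 𝟙` through which every `F ∈ R` splits off `F ∘ G`. This makes `G` the
Duflo involution of `R` (`IsDuflo`). The objects `F L` are relatively projective and all maps
between them come from 2-morphisms, so the cell categories are module categories
(`isModuleCategory_of_generator`).

The rest is done in an arbitrary 2-representation, with a simple object `T` for which the objects `F
T`, `F ∈ R`, behave like the indecomposable projectives (`TwoRep.IsCellGenerator`). The top of `G L`
in the cell 2-representation is such an object (`CellDatum.exists_isCellGenerator`). For such `T`
the space `Hom(G T, T)` is a line spanned by the evaluation of `c`. By adjunction, every map `H T →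
H' T` with `H`, `H'` sums of elements of `R` is the evaluation of a 2-morphism, and therefore `T`
generates (`TwoRep.IsCellGenerator.generates`).

The main step moves from `T` to another simple object `S`. Such an `S` is the top of some `F T`, and
`F* S ≅ G T` (`nonempty_iso_dual`). Let `G'` be the Duflo involution of the right cell of `F*`.
Computing the dimension of `End(G T) ≅ End(F* S)` on both sides by adjunction gives `m_{G,G} =
m_{F*,F*} · dim Hom(G' S, S)`. Since `G` and `F*` lie in the same left cell, constancy of the
multiplicities yields `dim Hom(G' S, S) = 1`, and `S` is a cell generator for the right cell of `F*`
(`TwoRep.IsCellGenerator.quotient`). This proves strong simplicity.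

For (b), choose `F ∈ R'` with `F* ∈ R`. The top `S` of `F T'`, with `T'` the cell generator of the
cell 2-representation of `R'`, is then a cell generator there for `R`. Evaluation at `S`, extended
right exactly to the Freyd category, restricts to an equivalence from the cell 2-representation of
`R`. The point is that a 2-morphism between sums of elements of `R` vanishes at `L` if and only if
it vanishes at `S`; this is reduced to 2-morphisms `G → 𝟙` and settled by locality of `End(G)`
(`eval_duflo_eq_zero`). -/

theorem isUnit_or_isUnit_one_sub {k E : Type*} [Field k] [Ring E] [Algebra k E]
    [Module.Finite k E] (h : ∀ e : E, e * e = e → e = 0 ∨ e = 1) (x : E) :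
    IsUnit x ∨ IsUnit (1 - x) := by
  have : IsArtinian k E := inferInstance
  have hA : IsArtinianRing E := IsArtinianRing.of_finite k E
  -- Fitting's lemma for left multiplication by `x`. The exponent `n + 1` leaves one factor `x` to
  -- split off in the invertible case.
  obtain ⟨n, hn⟩ := Filter.eventually_atTop.1
    (LinearMap.eventually_isCompl_ker_pow_range_pow (LinearMap.mulLeft k x))
  have hc := hn (n + 1) (by omega)
  rw [LinearMap.pow_mulLeft] at hc
  have h1 : (1 : E) ∈ (LinearMap.mulLeft k (x ^ (n + 1))).ker ⊔
      (LinearMap.mulLeft k (x ^ (n + 1))).range := by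
    rw [hc.sup_eq_top]; trivial
  obtain ⟨a, ha, b, ⟨c, hcb⟩, hab⟩ := Submodule.mem_sup.1 h1
  simp only [LinearMap.mem_ker, LinearMap.mulLeft_apply] at ha hcb
  -- The component of `1` in the range is idempotent: `b - b * b = a * b` lies both in the kernel
  -- and in the range, as both are right ideals.
  have hb : b * b = b := by
    have h2 : b - b * b = a * b := by
      have : (a + b) * b = b := by rw [hab, one_mul]
      rw [add_mul] at this
      rw [sub_eq_iff_eq_add]
      exact this.symm
    have h3 : a * b ∈ (LinearMap.mulLeft k (x ^ (n + 1))).ker := by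
      simp [← mul_assoc, ha]
    have h4 : a * b ∈ (LinearMap.mulLeft k (x ^ (n + 1))).range := by
      rw [← h2]
      refine ⟨c - c * b, ?_⟩
      simp [mul_sub, ← mul_assoc, hcb]
    have h5 := (Submodule.disjoint_def.1 hc.disjoint) _ h3 h4
    rw [h5, sub_eq_zero] at h2
    exact h2.symm
  rcases h b hb with rfl | rfl
  · right
    rw [add_zero] at hab
    subst hab
    refine IsNilpotent.isUnit_one_sub ⟨n + 1, ?_⟩
    simpa using ha
  · left
    have hxc : x * (x ^ n * c) = 1 := by rw [← mul_assoc, ← pow_succ', hcb]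
    -- A right inverse makes left multiplication surjective, hence injective in finite dimension, so
    -- it is also a left inverse.
    have hs : Function.Surjective (LinearMap.mulLeft k x) := fun y =>
      ⟨x ^ n * c * y, by simp [← mul_assoc, show x * x ^ n * c = 1 by rw [mul_assoc, hxc]]⟩
    have hcx : x ^ n * c * x = 1 := by
      apply LinearMap.injective_iff_surjective.2 hs
      simp only [LinearMap.mulLeft_apply, mul_one]
      rw [← mul_assoc, hxc, one_mul]
    exact ⟨⟨x, x ^ n * c, hxc, hcx⟩, rfl⟩

variable {V : Type u} [Category.{v} V] [Preadditive V]

/-- The endomorphism ring is local. -/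
def IsLocalObj (X : V) : Prop := ¬ IsZero X ∧ ∀ f : X ⟶ X, IsIso f ∨ IsIso (𝟙 X - f)

theorem IsLocalObj.of_iso {X Y : V} (h : IsLocalObj X) (e : X ≅ Y) : IsLocalObj Y := by
  refine ⟨fun hY => h.1 (hY.of_iso e), fun f => ?_⟩
  rcases h.2 (e.hom ≫ f ≫ e.inv) with h | h
  · left
    have : f = e.inv ≫ (e.hom ≫ f ≫ e.inv) ≫ e.hom := by simp
    rw [this]; infer_instance
  · right
    have : 𝟙 Y - f = e.inv ≫ (𝟙 X - e.hom ≫ f ≫ e.inv) ≫ e.hom := by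
      simp [Preadditive.sub_comp, Preadditive.comp_sub]
    rw [this]; infer_instance

/-- After multiplication by the inverse of the sum, the two terms have the form `x` and `1 - x`. -/
theorem IsLocalObj.isIso_of_add {X : V} (h : IsLocalObj X) {f g : X ⟶ X} (hu : IsIso (f + g)) :
    IsIso f ∨ IsIso g := by
  rcases h.2 (f ≫ inv (f + g)) with h | h
  · left
    have : f = (f ≫ inv (f + g)) ≫ (f + g) := by
      rw [Category.assoc, IsIso.inv_hom_id, Category.comp_id]
    rw [this]; infer_instance
  · right
    have : g = (𝟙 X - f ≫ inv (f + g)) ≫ (f + g) := by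
      rw [Preadditive.sub_comp, Category.assoc, IsIso.inv_hom_id, Category.comp_id,
        Category.id_comp, add_sub_cancel_left]
    rw [this]; infer_instance

theorem IsLocalObj.exists_isIso_of_sum {X : V} (h : IsLocalObj X) {ι : Type*} (s : Finset ι)
    (f : ι → (X ⟶ X)) (hu : IsIso (∑ a ∈ s, f a)) : ∃ a ∈ s, IsIso (f a) := by
  classical
  induction s using Finset.induction_on with
  | empty =>
    simp only [Finset.sum_empty] at hu
    exact absurd ((IsZero.iff_id_eq_zero X).2 (by
      rw [← IsIso.hom_inv_id (0 : X ⟶ X), zero_comp])) h.1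
  | insert a s ha ih =>
    rw [Finset.sum_insert ha] at hu
    rcases h.isIso_of_add hu with h1 | h1
    · exact ⟨a, by simp, h1⟩
    · obtain ⟨b, hb, h2⟩ := ih h1
      exact ⟨b, by simp [hb], h2⟩

variable [HasBinaryBiproducts V]

/-- Splitting both `e` and `1 - e` writes `X` as a biproduct, and one of the two factors is zero. -/
theorem _root_.CategoryTheory.Indecomposable.idem [IsIdempotentComplete V] {X : V}
    (h : Indecomposable X) (e : X ⟶ X) (he : e ≫ e = e) : e = 0 ∨ e = 𝟙 X := by
  obtain ⟨Y, i, p, hip, hpi⟩ := IsIdempotentComplete.idempotents_split X e he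
  obtain ⟨Z, j, q, hjq, hqj⟩ := IsIdempotentComplete.idempotents_split X (𝟙 X - e) (by
    simp [Preadditive.sub_comp, Preadditive.comp_sub, he])
  have hiq : i ≫ q = 0 := by
    have : i ≫ e = i := by rw [← hpi, reassoc_of% hip]
    have h2 : i ≫ q ≫ j = 0 := by rw [hqj, Preadditive.comp_sub, this]; simp
    calc i ≫ q = (i ≫ q ≫ j) ≫ q := by simp [hjq]
      _ = 0 := by rw [h2, zero_comp]
  have hjp : j ≫ p = 0 := by
    have : j ≫ (𝟙 X - e) = j := by rw [← hqj, reassoc_of% hjq]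
    have h3 : j ≫ e = 0 := by simpa [Preadditive.comp_sub] using this
    have h2 : j ≫ p ≫ i = 0 := by rw [hpi, h3]
    calc j ≫ p = (j ≫ p ≫ i) ≫ p := by simp [hip]
      _ = 0 := by rw [h2, zero_comp]
  let a : X ≅ Y ⊞ Z :=
    { hom := biprod.lift p q
      inv := biprod.desc i j
      hom_inv_id := by simp [biprod.lift_desc, hpi, hqj]
      inv_hom_id := by
        apply biprod.hom_ext' <;> apply biprod.hom_ext <;> simp [hip, hiq, hjp, hjq] }
  rcases h.2 Y Z a with hY | hZ
  · left; rw [← hpi, hY.eq_of_tgt p 0, zero_comp]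
  · right
    have : 𝟙 X - e = 0 := by rw [← hqj, hZ.eq_of_tgt q 0, zero_comp]
    exact (sub_eq_zero.1 this).symm

/-- A decomposition yields the idempotent projecting onto its first summand. This form is convenient
for the involution, which transports idempotents but is not given as an additive functor. -/
theorem indecomposable_of_idem {X : V} (h0 : ¬ IsZero X)
    (h : ∀ e : X ⟶ X, e ≫ e = e → e = 0 ∨ e = 𝟙 X) : Indecomposable X := by
  refine ⟨h0, fun Y Z a => ?_⟩
  rcases h (a.hom ≫ biprod.fst ≫ biprod.inl ≫ a.inv) (by simp) with h | h
  · left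
    rw [IsZero.iff_id_eq_zero]
    calc 𝟙 Y = (biprod.inl ≫ a.inv) ≫ (a.hom ≫ biprod.fst ≫ biprod.inl ≫ a.inv) ≫
        a.hom ≫ biprod.fst := by simp
      _ = 0 := by rw [h]; simp
  · right
    rw [IsZero.iff_id_eq_zero]
    calc 𝟙 Z = (biprod.inr ≫ a.inv) ≫ 𝟙 X ≫ a.hom ≫ biprod.snd := by simp
      _ = 0 := by rw [← h]; simp

theorem _root_.CategoryTheory.Indecomposable.of_iso {X Y : V} (h : Indecomposable X)
    (e : X ≅ Y) : Indecomposable Y :=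
  ⟨fun hY => h.1 (hY.of_iso e), fun A B a => h.2 A B (e ≪≫ a)⟩

/-- A nonzero retract of an indecomposable object is isomorphic to it. -/
theorem _root_.CategoryTheory.Indecomposable.iso_of_retract [IsIdempotentComplete V]
    {X Y : V} (h : Indecomposable Y)
    (hX : ¬ IsZero X) (r : Retract X Y) : Nonempty (X ≅ Y) := by
  rcases h.idem (r.r ≫ r.i) (by simp) with h | h
  · refine absurd ((IsZero.iff_id_eq_zero X).2 ?_) hX
    calc 𝟙 X = r.i ≫ (r.r ≫ r.i) ≫ r.r := by simp
      _ = 0 := by rw [h]; simp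
  · exact ⟨⟨r.i, r.r, r.retract, h⟩⟩

variable (k : Type uk) [Field k] [Linear k V]

theorem _root_.CategoryTheory.Indecomposable.isLocalObj [IsIdempotentComplete V] {X : V}
    (h : Indecomposable X)
    [hf : Module.Finite k (X ⟶ X)] : IsLocalObj X := by
  refine ⟨h.1, fun f => ?_⟩
  have : Module.Finite k (End X) := hf
  have := isUnit_or_isUnit_one_sub (k := k) (E := End X) (fun e he => h.idem e he) f
  rw [isUnit_iff_isIso, isUnit_iff_isIso] at this
  exact this

/-- Every object is a finite direct sum of indecomposable objects. -/
theorem exists_decomposition [HasZeroObject V] (hf : ∀ X Y : V, Module.Finite k (X ⟶ Y)) (X : V) :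
    ∃ (ι : Type) (_ : Fintype ι) (F : ι → V) (i : ∀ a, F a ⟶ X) (p : ∀ a, X ⟶ F a),
      (∀ a, Indecomposable (F a)) ∧ (∀ a, i a ≫ p a = 𝟙 (F a)) ∧
      (∀ a b, a ≠ b → i a ≫ p b = 0) ∧ ∑ a, p a ≫ i a = 𝟙 X := by
  induction hn : Module.finrank k (X ⟶ X) using Nat.strong_induction_on generalizing X with
  | _ n ih =>
    by_cases h0 : IsZero X
    · exact ⟨Empty, inferInstance, Empty.elim, fun a => a.elim, fun a => a.elim, fun a => a.elim,
        fun a => a.elim, fun a => a.elim, h0.eq_of_src _ _⟩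
    by_cases hX : Indecomposable X
    · exact ⟨Unit, inferInstance, fun _ => X, fun _ => 𝟙 X, fun _ => 𝟙 X, fun _ => hX, by simp,
        fun a b h => (h rfl).elim, by simp⟩
    have : ∃ (Y Z : V) (a : X ≅ Y ⊞ Z), ¬ IsZero Y ∧ ¬ IsZero Z := by
      by_contra hc
      push Not at hc
      exact hX ⟨h0, fun Y Z a => by
        by_cases hY : IsZero Y
        · exact Or.inl hY
        · exact Or.inr (hc Y Z a hY)⟩
    obtain ⟨Y, Z, a, hY, hZ⟩ := this
    -- Block diagonal endomorphisms embed `End Y × End Z` into `End X`. Both factors are nonzero, so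
    -- both dimensions drop and the induction applies.
    have key : Module.finrank k (Y ⟶ Y) + Module.finrank k (Z ⟶ Z) ≤ n := by
      have := hf Y Y
      have := hf Z Z
      have := hf X X
      rw [← Module.finrank_prod, ← hn]
      let φ : ((Y ⟶ Y) × (Z ⟶ Z)) →ₗ[k] (X ⟶ X) :=
        { toFun := fun x => a.hom ≫ biprod.map x.1 x.2 ≫ a.inv
          map_add' := fun x y => by
            have : biprod.map (x + y).1 (x + y).2 = biprod.map x.1 x.2 + biprod.map y.1 y.2 := by
              apply biprod.hom_ext' <;> apply biprod.hom_ext <;> simp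
            rw [this]; simp
          map_smul' := fun c x => by
            have : biprod.map (c • x).1 (c • x).2 = c • biprod.map x.1 x.2 := by
              apply biprod.hom_ext' <;> apply biprod.hom_ext <;> simp
            rw [this]; simp }
      refine LinearMap.finrank_le_finrank_of_injective (f := φ) fun x y hxy => ?_
      have hxy : a.hom ≫ biprod.map x.1 x.2 ≫ a.inv = a.hom ≫ biprod.map y.1 y.2 ≫ a.inv := hxy
      have h1 : biprod.map x.1 x.2 = biprod.map y.1 y.2 := by
        simpa using hxy
      ext1
      · have := congrArg (fun t => biprod.inl ≫ t ≫ biprod.fst) h1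
        simpa using this
      · have := congrArg (fun t => biprod.inr ≫ t ≫ biprod.snd) h1
        simpa using this
    have hpos : ∀ W : V, ¬ IsZero W → 0 < Module.finrank k (W ⟶ W) := fun W hW => by
      have := hf W W
      rw [Module.finrank_pos_iff_exists_ne_zero]
      exact ⟨𝟙 W, fun h => hW ((IsZero.iff_id_eq_zero W).2 h)⟩
    have h1 := hpos Y hY
    have h2 := hpos Z hZ
    obtain ⟨ι, _, F, i, p, hF, hip, hne, hs⟩ := ih _ (by omega) Y rfl
    obtain ⟨ι', _, F', i', p', hF', hip', hne', hs'⟩ := ih _ (by omega) Z rfl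
    let i₀ : ∀ c : ι ⊕ ι', Sum.elim F F' c ⟶ X := fun c => match c with
        | .inl c => i c ≫ biprod.inl ≫ a.inv
        | .inr c => i' c ≫ biprod.inr ≫ a.inv
    let p₀ : ∀ c : ι ⊕ ι', X ⟶ Sum.elim F F' c := fun c => match c with
        | .inl c => a.hom ≫ biprod.fst ≫ p c
        | .inr c => a.hom ≫ biprod.snd ≫ p' c
    refine ⟨ι ⊕ ι', inferInstance, Sum.elim F F', i₀, p₀, ?_, ?_, ?_, ?_⟩
    · rintro (c | c)
      exacts [hF c, hF' c]
    · rintro (c | c)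
      · exact (show (i c ≫ biprod.inl ≫ a.inv) ≫ a.hom ≫ biprod.fst ≫ p c = 𝟙 _ by simp [hip])
      · exact (show (i' c ≫ biprod.inr ≫ a.inv) ≫ a.hom ≫ biprod.snd ≫ p' c = 𝟙 _ by simp [hip'])
    · rintro (c | c) (c' | c') h
      · exact (show (i c ≫ biprod.inl ≫ a.inv) ≫ a.hom ≫ biprod.fst ≫ p c' = 0 by
          simp [hne c c' (fun e => h (e ▸ rfl))])
      · exact (show (i c ≫ biprod.inl ≫ a.inv) ≫ a.hom ≫ biprod.snd ≫ p' c' = 0 by simp)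
      · exact (show (i' c ≫ biprod.inr ≫ a.inv) ≫ a.hom ≫ biprod.fst ≫ p c' = 0 by simp)
      · exact (show (i' c ≫ biprod.inr ≫ a.inv) ≫ a.hom ≫ biprod.snd ≫ p' c' = 0 by
          simp [hne' c c' (fun e => h (e ▸ rfl))])
    · have e1 : ∑ c, (a.hom ≫ biprod.fst ≫ p c) ≫ i c ≫ biprod.inl ≫ a.inv =
          a.hom ≫ (biprod.fst ≫ (∑ c, p c ≫ i c) ≫ biprod.inl) ≫ a.inv := by
        simp [Preadditive.sum_comp, Preadditive.comp_sum]
      have e2 : ∑ c, (a.hom ≫ biprod.snd ≫ p' c) ≫ i' c ≫ biprod.inr ≫ a.inv =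
          a.hom ≫ (biprod.snd ≫ (∑ c, p' c ≫ i' c) ≫ biprod.inr) ≫ a.inv := by
        simp [Preadditive.sum_comp, Preadditive.comp_sum]
      rw [Fintype.sum_sum_type]
      refine (congrArg₂ (· + ·) e1 e2).trans ?_
      rw [hs, hs', ← Preadditive.comp_add, ← Preadditive.add_comp]
      simp [biprod.total]

end Krull

end Fiat

end

noncomputable section

namespace Fiat

/-! ### Finite abelian categories -/

/-- Hom-finite with a projective generator. -/
structure IsFiniteAbelian (k : Type uk) [Field k] (D : Type u') [Category.{w} D] [Abelian D]
    [Linear k D] : Prop where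
  finite_hom (X Y : D) : Module.Finite k (X ⟶ Y)
  exists_generator : ∃ E : D, Projective E ∧ ∀ X : D, (∀ f : E ⟶ X, f = 0) → IsZero X

section Local

variable {D : Type u'} [Category.{w} D] [Abelian D]

theorem epi_of_ne_zero {X Y : D} [Simple Y] {f : X ⟶ Y} (h : f ≠ 0) : Epi f :=
  epi_of_nonzero_to_simple h

/-- A projective object with local endomorphism ring has only one simple quotient. -/
theorem exists_iso_of_top {P : D} [Projective P] (hP : IsLocalObj P) {T T' : D} [Simple T]
    [Simple T'] {t : P ⟶ T} {t' : P ⟶ T'} (ht : t ≠ 0) (ht' : t' ≠ 0) :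
    ∃ φ : T ≅ T', t ≫ φ.hom = t' := by
  have := epi_of_ne_zero ht
  -- Otherwise `t'` lifts to the kernel of `t`, giving an endomorphism of `P` that is killed by `t`
  -- and fixed by `t'`. By locality it or its complement is invertible, so `t` or `t'` vanishes.
  have h0 : kernel.ι t ≫ t' = 0 := by
    by_contra hc
    have := epi_of_ne_zero hc
    let s : P ⟶ kernel t := Projective.factorThru t' (kernel.ι t ≫ t')
    have hs : s ≫ kernel.ι t ≫ t' = t' := Projective.factorThru_comp _ _
    rcases hP.2 (s ≫ kernel.ι t) with h | h
    · apply ht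
      rw [← cancel_epi (s ≫ kernel.ι t)]
      simp
    · apply ht'
      rw [← cancel_epi (𝟙 P - s ≫ kernel.ι t)]
      simp [Preadditive.sub_comp, hs]
  have e : t ≫ Abelian.epiDesc t t' h0 = t' := Abelian.comp_epiDesc t t' h0
  have hne : Abelian.epiDesc t t' h0 ≠ 0 := fun h => ht' (by rw [← e, h, comp_zero])
  have := isIso_of_hom_simple hne
  exact ⟨asIso (Abelian.epiDesc t t' h0), e⟩

variable {k : Type uk} [Field k] [Linear k D]

/-- The dimension of `Hom(E, -)` replaces length: projectivity makes it additive and the generator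
property makes it strict on proper quotients, and likewise on proper subobjects. -/
theorem IsFiniteAbelian.finrank_lt_of_epi (hD : IsFiniteAbelian k D) {E : D} [Projective E]
    (hE : ∀ X : D, (∀ f : E ⟶ X, f = 0) → IsZero X) {X Z : D} (f : X ⟶ Z) [Epi f]
    (hf : ¬ IsIso f) : Module.finrank k (E ⟶ Z) < Module.finrank k (E ⟶ X) := by
  have := hD.finite_hom E X
  have := hD.finite_hom E Z
  have hs : Function.Surjective (Linear.rightComp k E f) := fun g =>
    ⟨Projective.factorThru g f, Projective.factorThru_comp _ _⟩
  have h1 := LinearMap.finrank_range_add_finrank_ker (Linear.rightComp k E f)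
  rw [LinearMap.range_eq_top.2 hs, finrank_top] at h1
  have h2 : 0 < Module.finrank k (Linear.rightComp k E f).ker := by
    rw [Module.finrank_pos_iff_exists_ne_zero]
    by_contra hc
    push Not at hc
    have hz : IsZero (kernel f) := hE _ fun g => by
      have := hc ⟨g ≫ kernel.ι f, by simp⟩
      have h3 : g ≫ kernel.ι f = 0 := congrArg Subtype.val this
      rwa [← cancel_mono (kernel.ι f), zero_comp]
    have : Mono f := Preadditive.mono_of_kernel_zero (hz.eq_of_src _ _)
    exact hf (isIso_of_mono_of_epi f)
  omega

theorem IsFiniteAbelian.finrank_lt_of_mono (hD : IsFiniteAbelian k D) {E : D} [Projective E]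
    (hE : ∀ X : D, (∀ f : E ⟶ X, f = 0) → IsZero X) {X Y : D} (f : Y ⟶ X) [Mono f]
    (hf : ¬ IsIso f) : Module.finrank k (E ⟶ Y) < Module.finrank k (E ⟶ X) := by
  have := hD.finite_hom E X
  have := hD.finite_hom E Y
  have hi : Function.Injective (Linear.rightComp k E f) := fun g h e => by
    rwa [← cancel_mono f]
  refine lt_of_le_of_ne (LinearMap.finrank_le_finrank_of_injective hi) fun he => hf ?_
  have hs : Function.Surjective (Linear.rightComp k E f) :=
    (LinearMap.injective_iff_surjective_of_finrank_eq_finrank he).1 hi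
  have hz : IsZero (cokernel f) := hE _ fun g => by
    obtain ⟨h, hh⟩ := hs (Projective.factorThru g (cokernel.π f))
    have hh : h ≫ f = _ := hh
    rw [← Projective.factorThru_comp g (cokernel.π f), ← hh]
    simp
  have : Epi f := Preadditive.epi_of_cokernel_zero (hz.eq_of_tgt _ _)
  exact isIso_of_mono_of_epi f

/-- Descend along proper nonzero quotients; an object without any is simple. -/
theorem IsFiniteAbelian.exists_simple_quotient (hD : IsFiniteAbelian k D) {X : D}
    (hX : ¬ IsZero X) : ∃ (T : D) (p : X ⟶ T), Simple T ∧ Epi p := by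
  obtain ⟨E, _, hE⟩ := hD.exists_generator
  induction hn : Module.finrank k (E ⟶ X) using Nat.strong_induction_on generalizing X with
  | _ n ih =>
    by_cases h : ∃ (Z : D) (f : X ⟶ Z), Epi f ∧ ¬ IsIso f ∧ f ≠ 0
    · obtain ⟨Z, f, _, hf, hf0⟩ := h
      obtain ⟨T, p, hT, _⟩ := ih _ (hn ▸ hD.finrank_lt_of_epi hE f hf)
        (fun hZ => hf0 (hZ.eq_of_tgt _ _)) rfl
      exact ⟨T, f ≫ p, hT, epi_comp _ _⟩
    · push Not at h
      refine ⟨X, 𝟙 X, simple_of_cosimple X fun {Z} f _ => ⟨fun hi h0 => hX ?_, fun h0 => ?_⟩,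
        inferInstance⟩
      · rw [IsZero.iff_id_eq_zero, ← cancel_mono f]; simp [h0]
      · by_contra hc
        exact h0 (h Z f inferInstance hc)

theorem IsFiniteAbelian.exists_simple_sub (hD : IsFiniteAbelian k D) {X : D}
    (hX : ¬ IsZero X) : ∃ (T : D) (p : T ⟶ X), Simple T ∧ Mono p := by
  obtain ⟨E, _, hE⟩ := hD.exists_generator
  induction hn : Module.finrank k (E ⟶ X) using Nat.strong_induction_on generalizing X with
  | _ n ih =>
    by_cases h : ∃ (Z : D) (f : Z ⟶ X), Mono f ∧ ¬ IsIso f ∧ f ≠ 0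
    · obtain ⟨Z, f, _, hf, hf0⟩ := h
      obtain ⟨T, p, hT, _⟩ := ih _ (hn ▸ hD.finrank_lt_of_mono hE f hf)
        (fun hZ => hf0 (hZ.eq_of_src _ _)) rfl
      exact ⟨T, p ≫ f, hT, mono_comp _ _⟩
    · push Not at h
      refine ⟨X, 𝟙 X, ⟨fun {Z} f _ => ⟨fun hi h0 => hX ?_, fun h0 => ?_⟩⟩, inferInstance⟩
      · rw [IsZero.iff_id_eq_zero, ← cancel_epi f]; simp [h0]
      · by_contra hc
        exact h0 (h Z f inferInstance hc)

/-- Two nonzero maps to `T` differ by an automorphism of `T`, which is a scalar by Schur's lemma. -/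
theorem IsFiniteAbelian.finrank_top [IsAlgClosed k] (hD : IsFiniteAbelian k D)
    {P T : D} [Projective P]
    (hP : IsLocalObj P) [Simple T] {t : P ⟶ T} (ht : t ≠ 0) : Module.finrank k (P ⟶ T) = 1 := by
  have := hD.finite_hom T T
  refine finrank_eq_one t ht fun f => ?_
  by_cases hf : f = 0
  · exact ⟨0, by simp [hf]⟩
  · obtain ⟨φ, hφ⟩ := exists_iso_of_top hP ht hf
    obtain ⟨c, hc⟩ := endomorphism_simple_eq_smul_id k φ.hom
    exact ⟨c, by rw [← hφ, ← hc]; simp⟩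

/-- If `g` had a nonzero cokernel, a simple quotient of it would be a simple quotient of `P`, hence
the top `T`, and then `t` would kill `g`. -/
theorem IsFiniteAbelian.epi_of_comp_top (hD : IsFiniteAbelian k D) {X P T : D} [Projective P]
    (hP : IsLocalObj P) [Simple T] {t : P ⟶ T} (ht : t ≠ 0) (g : X ⟶ P) (hg : g ≫ t ≠ 0) :
    Epi g := by
  by_contra hc
  have hz : ¬ IsZero (cokernel g) := fun hz =>
    hc (Preadditive.epi_of_cokernel_zero (hz.eq_of_tgt _ _))
  obtain ⟨T', p, _, _⟩ := hD.exists_simple_quotient hz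
  have h0 : cokernel.π g ≫ p ≠ 0 := fun h => by
    have : p = 0 := by rw [← cancel_epi (cokernel.π g), h, comp_zero]
    exact Simple.not_isZero T' ((IsZero.iff_id_eq_zero T').2 (by
      rw [← cancel_epi p, this, zero_comp, zero_comp]))
  obtain ⟨φ, hφ⟩ := exists_iso_of_top hP h0 ht
  apply hg
  rw [← hφ]
  simp

end Local

/-! ### Module categories are finite abelian -/

section ModuleCategory

variable {k : Type uk} [Field k] {D : Type u'} [Category.{w} D] [Preadditive D] [Linear k D]

/-- The equality pins the additive structure, so that linear structures and additive functors
already in use stay compatible with the abelian one. -/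
theorem IsModuleCategory.exists_abelian (h : IsModuleCategory k D) :
    ∃ a : Abelian D, a.toPreadditive = ‹Preadditive D› := by
  obtain ⟨A, _, _, _, e, _, _⟩ := h
  have : IsNoetherianRing A := IsNoetherianRing.of_finite k A
  have : HasFiniteProducts D :=
    ⟨fun n => Adjunction.hasLimitsOfShape_of_equivalence e.functor⟩
  exact ⟨abelianOfEquivalence e.functor, rfl⟩

/-- The abelian structure on a module category. -/
@[reducible] def IsModuleCategory.abelian (h : IsModuleCategory k D) : Abelian D where
  toPreadditive := inferInstance
  normalMonoOfMono := by obtain ⟨a, rfl⟩ := h.exists_abelian; exact a.normalMonoOfMono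
  normalEpiOfEpi := by obtain ⟨a, rfl⟩ := h.exists_abelian; exact a.normalEpiOfEpi
  has_finite_products := by obtain ⟨a, rfl⟩ := h.exists_abelian; exact a.has_finite_products
  has_kernels := by obtain ⟨a, rfl⟩ := h.exists_abelian; exact a.has_kernels
  has_cokernels := by obtain ⟨a, rfl⟩ := h.exists_abelian; exact a.has_cokernels

open scoped ModuleCat in
theorem FGModuleCat.finite_hom (A : Type w) [Ring A] [Algebra k A] [Module.Finite k A]
    (M N : FGModuleCat.{w} A) : Module.Finite k (M ⟶ N) := by
  have : Module.Finite k M.obj := Module.Finite.trans A M.obj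
  have : Module.Finite k N.obj := Module.Finite.trans A N.obj
  let φ : (M ⟶ N) →ₗ[k] (M.obj →ₗ[k] N.obj) :=
    { toFun := fun f => f.hom.hom.restrictScalars k
      map_add' := fun f g => rfl
      map_smul' := fun c f => rfl }
  refine Module.Finite.of_injective φ fun f g hfg => ?_
  apply ObjectProperty.hom_ext
  ext x
  exact LinearMap.congr_fun hfg x

theorem FGModuleCat.projective_self (A : Type w) [Ring A] [IsNoetherianRing A] :
    Projective (FGModuleCat.of A A) where
  factors {N M} f e he := by
    have : Epi ((forget₂ (FGModuleCat A) (ModuleCat A)).map e) := inferInstance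
    have hs := (ModuleCat.epi_iff_surjective _).1 this
    obtain ⟨x, hx⟩ := hs (f.hom.hom 1)
    refine ⟨FGModuleCat.ofHom (LinearMap.toSpanSingleton A N x), ?_⟩
    apply ObjectProperty.hom_ext
    apply ModuleCat.hom_ext
    apply LinearMap.ext_ring
    have h1 : e.hom.hom x = f.hom.hom 1 := hx
    exact (congrArg e.hom.hom (one_smul A x)).trans h1

theorem IsModuleCategory.isFiniteAbelian (h : IsModuleCategory k D) :
    let := h.abelian
    IsFiniteAbelian k D := by
  let := h.abelian
  obtain ⟨A, _, _, _, e, _, _⟩ := h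
  have : IsNoetherianRing A := IsNoetherianRing.of_finite k A
  refine ⟨fun X Y => ?_, e.inverse.obj (FGModuleCat.of A A), ?_, fun X hX => ?_⟩
  · have := FGModuleCat.finite_hom (k := k) A (e.functor.obj X) (e.functor.obj Y)
    exact Module.Finite.of_injective (e.functor.mapLinearMap k) e.functor.map_injective
  · exact (e.symm.toAdjunction).map_projective _ (FGModuleCat.projective_self A)
  · rw [IsZero.iff_id_eq_zero]
    apply e.functor.map_injective
    apply ObjectProperty.hom_ext
    ext x
    let g : FGModuleCat.of A A ⟶ e.functor.obj X :=
      FGModuleCat.ofHom (LinearMap.toSpanSingleton A (e.functor.obj X) x)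
    have h1 := hX (e.inverse.map g ≫ e.unitInv.app X)
    have h2 : e.inverse.map g = 0 := by
      rw [← cancel_mono (e.unitInv.app X), h1, zero_comp]
    have h3 : g = 0 := e.inverse.map_injective (by rw [h2, Functor.map_zero])
    have h4 : g.hom.hom (1 : A) = 0 := by rw [h3]; rfl
    have h5 : x = 0 := (one_smul A x).symm.trans h4
    simp [h5]

end ModuleCategory

/-! ### A criterion for module categories -/

section Criterion

variable (k : Type uk) [Field k] {D : Type u'} [Category.{w} D] [Preadditive D] [Linear k D]

/-- `p` is a cokernel of `f` and `Hom(E, -)` is right exact on it. -/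
structure IsExactCoker (E : D) {X₁ X₀ X : D} (f : X₁ ⟶ X₀) (p : X₀ ⟶ X) : Prop where
  zero : f ≫ p = 0
  isColimit : Nonempty (IsColimit (CokernelCofork.ofπ p zero))
  lift (g : E ⟶ X) : ∃ g' : E ⟶ X₀, g' ≫ p = g
  exact (g : E ⟶ X₀) (hg : g ≫ p = 0) : ∃ g' : E ⟶ X₁, g' ≫ f = g

theorem IsExactCoker.hom_ext {E X₁ X₀ X : D} {f : X₁ ⟶ X₀} {p : X₀ ⟶ X}
    (h : IsExactCoker E f p) {Y : D} {g g' : X ⟶ Y} (e : p ≫ g = p ≫ g') : g = g' :=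
  Cofork.IsColimit.hom_ext h.isColimit.some e

theorem IsExactCoker.exists_desc {E X₁ X₀ X : D} {f : X₁ ⟶ X₀} {p : X₀ ⟶ X}
    (h : IsExactCoker E f p) {Y : D} (g : X₀ ⟶ Y) (e : f ≫ g = 0) : ∃ l : X ⟶ Y, p ≫ l = g :=
  ⟨_, (CokernelCofork.IsColimit.desc' h.isColimit.some g e).2⟩

/-- An endomorphism as a scalar acting on `Hom(E, -)`. -/
def opEnd {E : D} (e : E ⟶ E) : (End E)ᵐᵒᵖ := MulOpposite.op (α := End E) e

/-- The equivalence is `Hom(E, -)` with values in modules over `End(E)ᵐᵒᵖ`. Presentations by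
retracts of powers of `E` give full faithfulness, and finite presentations of modules lift to maps
between powers of `E`. No abelian structure on `D` is presupposed, because for cell categories it is
only obtained from this criterion. -/
theorem isModuleCategory_of_generator (hfin : ∀ X Y : D, Module.Finite k (X ⟶ Y)) (E : D)
    (b : ∀ n : ℕ, Bicone fun _ : Fin n => E) (hb : ∀ n, (b n).IsBilimit)
    (hcok : ∀ (m n : ℕ) (f : (b m).pt ⟶ (b n).pt), ∃ (X : D) (p : (b n).pt ⟶ X),
      IsExactCoker E f p)
    (hpres : ∀ X : D, ∃ (X₁ X₀ : D) (f : X₁ ⟶ X₀) (p : X₀ ⟶ X) (n : ℕ),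
      IsExactCoker E f p ∧ Nonempty (Retract X₀ (b n).pt)) : IsModuleCategory k D := by
  classical
  have hbt : ∀ n, ∑ a, (b n).π a ≫ (b n).ι a = 𝟙 (b n).pt := fun n => IsBilimit.total (hb n)
  have hA : Module.Finite k (End E) := hfin E E
  have : Module.Finite k (End E)ᵐᵒᵖ := Module.Finite.equiv (MulOpposite.opLinearEquiv k)
  have : IsNoetherianRing (End E)ᵐᵒᵖ := IsNoetherianRing.of_finite k _
  have hM : ∀ X : D, Module.Finite (End E)ᵐᵒᵖ ((preadditiveCoyonedaObj E).obj X) := fun X => by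
    obtain ⟨s, hs⟩ := hfin E X
    refine ⟨s, ?_⟩
    rw [eq_top_iff]
    intro x _
    have hx : x ∈ Submodule.span k (s : Set (E ⟶ X)) := by rw [hs]; trivial
    induction hx using Submodule.span_induction with
    | mem x h => exact Submodule.subset_span h
    | zero => exact Submodule.zero_mem _
    | add x y _ _ h1 h2 => exact Submodule.add_mem _ (h1 trivial) (h2 trivial)
    | smul c x _ h =>
      have e : ∀ y : E ⟶ X, (c • 𝟙 E) ≫ y = c • y := by simp
      have h2 := Submodule.smul_mem _ (opEnd (c • 𝟙 E)) (h trivial)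
      exact (e x) ▸ h2
  let Φ : D ⥤ FGModuleCat.{w} (End E)ᵐᵒᵖ :=
    ObjectProperty.lift _ (preadditiveCoyonedaObj E) hM
  have Φ_map : ∀ {X Y : D} (f : X ⟶ Y) (x : E ⟶ X), (Φ.map f).hom.hom x = x ≫ f :=
    fun f x => rfl
  have ext_gen : ∀ {X Y : D} (f g : X ⟶ Y), (∀ x : E ⟶ X, x ≫ f = x ≫ g) → f = g := by
    intro X Y f g h
    obtain ⟨X₁, X₀, d, p, n, hp, ⟨r⟩⟩ := hpres X
    refine hp.hom_ext ?_
    have h1 : r.r ≫ p ≫ f = r.r ≫ p ≫ g := by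
      rw [← Category.id_comp (r.r ≫ p ≫ f), ← Category.id_comp (r.r ≫ p ≫ g), ← hbt n]
      simp only [Preadditive.sum_comp, Category.assoc]
      refine Finset.sum_congr rfl fun a _ => ?_
      have := h ((b n).ι a ≫ r.r ≫ p)
      simp only [Category.assoc] at this
      rw [this]
    have := congrArg (r.i ≫ ·) h1
    simpa using this
  have : Φ.Faithful := ⟨fun {X Y f g} h => ext_gen f g fun x => by
    rw [← Φ_map f x, h, Φ_map]⟩
  have φ_smul : ∀ {X Y : D} (φ : Φ.obj X ⟶ Φ.obj Y) (e : E ⟶ E) (x : E ⟶ X),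
      φ.hom.hom (e ≫ x : E ⟶ X) = e ≫ (φ.hom.hom x : E ⟶ Y) := fun φ e x =>
    φ.hom.hom.map_smul (opEnd e) x
  have φ_sum : ∀ {X Y : D} (φ : Φ.obj X ⟶ Φ.obj Y) {n : ℕ} (x : Fin n → (E ⟶ X)),
      φ.hom.hom (∑ a, x a : E ⟶ X) = (∑ a, (φ.hom.hom (x a) : E ⟶ Y) : E ⟶ Y) := fun φ n x =>
    map_sum φ.hom.hom x Finset.univ
  -- A module map out of a retract of a power of `E` is determined by its values on the coordinate
  -- inclusions followed by the retraction.
  have full_retract : ∀ {X Y : D} (n : ℕ) (r : Retract X (b n).pt) (φ : Φ.obj X ⟶ Φ.obj Y),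
      ∃ f : X ⟶ Y, ∀ x : E ⟶ X, x ≫ f = φ.hom.hom x := by
    intro X Y n r φ
    refine ⟨r.i ≫ ∑ a, (b n).π a ≫ (φ.hom.hom ((b n).ι a ≫ r.r : E ⟶ X) : E ⟶ Y), fun x => ?_⟩
    have hx : x = ∑ a, (x ≫ r.i ≫ (b n).π a) ≫ (b n).ι a ≫ r.r := by
      calc x = x ≫ r.i ≫ (∑ a, (b n).π a ≫ (b n).ι a) ≫ r.r := by rw [hbt]; simp
        _ = _ := by simp [Preadditive.sum_comp, Preadditive.comp_sum]
    conv_rhs => rw [hx, φ_sum]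
    simp only [Preadditive.comp_sum]
    refine Finset.sum_congr rfl fun a _ => ?_
    have assoc₂ : ∀ y : E ⟶ Y, x ≫ r.i ≫ (b n).π a ≫ y = (x ≫ r.i ≫ (b n).π a) ≫ y := by simp
    exact (assoc₂ _).trans (φ_smul φ _ _).symm
  have : Φ.Full := ⟨fun {X Y} φ => by
    obtain ⟨X₁, X₀, d, p, n, hp, ⟨r⟩⟩ := hpres X
    obtain ⟨g, hg⟩ := full_retract n r (Φ.map p ≫ φ)
    have hg : ∀ x : E ⟶ X₀, x ≫ g = φ.hom.hom (x ≫ p : E ⟶ X) := hg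
    obtain ⟨f, hf⟩ := hp.exists_desc g (ext_gen _ _ fun x => by
      rw [← Category.assoc, hg, Category.assoc, hp.zero, comp_zero, comp_zero]
      exact map_zero φ.hom.hom)
    refine ⟨f, ?_⟩
    apply ObjectProperty.hom_ext
    apply ModuleCat.hom_ext
    refine LinearMap.ext fun (x : E ⟶ X) => ?_
    rw [Φ_map]
    obtain ⟨x, rfl⟩ := hp.lift x
    rw [Category.assoc, hf, hg]⟩
  have : Φ.EssSurj := ⟨fun N => by
    obtain ⟨n, s, hs⟩ := Module.Finite.exists_fin (R := (End E)ᵐᵒᵖ) (M := N)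
    let ψ : (Φ.obj (b n).pt) →ₗ[(End E)ᵐᵒᵖ] N :=
      { toFun := fun (x : E ⟶ (b n).pt) => ∑ a, opEnd (x ≫ (b n).π a) • s a
        map_add' := fun (x y : E ⟶ (b n).pt) => by
          rw [← Finset.sum_add_distrib]
          refine Finset.sum_congr rfl fun a _ => ?_
          rw [← add_smul]
          congr 1
          refine congrArg (opEnd (E := E)) (?_ : (x + y) ≫ (b n).π a = _)
          rw [Preadditive.add_comp]
          rfl
        map_smul' := fun e (x : E ⟶ (b n).pt) => by
          simp only [RingHom.id_apply, Finset.smul_sum, smul_smul]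
          refine Finset.sum_congr rfl fun a _ => ?_
          congr 1
          exact congrArg (opEnd (E := E))
            (Category.assoc (show E ⟶ E from e.unop) x ((b n).π a)) }
    have ψ_apply : ∀ x : E ⟶ (b n).pt,
        ψ x = ∑ a, opEnd (x ≫ (b n).π a) • s a := fun x => rfl
    have ψ_surj : Function.Surjective ψ := by
      rw [← LinearMap.range_eq_top, eq_top_iff, ← hs, Submodule.span_le]
      rintro _ ⟨a, rfl⟩
      refine ⟨((b n).ι a : E ⟶ (b n).pt), ?_⟩
      rw [ψ_apply, Finset.sum_eq_single a]
      · rw [bicone_ι_π_self]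
        exact one_smul _ _
      · intro c _ hc
        rw [bicone_ι_π_ne _ (Ne.symm hc)]
        exact zero_smul _ _
      · simp
    -- The kernel is finitely generated since the ring is Noetherian. Its generators are maps from
    -- `E` to a power of `E`; they assemble into the `f` whose cokernel realizes `N`.
    obtain ⟨m, t, ht⟩ := Module.Finite.exists_fin (R := (End E)ᵐᵒᵖ) (M := ψ.ker)
    let t' : Fin m → (E ⟶ (b n).pt) := fun a => (t a : Φ.obj (b n).pt)
    let f : (b m).pt ⟶ (b n).pt := ∑ a, (b m).π a ≫ t' a
    have hf : ∀ a, (b m).ι a ≫ f = t' a := fun a => by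
      simp only [f, Preadditive.comp_sum]
      rw [Finset.sum_eq_single a]
      · rw [← Category.assoc, bicone_ι_π_self, Category.id_comp]
      · intro c _ hc
        rw [← Category.assoc, bicone_ι_π_ne _ (Ne.symm hc), zero_comp]
      · simp
    obtain ⟨X, p, hp⟩ := hcok m n f
    have hker : (Φ.map p).hom.hom.ker = ψ.ker := by
      apply le_antisymm
      · intro (x : E ⟶ (b n).pt) hx
        have hx : x ≫ p = 0 := hx
        obtain ⟨y, rfl⟩ := hp.exact x hx
        have : y ≫ f = ∑ a, (y ≫ (b m).π a) ≫ t' a := by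
          simp [f, Preadditive.comp_sum]
        rw [this]
        exact Submodule.sum_mem ψ.ker fun a _ =>
          Submodule.smul_mem ψ.ker (opEnd (y ≫ (b m).π a)) (t a).2
      · have : ψ.ker = Submodule.map ψ.ker.subtype ⊤ := by simp
        rw [this, ← ht, Submodule.map_span, Submodule.span_le]
        rintro _ ⟨_, ⟨a, rfl⟩, rfl⟩
        change t' a ≫ p = 0
        rw [← hf, Category.assoc, hp.zero, comp_zero]
    have hps : Function.Surjective (Φ.map p).hom.hom := fun (x : E ⟶ X) => by
      obtain ⟨y, hy⟩ := hp.lift x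
      exact ⟨y, hy⟩
    let l : Φ.obj X ≃ₗ[(End E)ᵐᵒᵖ] N :=
      ((Φ.map p).hom.hom.quotKerEquivOfSurjective hps).symm.trans
        ((Submodule.quotEquivOfEq _ _ hker).trans (ψ.quotKerEquivOfSurjective ψ_surj))
    exact ⟨X, ⟨l.toFGModuleCatIso⟩⟩⟩
  have : Φ.IsEquivalence := { }
  refine ⟨(End E)ᵐᵒᵖ, inferInstance, inferInstance, inferInstance, Φ.asEquivalence, ?_, ?_⟩
  · exact ⟨fun {X Y f g} => by
      apply ObjectProperty.hom_ext
      apply ModuleCat.hom_ext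
      exact LinearMap.ext fun (x : E ⟶ X) => Preadditive.comp_add _ _ _ x f g⟩
  · exact ⟨fun {X Y} f c => by
      apply ObjectProperty.hom_ext
      apply ModuleCat.hom_ext
      refine LinearMap.ext fun (x : E ⟶ X) => ?_
      change x ≫ (c • f) = (c • 𝟙 E) ≫ x ≫ f
      simp⟩

end Criterion

end Fiat

end

noncomputable section

namespace Fiat

/-! ### The right Freyd category -/

section RightFreyd

variable {V : Type u} [Category.{v} V] [Preadditive V]

theorem cls_eq_zero_iff {X Y : Preadditive.RightFreyd V} (f : arr X ⟶ arr Y) :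
    cls f = 0 ↔ ∃ h : (arr X).right ⟶ (arr Y).left, f.right = h ≫ (arr Y).hom := by
  have : cls f = 0 ↔ (Preadditive.RightFreyd.quotient V).map f = 0 := Iff.rfl
  rw [this, Preadditive.RightFreyd.quotient_map_eq_zero_iff]
  constructor
  · rintro ⟨h⟩
    refine ⟨h.hom, ?_⟩
    have := h.comm
    simpa using this
  · rintro ⟨h, hh⟩
    exact ⟨⟨h, by simpa using hh⟩⟩

variable [HasZeroObject V]

/-- The projective object `0 → A`. -/
abbrev pr (V : Type u) [Category.{v} V] [Preadditive V] [HasZeroObject V] :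
    V ⥤ Preadditive.RightFreyd V :=
  Preadditive.RightFreyd.functor V

/-- The canonical projection from the target of a presentation. -/
def fromPr (X : Preadditive.RightFreyd V) : (pr V).obj (arr X).right ⟶ X :=
  cls (X := (pr V).obj (arr X).right) (Arrow.homMk 0 (𝟙 _) (by
    exact (zero_comp.trans zero_comp.symm)))

theorem pr_map_fromPr (X : Preadditive.RightFreyd V) {A : V} (h : A ⟶ (arr X).right) :
    (pr V).map h ≫ fromPr X = cls (X := (pr V).obj A) (Arrow.homMk 0 h
      (by exact (zero_comp.trans zero_comp.symm))) := by
  refine (cls_comp (X := (pr V).obj A) (Y := (pr V).obj _) (Z := X) _ _).trans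
    (cls_congr (X := (pr V).obj A) ?_ ?_)
  · exact zero_comp
  · exact Category.comp_id h

theorem exists_pr_map_fromPr {X : Preadditive.RightFreyd V} {A : V} (g : (pr V).obj A ⟶ X) :
    ∃ h : A ⟶ (arr X).right, (pr V).map h ≫ fromPr X = g := by
  obtain ⟨g, rfl⟩ := cls_surj g
  refine ⟨g.right, ?_⟩
  exact (pr_map_fromPr X (A := A) g.right).trans
    (cls_congr (X := (pr V).obj A) ((isZero_zero V).eq_of_src _ _) rfl)

theorem pr_map_fromPr_eq_zero_iff {X : Preadditive.RightFreyd V} {A : V}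
    (h : A ⟶ (arr X).right) :
    (pr V).map h ≫ fromPr X = 0 ↔ ∃ h' : A ⟶ (arr X).left, h = h' ≫ (arr X).hom := by
  rw [pr_map_fromPr, cls_eq_zero_iff]
  rfl

theorem fromPr_comp {X Y : Preadditive.RightFreyd V} (f : arr X ⟶ arr Y) :
    fromPr X ≫ cls f = (pr V).map f.right ≫ fromPr Y := by
  rw [pr_map_fromPr]
  refine (cls_comp (X := (pr V).obj _) (Y := X) (Z := Y) _ _).trans
    (cls_congr (X := (pr V).obj _) ?_ ?_)
  · exact zero_comp
  · exact Category.id_comp f.right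

theorem fromPr_zero (X : Preadditive.RightFreyd V) : (pr V).map (arr X).hom ≫ fromPr X = 0 :=
  (pr_map_fromPr_eq_zero_iff _).2 ⟨𝟙 _, by simp⟩

theorem fromPr_hom_ext {X Y : Preadditive.RightFreyd V} {g g' : X ⟶ Y}
    (h : fromPr X ≫ g = fromPr X ≫ g') : g = g' := by
  rw [← sub_eq_zero] at h ⊢
  rw [← Preadditive.comp_sub] at h
  obtain ⟨f, hf⟩ := cls_surj (g - g')
  rw [← hf, fromPr_comp] at h
  obtain ⟨h', hh'⟩ := (pr_map_fromPr_eq_zero_iff _).1 h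
  rw [← hf, cls_eq_zero_iff]
  exact ⟨h', hh'⟩

instance (X : Preadditive.RightFreyd V) : Epi (fromPr X) := ⟨fun _ _ h => fromPr_hom_ext h⟩

/-- Every object is the cokernel of its presentation. -/
theorem fromPr_isColimit (X : Preadditive.RightFreyd V) :
    Nonempty (IsColimit (CokernelCofork.ofπ (fromPr X) (fromPr_zero X))) := by
  have key : ∀ {Y : Preadditive.RightFreyd V} (g : (pr V).obj (arr X).right ⟶ Y),
      (pr V).map (arr X).hom ≫ g = 0 → ∃ l : X ⟶ Y, fromPr X ≫ l = g := by
    intro Y g hg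
    obtain ⟨h, rfl⟩ := exists_pr_map_fromPr g
    rw [← Category.assoc, ← Functor.map_comp] at hg
    obtain ⟨h', hh'⟩ := (pr_map_fromPr_eq_zero_iff _).1 hg
    exact ⟨cls (Arrow.homMk h' h hh'.symm), fromPr_comp _⟩
  exact ⟨CokernelCofork.IsColimit.ofπ _ _ (fun g hg => (key g hg).choose)
    (fun g hg => (key g hg).choose_spec)
    (fun g hg m hm => fromPr_hom_ext (hm.trans (key g hg).choose_spec.symm))⟩

theorem isExactCoker_fromPr (A : V) (X : Preadditive.RightFreyd V) :
    IsExactCoker ((pr V).obj A) ((pr V).map (arr X).hom) (fromPr X) where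
  zero := fromPr_zero X
  isColimit := fromPr_isColimit X
  lift g := by
    obtain ⟨h, hh⟩ := exists_pr_map_fromPr g
    exact ⟨_, hh⟩
  exact g hg := by
    obtain ⟨g, rfl⟩ := (pr V).map_surjective g
    obtain ⟨h', rfl⟩ := (pr_map_fromPr_eq_zero_iff _).1 hg
    exact ⟨(pr V).map h', by rw [← Functor.map_comp]⟩

theorem freyd_isZero_of_pr {X : Preadditive.RightFreyd V}
    (h : ∀ (A : V) (f : (pr V).obj A ⟶ X), f = 0) : IsZero X := by
  rw [IsZero.iff_id_eq_zero]
  apply fromPr_hom_ext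
  rw [h _ (fromPr X ≫ 𝟙 X), comp_zero]

variable (k : Type uk) [Field k] [Linear k V]

theorem freyd_finite_hom (hfin : ∀ A B : V, Module.Finite k (A ⟶ B))
    (X Y : Preadditive.RightFreyd V) : Module.Finite k (X ⟶ Y) := by
  let φ : (arr X ⟶ arr Y) →ₗ[k] ((arr X).left ⟶ (arr Y).left) × ((arr X).right ⟶ (arr Y).right) :=
    { toFun := fun f => (f.left, f.right)
      map_add' := fun _ _ => rfl
      map_smul' := fun _ _ => rfl }
  have := hfin (arr X).left (arr Y).left
  have := hfin (arr X).right (arr Y).right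
  have : Module.Finite k (arr X ⟶ arr Y) := Module.Finite.of_injective φ fun f g h =>
    Arrow.hom_ext _ _ (congrArg Prod.fst h) (congrArg Prod.snd h)
  let ψ : (arr X ⟶ arr Y) →ₗ[k] (X ⟶ Y) :=
    { toFun := cls
      map_add' := fun _ _ => rfl
      map_smul' := fun _ _ => rfl }
  exact Module.Finite.of_surjective ψ cls_surj

variable [HasFiniteBiproducts V]

/-- An epimorphism kills the projection to the candidate cokernel of its square. The resulting
null-homotopy `h` splits the map built from the presentation of `X` and the square; its second
component gives the lift, and its first component measures the error, which is zero in the Freyd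
category. -/
theorem pr_projective (A : V) : Projective ((pr V).obj A) where
  factors {Y X} g e he := by
    obtain ⟨f, rfl⟩ := cls_surj e
    have : HasBinaryBiproducts V := hasBinaryBiproducts_of_finite_biproducts _
    have h0 : (Preadditive.RightFreyd.quotient V).map
        (Preadditive.RightFreyd.Candidate.π f) = 0 := by
      have : cls f ≫ (Preadditive.RightFreyd.quotient V).map
          (Preadditive.RightFreyd.Candidate.π f) = 0 :=
        Preadditive.RightFreyd.eq_of_rightHomotopy _ _
          (Preadditive.RightFreyd.Candidate.condition f)
      exact (cancel_epi (cls f)).1 (this.trans comp_zero.symm)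
    obtain ⟨h, hh⟩ : ∃ h : (arr X).right ⟶ (arr X).left ⊞ (arr Y).right,
        𝟙 (arr X).right = h ≫ biprod.desc (arr X).hom f.right :=
      (cls_eq_zero_iff (X := X) (Y := (Preadditive.RightFreyd.quotient V).obj
      (Preadditive.RightFreyd.Candidate.cokernel f)) (Preadditive.RightFreyd.Candidate.π f)).1 h0
    obtain ⟨a, rfl⟩ := exists_pr_map_fromPr g
    refine ⟨(pr V).map (a ≫ h ≫ biprod.snd) ≫ fromPr Y, ?_⟩
    rw [Category.assoc, fromPr_comp, ← Category.assoc, ← Functor.map_comp, ← sub_eq_zero,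
      ← Preadditive.sub_comp, ← Functor.map_sub, pr_map_fromPr_eq_zero_iff]
    refine ⟨-(a ≫ h ≫ biprod.fst), ?_⟩
    have : a = a ≫ h ≫ biprod.fst ≫ (arr X).hom + a ≫ h ≫ biprod.snd ≫ f.right := by
      calc a = a ≫ 𝟙 _ := (Category.comp_id a).symm
        _ = a ≫ h ≫ biprod.desc (arr X).hom f.right := by rw [hh]
        _ = _ := by rw [biprod.desc_eq]; simp
    have h2 : (a ≫ h ≫ biprod.snd) ≫ f.right = a - (a ≫ h ≫ biprod.fst) ≫ (arr X).hom := by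
      rw [eq_sub_iff_add_eq, add_comm]
      simpa only [Category.assoc] using this.symm
    refine (congrArg (· - a) h2).trans ?_
    simp

theorem freyd_isModuleCategory (hfin : ∀ A B : V, Module.Finite k (A ⟶ B)) (G : V)
    (hG : ∀ A : V, ∃ n : ℕ, Nonempty (Retract A (⨁ fun _ : Fin n => G))) :
    IsModuleCategory k (Preadditive.RightFreyd V) := by
  refine isModuleCategory_of_generator k (freyd_finite_hom k hfin) ((pr V).obj G)
    (fun n => (pr V).mapBicone (biproduct.bicone fun _ : Fin n => G))
    (fun n => isBilimitOfPreserves (pr V) (biproduct.isBilimit _)) ?_ ?_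
  · intro m n f
    obtain ⟨a, rfl⟩ := (pr V).map_surjective f
    exact ⟨(Preadditive.RightFreyd.quotient V).obj (Arrow.mk a), _,
      isExactCoker_fromPr G ((Preadditive.RightFreyd.quotient V).obj (Arrow.mk a))⟩
  · intro X
    obtain ⟨n, ⟨r⟩⟩ := hG (arr X).right
    exact ⟨_, _, _, _, n, isExactCoker_fromPr G X, ⟨r.map (pr V)⟩⟩

end RightFreyd

/-! ### Freyd categories of the Hom categories of a finitary bicategory -/

section HomAbelian

variable {C : Type u} [Bicategory.{w, v} C] [PreadditiveBicategory C]

/-- The right Freyd categories of the categories of `1`-morphisms are abelian. -/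
class HomAbelian (C : Type u) [Bicategory.{w, v} C] [PreadditiveBicategory C] : Prop where
  exists_abelian (i j : C) : ∃ a : Abelian (Preadditive.RightFreyd (i ⟶ j)),
    a.toPreadditive = (inferInstance : Preadditive (Preadditive.RightFreyd (i ⟶ j)))

/-- An abelian structure with a prescribed preadditive structure. -/
@[reducible]
def abelianOfExists {D : Type u'} [Category.{v'} D] [p : Preadditive D]
    (h : ∃ a : Abelian D, a.toPreadditive = p) : Abelian D where
  toPreadditive := p
  normalMonoOfMono := by obtain ⟨a, rfl⟩ := h; exact a.normalMonoOfMono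
  normalEpiOfEpi := by obtain ⟨a, rfl⟩ := h; exact a.normalEpiOfEpi
  has_finite_products := h.choose.has_finite_products
  has_kernels := by obtain ⟨a, rfl⟩ := h; exact a.has_kernels
  has_cokernels := by obtain ⟨a, rfl⟩ := h; exact a.has_cokernels

instance freydAbelian [HomAbelian C] (i j : C) : Abelian (Preadditive.RightFreyd (i ⟶ j)) :=
  abelianOfExists (HomAbelian.exists_abelian i j)

variable [AdditiveBicategory C]

theorem decomposition (k : Type uk) [Field k] [LinearBicategory k C] [IsFinitary k C] {i j : C}
    (X : i ⟶ j) :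
    ∃ (ι : Type) (_ : Fintype ι) (F : ι → (i ⟶ j)) (s : ∀ a, F a ⟶ X) (p : ∀ a, X ⟶ F a),
      (∀ a, Indecomposable (F a)) ∧ (∀ a, s a ≫ p a = 𝟙 (F a)) ∧
      (∀ a b, a ≠ b → s a ≫ p b = 0) ∧ ∑ a, p a ≫ s a = 𝟙 X :=
  exists_decomposition k (fun X Y => IsFinitary.finite_hom X Y) X

/-- An object lying in `add G` up to isomorphism. -/
theorem retract_of_decomposition {V : Type u} [Category.{v} V] [Preadditive V]
    [HasFiniteBiproducts V] {A G : V} {ι : Type*} [Fintype ι] {F : ι → V} (s : ∀ a, F a ⟶ A)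
    (p : ∀ a, A ⟶ F a) (hs : ∑ a, p a ≫ s a = 𝟙 A) (r : ∀ a, Retract (F a) G) :
    ∃ n : ℕ, Nonempty (Retract A (⨁ fun _ : Fin n => G)) := by
  let e := Fintype.equivFin ι
  refine ⟨Fintype.card ι, ⟨biproduct.lift fun c => p (e.symm c) ≫ (r (e.symm c)).i,
    biproduct.desc fun c => (r (e.symm c)).r ≫ s (e.symm c), ?_⟩⟩
  rw [biproduct.lift_desc, ← hs, ← e.symm.sum_comp (fun a => p a ≫ s a)]
  simp

theorem isModuleCategory_principal (k : Type uk) [Field k] [LinearBicategory k C] [IsFinitary k C]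
    (i j : C) :
    IsModuleCategory k (Preadditive.RightFreyd (i ⟶ j)) := by
  obtain ⟨n, F, hF⟩ := IsFinitary.finite_indecomposables (k := k) i j
  refine freyd_isModuleCategory k (fun X Y => IsFinitary.finite_hom X Y) (⨁ F) fun A => ?_
  obtain ⟨ι, _, F', s, p, hi, -, -, hs⟩ := decomposition k A
  refine retract_of_decomposition s p hs fun a => ?_
  have h := hF (F' a) (hi a)
  exact ⟨h.choose_spec.some.hom ≫ biproduct.ι F _, biproduct.π F _ ≫ h.choose_spec.some.inv,
    by simp⟩

theorem homAbelian (k : Type uk) [Field k] [LinearBicategory k C] [IsFinitary k C] :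
    HomAbelian C :=
  ⟨fun i j => (isModuleCategory_principal k i j).exists_abelian⟩

theorem isFiniteAbelian_principal (k : Type uk) [Field k] [LinearBicategory k C] [IsFinitary k C]
    [HomAbelian C] (i j : C) :
    IsFiniteAbelian k (Preadditive.RightFreyd (i ⟶ j)) :=
  (isModuleCategory_principal k i j).isFiniteAbelian

theorem isLocalObj_of_indecomposable (k : Type uk) [Field k] [LinearBicategory k C] [IsFinitary k C]
    {i j : C} {F : i ⟶ j} (h : Indecomposable F) : IsLocalObj F :=
  have := IsFinitary.isIdempotentComplete (k := k) i j
  h.isLocalObj k (hf := IsFinitary.finite_hom F F)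

theorem isLocalObj_proj (k : Type uk) [Field k] [LinearBicategory k C] [IsFinitary k C]
    {i j : C} {F : i ⟶ j} (h : Indecomposable F) : IsLocalObj (proj F) := by
  have hl := isLocalObj_of_indecomposable k h
  refine ⟨fun hz => hl.1 ?_, fun f => ?_⟩
  · rw [IsZero.iff_id_eq_zero]
    exact (pr (i ⟶ j)).map_injective (hz.eq_of_src _ _)
  · obtain ⟨f, rfl⟩ := (pr (i ⟶ j)).map_surjective f
    rcases hl.2 f with h | h
    · left; infer_instance
    · right
      have : 𝟙 (proj F) - (pr (i ⟶ j)).map f = (pr (i ⟶ j)).map (𝟙 F - f) := by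
        rw [Functor.map_sub, CategoryTheory.Functor.map_id]
      rw [this]; infer_instance

end HomAbelian

end Fiat

end

noncomputable section

namespace Fiat

variable {C : Type u} [Bicategory.{w, v} C]

/-! ### Adjunctions between `1`-morphisms -/

/-- Transport of an adjunction along an isomorphism of right adjoints. -/
def adjunctionOfIsoRight {i j : C} {F : i ⟶ j} {U U' : j ⟶ i} (adj : Bicategory.Adjunction F U)
    (e : U ≅ U') : Bicategory.Adjunction F U' where
  unit := adj.unit ≫ F ◁ e.hom
  counit := e.inv ▷ F ≫ adj.counit
  left_triangle := by
    calc _ = 𝟙 _ ⊗≫ adj.unit ▷ F ⊗≫ F ◁ ((e.hom ≫ e.inv) ▷ F) ⊗≫ F ◁ adj.counit ⊗≫ 𝟙 _ := by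
          simp only [leftZigzag]
          bicategory
      _ = 𝟙 _ ⊗≫ leftZigzag adj.unit adj.counit ⊗≫ 𝟙 _ := by
          rw [e.hom_inv_id]
          simp only [leftZigzag]
          bicategory
      _ = _ := by rw [adj.left_triangle]; bicategory
  right_triangle := by
    calc _ = 𝟙 _ ⊗≫ U' ◁ adj.unit ⊗≫ (U' ◁ (F ◁ e.hom) ≫ e.inv ▷ (F ≫ U')) ⊗≫
              adj.counit ▷ U' ⊗≫ 𝟙 _ := by
          simp only [rightZigzag]
          bicategory
      _ = 𝟙 _ ⊗≫ (U' ◁ adj.unit ≫ e.inv ▷ (F ≫ U)) ⊗≫ ((U ≫ F) ◁ e.hom ≫ adj.counit ▷ U') ⊗≫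
            𝟙 _ := by
          rw [whisker_exchange e.inv (F ◁ e.hom)]
          bicategory
      _ = 𝟙 _ ⊗≫ (e.inv ▷ 𝟙 _ ≫ U ◁ adj.unit) ⊗≫ (adj.counit ▷ U ≫ 𝟙 _ ◁ e.hom) ⊗≫ 𝟙 _ := by
          rw [whisker_exchange, whisker_exchange]
      _ = 𝟙 _ ⊗≫ e.inv ⊗≫ rightZigzag adj.unit adj.counit ⊗≫ e.hom ⊗≫ 𝟙 _ := by
          simp only [rightZigzag]
          bicategory
      _ = 𝟙 _ ⊗≫ (e.inv ≫ e.hom) ⊗≫ 𝟙 _ := by rw [adj.right_triangle]; bicategory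
      _ = _ := by rw [e.inv_hom_id]; bicategory

/-- The adjunction `F* ⊣ F`. -/
theorem Involution.HasAdjunctions.dual_adj {I : Involution C} (hI : I.HasAdjunctions) {i j : C}
    (F : i ⟶ j) : Nonempty (Bicategory.Adjunction (I.dual F) F) :=
  ⟨adjunctionOfIsoRight (hI (I.dual F)).some (I.starStar F)⟩

variable [PreadditiveBicategory C]

/-! ### Evaluation of 2-morphisms in a 2-representation -/

namespace TwoRep

variable {k : Type uk} [Field k] [LinearBicategory k C] (M : TwoRep.{w, v, u, u', uk} k C)

instance (j : C) : Abelian (M.obj j) := (M.isModuleCategory j).abelian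

theorem isFiniteAbelian (j : C) : IsFiniteAbelian k (M.obj j) :=
  (M.isModuleCategory j).isFiniteAbelian

/-- The functor by which a `1`-morphism acts. -/
abbrev act {i j : C} (F : i ⟶ j) : M.obj i ⥤ M.obj j := (M.functor.map F).toFunctor

instance {i j : C} (F : i ⟶ j) : (M.act F).Additive := M.map_additive F

instance {i j : C} (F : i ⟶ j) : (M.act F).Linear k := M.map_linear F

/-- Compositions act by compositions. -/
def compIso {i j l : C} (F : i ⟶ j) (H : j ⟶ l) (X : M.obj i) :
    M.actObj (F ≫ H) X ≅ M.actObj H (M.actObj F X) :=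
  (Cat.Hom.toNatIso (M.functor.mapComp F H)).app X

/-- Identities act by identities. -/
def idIso {i : C} (X : M.obj i) : M.actObj (𝟙 i) X ≅ X :=
  (Cat.Hom.toNatIso (M.functor.mapId i)).app X

theorem compIso_naturality {i j l : C} (F : i ⟶ j) (H : j ⟶ l) {X Y : M.obj i} (f : X ⟶ Y) :
    (M.act (F ≫ H)).map f ≫ (M.compIso F H Y).hom =
      (M.compIso F H X).hom ≫ (M.act H).map ((M.act F).map f) :=
  (Cat.Hom.toNatIso (M.functor.mapComp F H)).hom.naturality f

theorem idIso_naturality {i : C} {X Y : M.obj i} (f : X ⟶ Y) :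
    (M.act (𝟙 i)).map f ≫ (M.idIso Y).hom = (M.idIso X).hom ≫ f :=
  (Cat.Hom.toNatIso (M.functor.mapId i)).hom.naturality f

section

variable {i j : C} {F G H : i ⟶ j}

theorem eval_naturality (a : F ⟶ G) {X Y : M.obj i} (f : X ⟶ Y) :
    (M.act F).map f ≫ M.eval a Y = M.eval a X ≫ (M.act G).map f :=
  (M.functor.map₂ a).toNatTrans.naturality f

theorem eval_id (F : i ⟶ j) (X : M.obj i) : M.eval (𝟙 F) X = 𝟙 _ :=
  congr($(M.functor.map₂_id F).toNatTrans.app X)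

theorem eval_comp (a : F ⟶ G) (b : G ⟶ H) (X : M.obj i) :
    M.eval (a ≫ b) X = M.eval a X ≫ M.eval b X :=
  congr($(M.functor.map₂_comp a b).toNatTrans.app X)

/-- Evaluation at an object. -/
def evFunctor (j : C) (X : M.obj i) : (i ⟶ j) ⥤ M.obj j where
  obj F := M.actObj F X
  map a := M.eval a X
  map_id F := M.eval_id F X
  map_comp a b := M.eval_comp a b X

instance (j : C) (X : M.obj i) : (M.evFunctor j X).Additive where
  map_add {_ _ a b} := M.map₂_add a b X

instance (j : C) (X : M.obj i) : (M.evFunctor j X).Linear k where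
  map_smul a c := M.map₂_smul c a X

theorem eval_add (a b : F ⟶ G) (X : M.obj i) : M.eval (a + b) X = M.eval a X + M.eval b X :=
  M.map₂_add a b X

theorem eval_zero (X : M.obj i) : M.eval (0 : F ⟶ G) X = 0 := (M.evFunctor j X).map_zero F G

theorem eval_sub (a b : F ⟶ G) (X : M.obj i) : M.eval (a - b) X = M.eval a X - M.eval b X :=
  (M.evFunctor j X).map_sub

theorem eval_sum {ι : Type*} (s : Finset ι) (a : ι → (F ⟶ G)) (X : M.obj i) :
    M.eval (∑ c ∈ s, a c) X = ∑ c ∈ s, M.eval (a c) X :=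
  (M.evFunctor j X).map_sum _ _

end

section

variable {i j l : C}

theorem eval_whiskerLeft (F : i ⟶ j) {H H' : j ⟶ l} (a : H ⟶ H') (X : M.obj i) :
    M.eval (F ◁ a) X =
      (M.compIso F H X).hom ≫ M.eval a (M.actObj F X) ≫ (M.compIso F H' X).inv :=
  congr($(M.functor.map₂_whisker_left F a).toNatTrans.app X)

theorem eval_whiskerRight {F F' : i ⟶ j} (a : F ⟶ F') (H : j ⟶ l) (X : M.obj i) :
    M.eval (a ▷ H) X =
      (M.compIso F H X).hom ≫ (M.act H).map (M.eval a X) ≫ (M.compIso F' H X).inv :=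
  congr($(M.functor.map₂_whisker_right a H).toNatTrans.app X)

theorem eval_rightUnitor_inv (F : i ⟶ j) (X : M.obj i) :
    M.eval (ρ_ F).inv X = (M.idIso (M.actObj F X)).inv ≫ (M.compIso F (𝟙 j) X).inv := by
  have h : M.eval (ρ_ F).hom X = (M.compIso F (𝟙 j) X).hom ≫ (M.idIso (M.actObj F X)).hom :=
    congr($(M.functor.map₂_right_unitor F).toNatTrans.app X).trans
      (congrArg _ (Category.comp_id _))
  have h2 : M.eval (ρ_ F).inv X ≫ M.eval (ρ_ F).hom X = 𝟙 _ := by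
    rw [← eval_comp, Iso.inv_hom_id, eval_id]
  rw [h] at h2
  rw [← cancel_mono ((M.compIso F (𝟙 j) X).hom ≫ (M.idIso (M.actObj F X)).hom), h2]
  simp

theorem eval_associator_inv {m : C} (F : i ⟶ j) (H : j ⟶ l) (U : l ⟶ m) (X : M.obj i) :
    M.eval (α_ F H U).inv X = (M.compIso F (H ≫ U) X).hom ≫
      (M.compIso H U (M.actObj F X)).hom ≫ (M.act U).map (M.compIso F H X).inv ≫
        (M.compIso (F ≫ H) U X).inv := by
  have h : M.eval (α_ F H U).hom X = (M.compIso (F ≫ H) U X).hom ≫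
      (M.act U).map (M.compIso F H X).hom ≫ (M.compIso H U (M.actObj F X)).inv ≫
        (M.compIso F (H ≫ U) X).inv :=
    congr($(M.functor.map₂_associator F H U).toNatTrans.app X).trans
      (congrArg _ (congrArg _ (Category.id_comp _)))
  have h2 : M.eval (α_ F H U).inv X ≫ M.eval (α_ F H U).hom X = 𝟙 _ := by
    rw [← eval_comp, Iso.inv_hom_id, eval_id]
  rw [h] at h2
  rw [← cancel_mono ((M.compIso (F ≫ H) U X).hom ≫ (M.act U).map (M.compIso F H X).hom ≫
    (M.compIso H U (M.actObj F X)).inv ≫ (M.compIso F (H ≫ U) X).inv), h2]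
  simp only [Category.assoc, Iso.inv_hom_id_assoc, ← Functor.map_comp_assoc, Iso.inv_hom_id,
    CategoryTheory.Functor.map_id, Category.id_comp, Iso.hom_inv_id_assoc,
    Iso.hom_inv_id]

/-- The adjunction between the actions of adjoint `1`-morphisms. -/
def adj {F : i ⟶ j} {U : j ⟶ i} (a : Bicategory.Adjunction F U) : M.act F ⊣ M.act U :=
  Adjunction.ofCat (M.functor.mapAdjunction a)

theorem adj_unit_app {F : i ⟶ j} {U : j ⟶ i} (a : Bicategory.Adjunction F U) (X : M.obj i) :
    (M.adj a).unit.app X =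
      (M.idIso X).inv ≫ M.eval a.unit X ≫ (M.compIso F U X).hom := rfl

/-- Evaluation of the transpose of a `2`-morphism. -/
theorem eval_homEquiv₂ {m : C} {U : l ⟶ m} {U' : m ⟶ l} (a : Bicategory.Adjunction U U')
    {H : i ⟶ l} {K : i ⟶ m} (e : H ≫ U ⟶ K) (X : M.obj i) :
    M.eval (a.homEquiv₂ e) X ≫ (M.compIso K U' X).hom =
      (M.adj a).homEquiv _ _ ((M.compIso H U X).inv ≫ M.eval e X) := by
  have h : a.homEquiv₂ e = (ρ_ _).inv ≫ H ◁ a.unit ≫ (α_ _ _ _).inv ≫ e ▷ U' := rfl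
  rw [h, Adjunction.homEquiv_unit, adj_unit_app]
  simp only [eval_comp, eval_rightUnitor_inv, eval_whiskerLeft, eval_associator_inv,
    eval_whiskerRight, Category.assoc, Iso.inv_hom_id_assoc, Iso.inv_hom_id, Category.comp_id,
    Functor.map_comp, CategoryTheory.Functor.map_comp]

/-- A retract acts by retracts. -/
def evalRetract {F G : i ⟶ j} (r : Retract F G) (X : M.obj i) :
    Retract (M.actObj F X) (M.actObj G X) := r.map (M.evFunctor j X)

end

end TwoRep

end Fiat

end

/-! ### Exactness, summands and transposition in 2-representations -/

noncomputable section

namespace Fiat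

variable {C : Type u} [Bicategory.{w, v} C]

/-- Every `1`-morphism has a simultaneous left and right adjoint. -/
class HasBiadjoints (C : Type u) [Bicategory.{w, v} C] : Prop where
  exists_biadjoint {i j : C} (F : i ⟶ j) : ∃ U : j ⟶ i,
    Nonempty (Bicategory.Adjunction F U) ∧ Nonempty (Bicategory.Adjunction U F)

theorem Involution.HasAdjunctions.hasBiadjoints {I : Involution C} (hI : I.HasAdjunctions) :
    HasBiadjoints C :=
  ⟨fun F => ⟨I.dual F, hI F, hI.dual_adj F⟩⟩

variable [PreadditiveBicategory C]

namespace TwoRep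

variable {k : Type uk} [Field k] [LinearBicategory k C] (M : TwoRep.{w, v, u, u', uk} k C)

section Exact

variable [HasBiadjoints C] {i j : C} (F : i ⟶ j)

/-- Exactness of the action comes entirely from `F` having an adjoint on either side. -/
instance : PreservesLimits (M.act F) := by
  obtain ⟨U, -, ⟨a⟩⟩ := HasBiadjoints.exists_biadjoint F
  exact (M.adj a).rightAdjoint_preservesLimits

instance : PreservesColimits (M.act F) := by
  obtain ⟨U, ⟨a⟩, -⟩ := HasBiadjoints.exists_biadjoint F
  exact (M.adj a).leftAdjoint_preservesColimits

end Exact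

theorem finrank_adj {i j : C} {F : i ⟶ j} {U : j ⟶ i} (a : Bicategory.Adjunction F U)
    (X : M.obj i) (Y : M.obj j) :
    Module.finrank k (M.actObj F X ⟶ Y) = Module.finrank k (X ⟶ M.actObj U Y) :=
  LinearEquiv.finrank_eq
    { (M.adj a).homAddEquiv X Y with
      map_smul' := fun c f => by
        change (M.adj a).homEquiv X Y (c • f) = c • (M.adj a).homEquiv X Y f
        simp only [Adjunction.homEquiv_unit]
        rw [Functor.map_smul, Linear.comp_smul] }

theorem exists_ne_zero_adj {i j : C} {F : i ⟶ j} {U : j ⟶ i} (a : Bicategory.Adjunction F U)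
    {X : M.obj i} {Y : M.obj j} :
    (∃ f : M.actObj F X ⟶ Y, f ≠ 0) ↔ ∃ f : X ⟶ M.actObj U Y, f ≠ 0 := by
  let e := (M.adj a).homAddEquiv X Y
  constructor
  · rintro ⟨f, hf⟩
    exact ⟨e f, fun h => hf ((map_eq_zero_iff e e.injective).1 h)⟩
  · rintro ⟨f, hf⟩
    exact ⟨e.symm f, fun h => hf ((map_eq_zero_iff e.symm e.symm.injective).1 h)⟩

/-! ### Reduction to indecomposable summands -/

section Summand

variable [AdditiveBicategory C] [IsFinitary k C] {i j : C}

/-- Evaluating a decomposition of the identity of `H` at `X` writes `f` as a sum over indecomposable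
summands. This is the device for testing maps out of `H X` on indecomposable 1-morphisms. -/
theorem exists_summand_ne_zero {H : i ⟶ j} {X : M.obj i} {Y : M.obj j}
    {f : M.actObj H X ⟶ Y} (hf : f ≠ 0) :
    ∃ (J : i ⟶ j) (r : Retract J H), Indecomposable J ∧ M.eval r.i X ≫ f ≠ 0 := by
  obtain ⟨ι, _, F, s, p, hi, h1, -, hs⟩ := decomposition k H
  by_contra! hc
  apply hf
  have : M.eval (∑ a, p a ≫ s a) X ≫ f = f := by rw [hs, eval_id, Category.id_comp]
  rw [← this, eval_sum, Preadditive.sum_comp]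
  refine Finset.sum_eq_zero fun a _ => ?_
  rw [eval_comp, Category.assoc, hc (F a) ⟨s a, p a, h1 a⟩ (hi a), comp_zero]

theorem exists_summand_not_isZero {H : i ⟶ j} {X : M.obj i} (h : ¬ IsZero (M.actObj H X)) :
    ∃ (J : i ⟶ j) (_ : Retract J H), Indecomposable J ∧ ¬ IsZero (M.actObj J X) := by
  obtain ⟨J, r, hJ, hne⟩ := M.exists_summand_ne_zero (H := H) (X := X)
    (f := 𝟙 _) (fun h0 => h ((IsZero.iff_id_eq_zero _).2 h0))
  exact ⟨J, r, hJ, fun hz => hne (hz.eq_of_src _ _)⟩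

theorem exists_eval_of_summands {H K : i ⟶ j} {X : M.obj i} (ψ : M.actObj H X ⟶ M.actObj K X)
    (h : ∀ (J : i ⟶ j) (r : Retract J H), Indecomposable J →
      ∃ e : J ⟶ K, M.eval e X = M.eval r.i X ≫ ψ) :
    ∃ e : H ⟶ K, M.eval e X = ψ := by
  obtain ⟨ι, _, F, s, p, hi, h1, -, hs⟩ := decomposition k H
  choose e he using fun a => h (F a) ⟨s a, p a, h1 a⟩ (hi a)
  refine ⟨∑ a, p a ≫ e a, ?_⟩
  have : M.eval (∑ a, p a ≫ s a) X ≫ ψ = ψ := by rw [hs, eval_id, Category.id_comp]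
  rw [eval_sum, ← this, eval_sum, Preadditive.sum_comp]
  refine Finset.sum_congr rfl fun a _ => ?_
  rw [eval_comp, eval_comp, Category.assoc, he]

theorem eval_eq_zero_of_summands {H K : i ⟶ j} {X : M.obj i} (e : H ⟶ K)
    (h : ∀ (J : i ⟶ j) (r : Retract J H), Indecomposable J → M.eval (r.i ≫ e) X = 0) :
    M.eval e X = 0 := by
  by_contra hc
  obtain ⟨J, r, hJ, hne⟩ := M.exists_summand_ne_zero hc
  exact hne (by rw [← eval_comp]; exact h J r hJ)

end Summand

/-! ### Transposition -/

section Transpose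

variable {i l : C} {U : l ⟶ i} {U' : i ⟶ l} {H : i ⟶ l}

/-- The transpose of a `2`-morphism. -/
def transpose (a : Bicategory.Adjunction U U') : (H ≫ U ⟶ 𝟙 i) ≃ (H ⟶ U') :=
  a.homEquiv₂.trans (Iso.homToEquiv (λ_ U'))

theorem eval_transpose (a : Bicategory.Adjunction U U') (e : H ≫ U ⟶ 𝟙 i) (X : M.obj i) :
    M.eval (transpose a e) X = (M.adj a).homEquiv _ _ ((M.compIso H U X).inv ≫ M.eval e X) ≫
      (M.compIso (𝟙 i) U' X).inv ≫ M.eval (λ_ U').hom X := by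
  rw [← M.eval_homEquiv₂ a e X, Category.assoc, Iso.hom_inv_id_assoc, ← eval_comp]
  rfl

instance isIso_eval {j : C} {F G : i ⟶ j} (b : F ⟶ G) [IsIso b] (X : M.obj i) :
    IsIso (M.eval b X) :=
  inferInstanceAs (IsIso ((M.evFunctor j X).map b))

/-- Evaluation turns transposition into the adjunction bijection up to isomorphisms. Together with
`exists_eval_of_transpose` this reduces questions about 2-morphisms `H ⟶ U'` to 2-morphisms into an
identity. -/
theorem eval_transpose_eq_zero_iff (a : Bicategory.Adjunction U U') (e : H ≫ U ⟶ 𝟙 i)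
    (X : M.obj i) :
    M.eval (transpose a e) X = 0 ↔ M.eval e X = 0 := by
  rw [eval_transpose]
  constructor
  · intro h
    have h1 := (Preadditive.IsIso.comp_right_eq_zero _ _).1 h
    have h2 := (map_eq_zero_iff ((M.adj a).homAddEquiv _ _)
      ((M.adj a).homAddEquiv _ _).injective).1 h1
    exact (Preadditive.IsIso.comp_left_eq_zero _ _).1 h2
  · intro h
    rw [h, comp_zero]
    have : (M.adj a).homEquiv (M.actObj H X) (M.actObj (𝟙 i) X) 0 = 0 :=
      map_zero ((M.adj a).homAddEquiv _ _)
    rw [this, zero_comp]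

theorem exists_eval_of_transpose (a : Bicategory.Adjunction U U') {X : M.obj i}
    (h : ∀ ψ : M.actObj (H ≫ U) X ⟶ M.actObj (𝟙 i) X, ∃ e, M.eval e X = ψ)
    (φ : M.actObj H X ⟶ M.actObj U' X) : ∃ β : H ⟶ U', M.eval β X = φ := by
  obtain ⟨e, he⟩ := h ((M.compIso H U X).hom ≫ ((M.adj a).homEquiv _ _).symm
    (φ ≫ M.eval (λ_ U').inv X ≫ (M.compIso (𝟙 i) U' X).hom))
  refine ⟨transpose a e, ?_⟩
  rw [eval_transpose, he, Iso.inv_hom_id_assoc, Equiv.apply_symm_apply]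
  simp only [Category.assoc, Iso.hom_inv_id_assoc, ← eval_comp, Iso.inv_hom_id, eval_id,
    Category.comp_id]

end Transpose

end TwoRep

/-! ### The principal `2`-representations -/

section Principal

variable (k : Type uk) [Field k] [LinearBicategory k C] [AdditiveBicategory C] [IsFinitary k C]

/-- The principal `2`-representation. -/
def principalRep (i : C) : TwoRep.{w, v, u, max v w, uk} k C where
  functor := principal i
  preadditive j := inferInstanceAs (Preadditive (Preadditive.RightFreyd (i ⟶ j)))
  linear j := inferInstanceAs (Linear k (Preadditive.RightFreyd (i ⟶ j)))
  map_additive H := inferInstanceAs (act i H).Additive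
  map_linear H := inferInstanceAs ((act i H).Linear k)
  map₂_add {_ _ F G} a b X :=
    cls_congr (X := (act i F).obj X) (Y := (act i G).obj X)
      (PreadditiveBicategory.whiskerLeft_add _ a b) (PreadditiveBicategory.whiskerLeft_add _ a b)
  map₂_smul {_ _ F G} c a X :=
    cls_congr (X := (act i F).obj X) (Y := (act i G).obj X)
      (LinearBicategory.whiskerLeft_smul _ c a) (LinearBicategory.whiskerLeft_smul _ c a)
  isModuleCategory j := isModuleCategory_principal k i j

/-- `H ∘ P_F = P_{H ∘ F}`. -/
def actProjIso {i j l : C} (F : i ⟶ j) (H : j ⟶ l) : (act i H).obj (proj F) ≅ proj (F ≫ H) :=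
  isoSq ((act i H).obj (proj F)) (proj (F ≫ H))
    ((Functor.map_isZero (postcomp i H) (isZero_zero _)).iso (isZero_zero _)) (Iso.refl _)
    ((Functor.map_isZero (postcomp i H) (isZero_zero _)).eq_of_src _ _)

theorem actProjIso_naturality {i j l : C} {F F' : i ⟶ j} (a : F ⟶ F') (H : j ⟶ l) :
    (act i H).map ((pr _).map a) ≫ (actProjIso F' H).hom =
      (actProjIso F H).hom ≫ (pr _).map (a ▷ H) := by
  refine cls_congr (X := (act i H).obj (proj F)) (Y := proj (F' ≫ H)) ?_ ?_
  · exact (Functor.map_isZero (postcomp i H) (isZero_zero _)).eq_of_src _ _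
  · exact (Category.comp_id (a ▷ H)).trans (Category.id_comp (a ▷ H)).symm

theorem actProjIso_naturality₂ {i j l : C} (F : i ⟶ j) {H H' : j ⟶ l} (a : H ⟶ H') :
    (actNat i a).app (proj F) ≫ (actProjIso F H').hom =
      (actProjIso F H).hom ≫ (pr _).map (F ◁ a) := by
  refine cls_congr (X := (act i H).obj (proj F)) (Y := proj (F ≫ H')) ?_ ?_
  · exact (Functor.map_isZero (postcomp i H) (isZero_zero _)).eq_of_src _ _
  · exact (Category.comp_id (F ◁ a)).trans (Category.id_comp (F ◁ a)).symm

end Principal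

end Fiat

end

noncomputable section

namespace Fiat

/-! ### Combinatorics of cells -/

section Cells

variable {C : Type u} [Bicategory.{w, v} C]

/-- Composition of retracts with a `1`-morphism. -/
def retractComp {i j l : C} {F G : i ⟶ j} (r : Retract F G) (H : j ⟶ l) :
    Retract (F ≫ H) (G ≫ H) :=
  r.map (postcomp i H)

/-- Composition of a `1`-morphism with retracts. -/
def compRetract {i j l : C} (H : l ⟶ i) {F G : i ⟶ j} (r : Retract F G) :
    Retract (H ≫ F) (H ≫ G) :=
  r.map (precomp j H)

theorem rightLE_iff {i j l : C} {F : i ⟶ j} {G : i ⟶ l} :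
    RightLE ⟨F⟩ ⟨G⟩ ↔ ∃ H : j ⟶ l, Nonempty (Retract G (F ≫ H)) :=
  ⟨fun h => by cases h with | mk H r => exact ⟨H, ⟨r⟩⟩, fun ⟨H, ⟨r⟩⟩ => .mk H r⟩

theorem leftLE_iff {i j l : C} {F : i ⟶ j} {G : l ⟶ j} :
    LeftLE ⟨F⟩ ⟨G⟩ ↔ ∃ H : l ⟶ i, Nonempty (Retract G (H ≫ F)) :=
  ⟨fun h => by cases h with | mk H r => exact ⟨H, ⟨r⟩⟩, fun ⟨H, ⟨r⟩⟩ => .mk H r⟩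

theorem iso₁_iff {i j : C} {F G : i ⟶ j} : Iso₁ ⟨F⟩ ⟨G⟩ ↔ Nonempty (F ≅ G) :=
  ⟨fun h => by cases h with | mk e => exact ⟨e⟩, fun ⟨e⟩ => .mk e⟩

/-- Isomorphisms are retracts. -/
def retractOfIso {D : Type u'} [Category.{v'} D] {X Y : D} (e : X ≅ Y) : Retract X Y :=
  ⟨e.hom, e.inv, e.hom_inv_id⟩

variable {A B D : OneMor C}

theorem RightLE.src_eq (h : RightLE A B) : A.src = B.src := by cases h; rfl

theorem LeftLE.tgt_eq (h : LeftLE A B) : A.tgt = B.tgt := by cases h; rfl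

theorem Iso₁.rightLE (h : Iso₁ A B) : RightLE A B := by
  cases h with
  | mk e => exact .mk (𝟙 _) (retractOfIso (e.symm ≪≫ (ρ_ _).symm))

theorem Iso₁.leftLE (h : Iso₁ A B) : LeftLE A B := by
  cases h with
  | mk e => exact .mk (𝟙 _) (retractOfIso (e.symm ≪≫ (λ_ _).symm))

theorem Iso₁.symm (h : Iso₁ A B) : Iso₁ B A := by
  cases h with
  | mk e => exact .mk e.symm

theorem RightLE.trans (h : RightLE A B) (h' : RightLE B D) : RightLE A D := by
  cases h with
  | mk H r =>
    cases h' with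
    | mk H' r' =>
      exact .mk (H ≫ H') ((r'.trans (retractComp r H')).trans (retractOfIso (α_ _ _ _)))

theorem LeftLE.trans (h : LeftLE A B) (h' : LeftLE B D) : LeftLE A D := by
  cases h with
  | mk H r =>
    cases h' with
    | mk H' r' =>
      exact .mk (H' ≫ H) ((r'.trans (compRetract H' r)).trans (retractOfIso (α_ _ _ _).symm))

theorem TwoSidedLE.trans (h : TwoSidedLE A B) (h' : TwoSidedLE B D) : TwoSidedLE A D := by
  cases h with
  | mk H K r =>
    cases h' with
    | mk H' K' r' =>
      refine .mk (H' ≫ H) (K ≫ K')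
        ((r'.trans (compRetract H' (retractComp r K'))).trans (retractOfIso ?_))
      exact whiskerLeftIso H' (α_ _ _ _ ≪≫ whiskerLeftIso H (α_ _ _ _)) ≪≫ (α_ _ _ _).symm

theorem RightLE.twoSidedLE (h : RightLE A B) : TwoSidedLE A B := by
  cases h with
  | mk H r => exact .mk (𝟙 _) H (r.trans (retractOfIso (λ_ _).symm))

theorem LeftLE.twoSidedLE (h : LeftLE A B) : TwoSidedLE A B := by
  cases h with
  | mk H r => exact .mk H (𝟙 _) (r.trans (retractOfIso (whiskerLeftIso H (ρ_ _).symm)))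

theorem RightLE.refl (A : OneMor C) : RightLE A A := Iso₁.rightLE (.mk (Iso.refl _))

theorem LeftLE.refl (A : OneMor C) : LeftLE A A := Iso₁.leftLE (.mk (Iso.refl _))

theorem rightLE_of_retract {i j l : C} {F : i ⟶ j} {H : j ⟶ l} {G : i ⟶ l}
    (r : Retract G (F ≫ H)) : RightLE ⟨F⟩ ⟨G⟩ := .mk H r

theorem leftLE_of_retract {i j l : C} {F : i ⟶ j} {H : j ⟶ l} {G : i ⟶ l}
    (r : Retract G (F ≫ H)) : LeftLE ⟨H⟩ ⟨G⟩ := .mk F r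

/-! ### Duality -/

/-- The dual of a `1`-morphism with its source and target. -/
def Involution.dual₁ (I : Involution C) (A : OneMor C) : OneMor C := ⟨I.dual A.mor⟩

variable (I : Involution C)

/-- The involution on retracts. -/
def Involution.dualRetract {i j : C} {F G : i ⟶ j} (r : Retract F G) :
    Retract (I.dual F) (I.dual G) :=
  ⟨(I.star i j).map r.r.op, (I.star i j).map r.i.op, by
    rw [← Functor.map_comp, ← op_comp, r.retract, op_id, CategoryTheory.Functor.map_id]⟩

theorem Involution.dual₁_dual₁ (A : OneMor C) : Iso₁ (I.dual₁ (I.dual₁ A)) A :=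
  .mk (I.starStar A.mor)

variable {I}

theorem RightLE.dual (h : RightLE A B) : LeftLE (I.dual₁ A) (I.dual₁ B) := by
  cases h with
  | mk H r => exact .mk (I.dual H) ((I.dualRetract r).trans (retractOfIso (I.starComp _ _)))

theorem LeftLE.dual (h : LeftLE A B) : RightLE (I.dual₁ A) (I.dual₁ B) := by
  cases h with
  | mk H r => exact .mk (I.dual H) ((I.dualRetract r).trans (retractOfIso (I.starComp _ _)))

theorem rightLE_of_dual (h : LeftLE (I.dual₁ A) (I.dual₁ B)) : RightLE A B :=
  ((I.dual₁_dual₁ A).symm.rightLE.trans h.dual).trans (I.dual₁_dual₁ B).rightLE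

theorem leftLE_of_dual (h : RightLE (I.dual₁ A) (I.dual₁ B)) : LeftLE A B :=
  ((I.dual₁_dual₁ A).symm.leftLE.trans h.dual).trans (I.dual₁_dual₁ B).leftLE

/-- Naturality of `F** ≅ F` recovers `a` from its double dual. -/
theorem Involution.star_injective (I : Involution C) {i j : C} {F G : i ⟶ j} {a b : F ⟶ G}
    (h : (I.star i j).map a.op = (I.star i j).map b.op) : a = b := by
  rw [← cancel_epi (I.starStar F).hom, I.starStar_natural, I.starStar_natural, h]

/-- The preimage is the dual of `g` conjugated by `F** ≅ F`; it suffices to compare after dualizing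
once more. -/
theorem Involution.star_surjective (I : Involution C) {i j : C} {F G : i ⟶ j}
    (g : I.dual G ⟶ I.dual F) : ∃ a : F ⟶ G, (I.star i j).map a.op = g := by
  refine ⟨(I.starStar F).inv ≫ (I.star j i).map g.op ≫ (I.starStar G).hom, ?_⟩
  apply I.star_injective
  rw [← cancel_mono (I.starStar G).hom, ← I.starStar_natural]
  simp

/-- A retract of `F ≫ F* ≫ F` which is `F`. -/
theorem Involution.HasAdjunctions.retract (hI : I.HasAdjunctions) {i j : C} (F : i ⟶ j) :
    Nonempty (Retract F (F ≫ I.dual F ≫ F)) := by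
  obtain ⟨a⟩ := hI F
  refine ⟨⟨(λ_ F).inv ≫ a.unit ▷ F ≫ (α_ _ _ _).hom, F ◁ a.counit ≫ (ρ_ F).hom, ?_⟩⟩
  have h : leftZigzag a.unit a.counit = (λ_ F).hom ≫ (ρ_ F).inv := a.left_triangle
  have h2 : a.unit ▷ F ≫ (α_ F (I.dual F) F).hom ≫ F ◁ a.counit = (λ_ F).hom ≫ (ρ_ F).inv := by
    rw [← h]
    simp [leftZigzag, bicategoricalComp]
  simp only [Category.assoc]
  have h3 : a.unit ▷ F ≫ (α_ F (I.dual F) F).hom ≫ F ◁ a.counit ≫ (ρ_ F).hom = (λ_ F).hom := by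
    have := congrArg (· ≫ (ρ_ F).hom) h2
    simpa using this
  rw [h3, Iso.inv_hom_id]

variable [PreadditiveBicategory C]

/-- The involution is not assumed additive. Instead, the zero endomorphism of `F*` is the dual of
some endomorphism of `F`, which can only be the identity. -/
theorem Involution.isZero_dual (I : Involution C) {i j : C} {F : i ⟶ j} (h : IsZero F) :
    IsZero (I.dual F) := by
  rw [IsZero.iff_id_eq_zero]
  obtain ⟨a, ha⟩ := I.star_surjective (0 : I.dual F ⟶ I.dual F)
  rw [← ha, h.eq_of_src a (𝟙 F), op_id, CategoryTheory.Functor.map_id]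

variable [AdditiveBicategory C]

theorem Involution.indecomposable_dual (I : Involution C) (k : Type uk) [Field k]
    [LinearBicategory k C] [IsFinitary k C] {i j : C} {F : i ⟶ j} (h : Indecomposable F) :
    Indecomposable (I.dual F) := by
  have := IsFinitary.isIdempotentComplete (k := k) (C := C) i j
  refine indecomposable_of_idem (fun hz => h.1 ?_) fun e he => ?_
  · exact (I.isZero_dual hz).of_iso (I.starStar F).symm
  · obtain ⟨a, rfl⟩ := I.star_surjective e
    have ha : a ≫ a = a := I.star_injective (by rw [op_comp, Functor.map_comp, he])
    rcases h.idem a ha with rfl | rfl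
    · left
      -- Without additivity, zero morphisms are preserved because they factor through a zero object.
      obtain ⟨Z, hZ⟩ := HasZeroObject.zero (C := i ⟶ j)
      have h0 : (0 : F ⟶ F) = (0 : F ⟶ Z) ≫ (0 : Z ⟶ F) := by simp
      rw [h0, op_comp, Functor.map_comp, (I.isZero_dual hZ).eq_of_tgt
        ((I.star i j).map (0 : Z ⟶ F).op) 0, zero_comp]
    · right
      rw [op_id, CategoryTheory.Functor.map_id]

/-! ### Strongly regular cells -/

/-- The consequences of strong regularity that are used below. -/
structure CellCombinatorics (I : Involution C) (Q : Set (OneMor C)) : Prop where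
  indecomposable {A : OneMor C} : A ∈ Q → Indecomposable A.mor
  dual_mem {A : OneMor C} : A ∈ Q → I.dual₁ A ∈ Q
  convex {A B D : OneMor C} : A ∈ Q → D ∈ Q → Indecomposable B.mor → TwoSidedLE A B →
    TwoSidedLE B D → B ∈ Q
  rightLE_symm {A B : OneMor C} : A ∈ Q → B ∈ Q → RightLE A B → RightLE B A
  leftLE_symm {A B : OneMor C} : A ∈ Q → B ∈ Q → LeftLE A B → LeftLE B A
  iso {A B : OneMor C} : A ∈ Q → B ∈ Q → RightLE A B → LeftLE A B → Iso₁ A B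
  exists_meet {A B : OneMor C} : A ∈ Q → B ∈ Q → ∃ D ∈ Q, RightLE A D ∧ LeftLE B D

/-- `F` is a summand of `F ∘ F* ∘ F`, so `F` and `F*` generate the same two-sided cell. Duality then
carries the incomparability of right cells over to left cells. Uniqueness in `L ∩ R` gives the field
`iso`, and nonemptiness gives `exists_meet`. -/
theorem cellCombinatorics (k : Type uk) [Field k] [LinearBicategory k C] [IsFinitary k C]
    (hI : I.HasAdjunctions) {Q : Set (OneMor C)} (hQ : IsTwoSidedCell Q)
    (hreg : IsStronglyRegularCell Q) : CellCombinatorics I Q := by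
  obtain ⟨F₀, hF₀, rfl⟩ := hQ
  have hind : ∀ {A : OneMor C}, A ∈ cellOf TwoSidedLE F₀ → Indecomposable A.mor := fun h => h.1
  have hconv : ∀ {A B D : OneMor C}, A ∈ cellOf TwoSidedLE F₀ → D ∈ cellOf TwoSidedLE F₀ →
      Indecomposable B.mor → TwoSidedLE A B → TwoSidedLE B D → B ∈ cellOf TwoSidedLE F₀ :=
    fun hA hD hB h h' => ⟨hB, hA.2.1.trans h, h'.trans hD.2.2⟩
  have hdual : ∀ {A : OneMor C}, A ∈ cellOf TwoSidedLE F₀ →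
      I.dual₁ A ∈ cellOf TwoSidedLE F₀ := by
    intro A hA
    have h1 : ∀ B : OneMor C, TwoSidedLE (I.dual₁ B) B := fun B => by
      obtain ⟨r⟩ := hI.retract B.mor
      exact .mk B.mor B.mor r
    refine hconv hA hA (I.indecomposable_dual k hA.1) ?_ (h1 A)
    exact (I.dual₁_dual₁ A).symm.rightLE.twoSidedLE.trans (h1 (I.dual₁ A))
  have hR : ∀ {A : OneMor C}, A ∈ cellOf TwoSidedLE F₀ →
      cellOf RightLE A ⊆ cellOf TwoSidedLE F₀ := fun hA B hB =>
    hconv hA hA hB.1 hB.2.1.twoSidedLE hB.2.2.twoSidedLE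
  have hL : ∀ {A : OneMor C}, A ∈ cellOf TwoSidedLE F₀ →
      cellOf LeftLE A ⊆ cellOf TwoSidedLE F₀ := fun hA B hB =>
    hconv hA hA hB.1 hB.2.1.twoSidedLE hB.2.2.twoSidedLE
  have hrs : ∀ {A B : OneMor C}, A ∈ cellOf TwoSidedLE F₀ → B ∈ cellOf TwoSidedLE F₀ →
      RightLE A B → RightLE B A := by
    intro A B hA hB h
    by_cases hc : cellOf RightLE A = cellOf RightLE B
    · have : A ∈ cellOf RightLE B := hc ▸ ⟨hA.1, RightLE.refl A, RightLE.refl A⟩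
      exact this.2.1
    · exact absurd h (hreg.1 _ _ ⟨A, hA.1, rfl⟩ ⟨B, hB.1, rfl⟩ (hR hA) (hR hB) hc A
        ⟨hA.1, RightLE.refl A, RightLE.refl A⟩ B ⟨hB.1, RightLE.refl B, RightLE.refl B⟩)
  have hls : ∀ {A B : OneMor C}, A ∈ cellOf TwoSidedLE F₀ → B ∈ cellOf TwoSidedLE F₀ →
      LeftLE A B → LeftLE B A := fun {A B} hA hB h =>
    leftLE_of_dual (I := I) (hrs (hdual hA) (hdual hB) h.dual)
  refine ⟨hind, hdual, hconv, hrs, hls, ?_, ?_⟩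
  · intro A B hA hB h h'
    obtain ⟨F, -, hu⟩ := hreg.2 (cellOf LeftLE A) (cellOf RightLE A) ⟨A, hA.1, rfl⟩
      ⟨A, hA.1, rfl⟩ (hL hA) (hR hA)
    have h1 := hu A ⟨⟨hA.1, LeftLE.refl A, LeftLE.refl A⟩, ⟨hA.1, RightLE.refl A, RightLE.refl A⟩⟩
    have h2 := hu B ⟨⟨hB.1, h', hls hA hB h'⟩, ⟨hB.1, h, hrs hA hB h⟩⟩
    cases h1 with
    | mk e =>
      obtain ⟨b⟩ := B
      cases h2 with
      | mk e' => exact .mk (e ≪≫ e'.symm)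
  · intro A B hA hB
    obtain ⟨F, hF, -⟩ := hreg.2 (cellOf LeftLE B) (cellOf RightLE A) ⟨B, hB.1, rfl⟩
      ⟨A, hA.1, rfl⟩ (hL hB) (hR hA)
    exact ⟨F, hL hB hF.1, hF.2.2.1, hF.1.2.1⟩

end Cells

end Fiat

end

noncomputable section

namespace Fiat

/-! ### Traces and exact functors -/

section Trace

variable {k : Type uk} [Field k] {D : Type u'} [Category.{w} D] [Abelian D] [Linear k D]

/-- The largest subobject of `X` which is covered by a finite family of objects. -/
theorem exists_trace (hfin : ∀ X Y : D, Module.Finite k (X ⟶ Y)) {n : ℕ} (P : Fin n → D) (X : D) :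
    ∃ (K : D) (ι : K ⟶ X), Mono ι ∧ (∀ a (f : P a ⟶ X), ∃ g, g ≫ ι = f) ∧
      ∀ (Y : D) (g : K ⟶ Y), (∀ a (h : P a ⟶ K), h ≫ g = 0) → g = 0 := by
  have := fun a => hfin (P a) X
  let B := fun a => Module.finBasis k (P a ⟶ X)
  have : HasFiniteBiproducts D := HasFiniteBiproducts.of_hasFiniteProducts
  let J := Σ a : Fin n, Fin (Module.finrank k (P a ⟶ X))
  let T : J → D := fun c => P c.1
  let t : (⨁ T) ⟶ X := biproduct.desc fun c => B c.1 c.2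
  refine ⟨Abelian.image t, Abelian.image.ι t, inferInstance, fun a f => ?_, fun Y g hg => ?_⟩
  · refine ⟨(∑ c, (B a).repr f c • biproduct.ι T ⟨a, c⟩) ≫ Abelian.factorThruImage t, ?_⟩
    rw [Category.assoc, Abelian.image.fac, Preadditive.sum_comp]
    conv_rhs => rw [← (B a).sum_repr f]
    refine Finset.sum_congr rfl fun c _ => ?_
    rw [Linear.smul_comp, biproduct.ι_desc]
  · rw [← cancel_epi (Abelian.factorThruImage t), comp_zero]
    refine biproduct.hom_ext' _ _ fun c => ?_
    rw [comp_zero, ← Category.assoc]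
    exact hg c.1 _

variable {D' : Type v'} [Category.{w'} D'] [Abelian D'] (F : D ⥤ D') [F.Additive]

theorem epi_map_of_isZero_cokernel [PreservesColimits F] {X Y : D} {f : X ⟶ Y}
    (h : IsZero (F.obj (cokernel f))) : Epi (F.map f) := by
  refine Preadditive.epi_of_cokernel_zero ?_
  exact (h.of_iso (PreservesCokernel.iso F f).symm).eq_of_tgt _ _

theorem mono_map_of_isZero_kernel [PreservesLimits F] {X Y : D} {f : X ⟶ Y}
    (h : IsZero (F.obj (kernel f))) : Mono (F.map f) := by
  refine Preadditive.mono_of_kernel_zero ?_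
  exact (h.of_iso (PreservesKernel.iso F f).symm).eq_of_src _ _

end Trace

variable {C : Type u} [Bicategory.{w, v} C]

/-! ### Right cells -/

section RightCells

variable [PreadditiveBicategory C] [AdditiveBicategory C] {Q R : Set (OneMor C)} {A B : OneMor C}

theorem IsCell.indecomposable {le : OneMor C → OneMor C → Prop} (hR : IsCell le R) (hA : A ∈ R) :
    Indecomposable A.mor := by
  obtain ⟨F, -, rfl⟩ := hR
  exact hA.1

theorem IsCell.rightLE (hR : IsRightCell R) (hA : A ∈ R) (hB : B ∈ R) : RightLE A B := by
  obtain ⟨F, -, rfl⟩ := hR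
  exact hA.2.2.trans hB.2.1

theorem IsCell.mem (hR : IsRightCell R) (hA : A ∈ R) (hB : Indecomposable B.mor)
    (h : RightLE A B) (h' : RightLE B A) : B ∈ R := by
  obtain ⟨F, -, rfl⟩ := hR
  exact ⟨hB, hA.2.1.trans h, h'.trans hA.2.2⟩

theorem IsCell.mem_of_iso (hR : IsRightCell R) (hA : A ∈ R) (h : Iso₁ A B) : B ∈ R := by
  refine hR.mem hA ?_ h.rightLE h.symm.rightLE
  cases h with
  | mk e => exact (hR.indecomposable hA).of_iso e

theorem CellCombinatorics.mem {I : Involution C} (hc : CellCombinatorics I Q)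
    (hR : IsRightCell R) (hRQ : R ⊆ Q) (hA : A ∈ R) (hB : B ∈ Q) (h : RightLE A B) : B ∈ R :=
  hR.mem hA (hc.indecomposable hB) h (hc.rightLE_symm (hRQ hA) hB h)

end RightCells

variable [PreadditiveBicategory C]

/-! ### Supports -/

section Support

/-- The adjunction between the actions of adjoint `1`-morphisms on the right Freyd categories. -/
def actAdj (i : C) {j l : C} {F : j ⟶ l} {U : l ⟶ j} (a : Bicategory.Adjunction F U) :
    act i F ⊣ act i U :=
  Adjunction.ofCat ((principal i).mapAdjunction a)

instance [HasBiadjoints C] (i : C) {j l : C} (F : j ⟶ l) : PreservesLimits (act i F) := by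
  obtain ⟨U, -, ⟨a⟩⟩ := HasBiadjoints.exists_biadjoint F
  exact (actAdj i a).rightAdjoint_preservesLimits

instance [HasBiadjoints C] (i : C) {j l : C} (F : j ⟶ l) : PreservesColimits (act i F) := by
  obtain ⟨U, ⟨a⟩, -⟩ := HasBiadjoints.exists_biadjoint F
  exact (actAdj i a).leftAdjoint_preservesColimits

variable [AdditiveBicategory C]

instance {i j : C} (F : i ⟶ j) : Projective (proj F) := pr_projective F

/-- This is the adjunction `F* ⊣ F` combined with `F* P_J ≅ P_{F* ∘ J}`. -/
theorem exists_ne_zero_act_iff {I : Involution C} (hI : I.HasAdjunctions) {i j l : C} (F : j ⟶ l)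
    (J : i ⟶ l) (X : Preadditive.RightFreyd (i ⟶ j)) :
    (∃ f : proj J ⟶ (act i F).obj X, f ≠ 0) ↔ ∃ f : proj (J ≫ I.dual F) ⟶ X, f ≠ 0 := by
  obtain ⟨a⟩ := hI.dual_adj F
  let e := (actAdj i a).homAddEquiv (proj J) X
  constructor
  · rintro ⟨f, hf⟩
    refine ⟨(actProjIso J (I.dual F)).inv ≫ e.symm f, fun h => hf ?_⟩
    exact (map_eq_zero_iff e.symm e.symm.injective).1
      ((Preadditive.IsIso.comp_left_eq_zero _ _).1 h)
  · rintro ⟨f, hf⟩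
    refine ⟨e ((actProjIso J (I.dual F)).hom ≫ f), fun h => hf ?_⟩
    exact (Preadditive.IsIso.comp_left_eq_zero _ _).1 ((map_eq_zero_iff e e.injective).1 h)

theorem exists_summand_proj (k : Type uk) [Field k] [LinearBicategory k C]
    [IsFinitary k C] {i j : C} {H : i ⟶ j} {X : Preadditive.RightFreyd (i ⟶ j)}
    {f : proj H ⟶ X} (hf : f ≠ 0) :
    ∃ (J : i ⟶ j) (r : Retract J H), Indecomposable J ∧ (pr _).map r.i ≫ f ≠ 0 := by
  obtain ⟨ι, _, F, s, p, hi, h1, -, hs⟩ := decomposition k H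
  by_contra! hc
  apply hf
  have : (pr _).map (∑ a, p a ≫ s a) ≫ f = f := by
    rw [hs, CategoryTheory.Functor.map_id, Category.id_comp]
  rw [← this, Functor.map_sum, Preadditive.sum_comp]
  refine Finset.sum_eq_zero fun a _ => ?_
  rw [Functor.map_comp, Category.assoc, hc (F a) ⟨s a, p a, h1 a⟩ (hi a), comp_zero]

theorem exists_indecomposable_proj (k : Type uk) [Field k] [LinearBicategory k C]
    [IsFinitary k C] {i j : C} {X : Preadditive.RightFreyd (i ⟶ j)}
    (hX : ¬ IsZero X) : ∃ (J : i ⟶ j) (f : proj J ⟶ X), Indecomposable J ∧ f ≠ 0 := by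
  by_contra! hc
  refine hX (freyd_isZero_of_pr fun A f => ?_)
  by_contra hf
  obtain ⟨J, r, hJ, hne⟩ := exists_summand_proj k hf
  exact hne (hc J _ hJ)

/-- By adjunction a nonzero map `P_A → F X` is a nonzero map `P_{F* ∘ A} → X`, and the
indecomposable summands of the various `F* ∘ A` are exactly the indecomposable `J` with `F* ≤_L J`.
Thus `F` detects precisely the composition factors `L_J` with `F* ≤_L J`. -/
theorem not_isZero_act_iff (k : Type uk) [Field k] [LinearBicategory k C]
    [IsFinitary k C] {I : Involution C} (hI : I.HasAdjunctions) {i j l : C} (F : j ⟶ l)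
    (X : Preadditive.RightFreyd (i ⟶ j)) :
    ¬ IsZero ((act i F).obj X) ↔ ∃ (J : i ⟶ j) (f : proj J ⟶ X), Indecomposable J ∧
      LeftLE ⟨I.dual F⟩ ⟨J⟩ ∧ f ≠ 0 := by
  constructor
  · intro h
    obtain ⟨A, f, -, hf⟩ := exists_indecomposable_proj k h
    obtain ⟨g, hg⟩ := (exists_ne_zero_act_iff hI F A X).1 ⟨f, hf⟩
    obtain ⟨J, r, hJ, hne⟩ := exists_summand_proj k hg
    exact ⟨J, _, hJ, leftLE_of_retract r, hne⟩
  · rintro ⟨J, f, -, hle, hf⟩ hz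
    obtain ⟨H, ⟨r⟩⟩ := leftLE_iff.1 hle
    obtain ⟨g, hg⟩ := (exists_ne_zero_act_iff hI F H X).2 ⟨(pr _).map r.r ≫ f, fun h => hf (by
      rw [← Category.id_comp f, ← CategoryTheory.Functor.map_id, ← r.retract, Functor.map_comp,
        Category.assoc, h, comp_zero])⟩
    exact hg (hz.eq_of_tgt _ _)

/-- The objects annihilated by a `1`-morphism only depend on its right cell. -/
theorem isZero_act_of_rightLE (k : Type uk) [Field k] [LinearBicategory k C]
    [IsFinitary k C] {I : Involution C} (hI : I.HasAdjunctions) {i j l m : C}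
    {F : j ⟶ l} {F' : j ⟶ m} (h : RightLE ⟨F⟩ ⟨F'⟩) {X : Preadditive.RightFreyd (i ⟶ j)}
    (hX : IsZero ((act i F).obj X)) : IsZero ((act i F').obj X) := by
  by_contra hc
  obtain ⟨J, f, hJ, hle, hf⟩ := (not_isZero_act_iff k hI F' X).1 hc
  exact (not_isZero_act_iff k hI F X).2 ⟨J, f, hJ, (RightLE.dual (I := I) h).trans hle, hf⟩ hX

/-- Lifting `t` through `t'` gives a map `P_J → P_{J'}`, surjective because `T` is the only top of
`P_{J'}`. It splits, so `J'` is a nonzero retract of the indecomposable `J`. -/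
theorem iso_of_top (k : Type uk) [Field k] [LinearBicategory k C]
    [IsFinitary k C] [HomAbelian C] {i j : C} {J J' : i ⟶ j} (hJ : Indecomposable J)
    (hJ' : Indecomposable J') {T : Preadditive.RightFreyd (i ⟶ j)} [Simple T] {t : proj J ⟶ T}
    {t' : proj J' ⟶ T} (ht : t ≠ 0) (ht' : t' ≠ 0) : Nonempty (J ≅ J') := by
  have := epi_of_ne_zero ht'
  have : IsIdempotentComplete (i ⟶ j) := IsFinitary.isIdempotentComplete (k := k) i j
  have h1 : Projective.factorThru t t' ≫ t' = t := Projective.factorThru_comp _ _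
  have := (isFiniteAbelian_principal k i j).epi_of_comp_top (isLocalObj_proj k hJ') ht'
    (Projective.factorThru t t') (by rwa [h1])
  obtain ⟨a, ha⟩ := (pr _).map_surjective (Projective.factorThru t t')
  obtain ⟨b, hb⟩ := (pr _).map_surjective
    (Projective.factorThru (𝟙 (proj J')) (Projective.factorThru t t'))
  obtain ⟨e⟩ := hJ.iso_of_retract hJ'.1 ⟨b, a, (pr _).map_injective (by
    rw [Functor.map_comp, ha, hb, Projective.factorThru_comp, CategoryTheory.Functor.map_id])⟩
  exact ⟨e.symm⟩

end Support

end Fiat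

end

noncomputable section

namespace Fiat

variable {C : Type u} [Bicategory.{w, v} C] [PreadditiveBicategory C] [AdditiveBicategory C]

/-! ### Existence of cell data -/

section Existence

/-- A morphism inducing the identity up to isomorphism: `F P_1 ≅ P_F`. -/
def actUnitIso {i j : C} (F : i ⟶ j) : (act i F).obj (proj (𝟙 i)) ≅ proj F :=
  actProjIso (𝟙 i) F ≪≫ (pr _).mapIso (λ_ F)

theorem actUnitIso_naturality {i j : C} {F F' : i ⟶ j} (a : F ⟶ F') :
    (actNat i a).app (proj (𝟙 i)) ≫ (actUnitIso F').hom = (actUnitIso F).hom ≫ (pr _).map a := by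
  have h1 : (actUnitIso F').hom = (actProjIso (𝟙 i) F').hom ≫ (pr _).map (λ_ F').hom := rfl
  have h2 : (actUnitIso F).hom = (actProjIso (𝟙 i) F).hom ≫ (pr _).map (λ_ F).hom := rfl
  rw [h1, h2, ← Category.assoc, actProjIso_naturality₂, Category.assoc, Category.assoc,
    ← Functor.map_comp, ← Functor.map_comp, leftUnitor_naturality]

/-- `K` is the trace in `P_𝟙` of the projectives `P_J` with `F* ≤_L J`. Then `F` kills `P_𝟙 / K`, so
`F K ≅ F P_𝟙 ≅ P_F` is projective with local endomorphism ring, while `F` kills no nonzero quotient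
of `K`. Two different simple quotients of `K` would contradict locality. Every element of `R`
annihilates the same objects as `F`. -/
theorem exists_cellDatum (k : Type uk) [Field k] [LinearBicategory k C] [IsFinitary k C]
    [HomAbelian C] [HasBiadjoints C] {I : Involution C} (hI : I.HasAdjunctions)
    {R : Set (OneMor C)} (hR : IsRightCell R) : Nonempty (CellDatum R) := by
  obtain ⟨⟨F⟩, hF, rfl⟩ := hR
  rename_i i j
  have hsrc : ∀ A ∈ cellOf RightLE ⟨F⟩, A.src = i := fun A hA => hA.2.1.src_eq.symm
  have hfab := isFiniteAbelian_principal k i i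
  obtain ⟨n, rep, hrep⟩ := IsFinitary.finite_indecomposables (k := k) i i
  classical
  obtain ⟨Z₀, hZ₀⟩ := HasZeroObject.zero (C := Preadditive.RightFreyd (i ⟶ i))
  -- Irrelevant representatives are replaced by a zero object, to keep a family indexed by `Fin n`.
  let Pf : Fin n → Preadditive.RightFreyd (i ⟶ i) := fun a =>
    if LeftLE ⟨I.dual F⟩ ⟨rep a⟩ then proj (rep a) else Z₀
  obtain ⟨K, ι, hι, htr, hgen⟩ := exists_trace hfab.finite_hom Pf (proj (𝟙 i))
  have htr' : ∀ (J : i ⟶ i) (_ : Indecomposable J), LeftLE ⟨I.dual F⟩ ⟨J⟩ →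
      ∀ f : proj J ⟶ proj (𝟙 i), ∃ g, g ≫ ι = f := by
    intro J hJ hle f
    obtain ⟨a, ⟨e⟩⟩ := hrep J hJ
    have hle' : LeftLE ⟨I.dual F⟩ ⟨rep a⟩ := hle.trans (Iso₁.leftLE (.mk e))
    have hPf : Pf a = proj (rep a) := if_pos hle'
    obtain ⟨g, hg⟩ := htr a (eqToHom hPf ≫ (pr _).map e.inv ≫ f)
    refine ⟨(pr _).map e.hom ≫ eqToHom hPf.symm ≫ g, ?_⟩
    rw [Category.assoc, Category.assoc, hg, eqToHom_trans_assoc, eqToHom_refl, Category.id_comp,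
      ← Category.assoc, ← Functor.map_comp, Iso.hom_inv_id, CategoryTheory.Functor.map_id,
      Category.id_comp]
  have hgen' : ∀ (Y : Preadditive.RightFreyd (i ⟶ i)) (g : K ⟶ Y), g ≠ 0 →
      ∃ (J : i ⟶ i) (h : proj J ⟶ K), Indecomposable J ∧ LeftLE ⟨I.dual F⟩ ⟨J⟩ ∧ h ≫ g ≠ 0 := by
    intro Y g hg
    by_contra! hc
    refine hg (hgen Y g fun a h => ?_)
    by_cases hle : LeftLE ⟨I.dual F⟩ ⟨rep a⟩
    · have hPf : proj (rep a) = Pf a := (if_pos hle).symm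
      by_contra hne
      have hne' : (eqToHom hPf ≫ h) ≫ g ≠ 0 := by
        rw [Category.assoc]
        exact fun h0 => hne ((Preadditive.IsIso.comp_left_eq_zero _ _).1 h0)
      -- The listed representative need not itself be indecomposable, so a summand is taken; it is
      -- still left above `F*`.
      obtain ⟨J, r, hJ, hne2⟩ := exists_summand_proj k hne'
      obtain ⟨H, ⟨s⟩⟩ := leftLE_iff.1 hle
      exact hne2 ((Category.assoc _ _ _).symm.trans
        (hc J ((pr _).map r.i ≫ eqToHom hPf ≫ h) hJ (leftLE_of_retract (r.trans s))))
    · have hPf : Pf a = Z₀ := if_neg hle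
      have hz : IsZero (Pf a) := hPf ▸ hZ₀
      exact hz.eq_of_src _ _
  have hFne : ∀ (Y : Preadditive.RightFreyd (i ⟶ i)) (g : K ⟶ Y), g ≠ 0 →
      ¬ IsZero ((act i F).obj Y) := by
    intro Y g hg
    obtain ⟨J, h, hJ, hle, hne⟩ := hgen' Y g hg
    exact (not_isZero_act_iff k hI F Y).2 ⟨J, h ≫ g, hJ, hle, hne⟩
  have hZ : ∀ (Z : Preadditive.RightFreyd (i ⟶ i)) (c : proj (𝟙 i) ⟶ Z), ι ≫ c = 0 → Epi c →
      IsZero ((act i F).obj Z) := by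
    intro Z c hc hepi
    by_contra hne
    obtain ⟨J, f, hJ, hle, hf⟩ := (not_isZero_act_iff k hI F Z).1 hne
    obtain ⟨g, hg⟩ := htr' J hJ hle (Projective.factorThru f c)
    exact hf (by rw [← Projective.factorThru_comp f c, ← hg, Category.assoc, hc, comp_zero])
  have : Epi ((act i F).map ι) := epi_map_of_isZero_cokernel (act i F)
    (hZ _ (cokernel.π ι) (cokernel.condition ι) inferInstance)
  have : IsIso ((act i F).map ι) := isIso_of_mono_of_epi _
  let eF : proj F ≅ (act i F).obj K := (actUnitIso F).symm ≪≫ (asIso ((act i F).map ι)).symm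
  have hloc : IsLocalObj ((act i F).obj K) := (isLocalObj_proj k hF).of_iso eF
  have : Projective ((act i F).obj K) := Projective.of_iso eF inferInstance
  have hK : ¬ IsZero K := fun hz => hloc.1 (Functor.map_isZero (act i F) hz)
  obtain ⟨L, π, hL, hπ⟩ := hfab.exists_simple_quotient hK
  have hπ0 : π ≠ 0 := fun h => hK (by
    have : Epi (0 : K ⟶ L) := h ▸ hπ
    exact absurd (IsZero.of_epi_zero K L) (Simple.not_isZero L))
  obtain ⟨G, p, hG, hp⟩ := exists_indecomposable_proj k (Simple.not_isZero L)
  have hFL := hFne L π hπ0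
  refine ⟨{
    i := i
    src_eq := hsrc
    K := K
    ι := ι
    mono_ι := hι
    annihilates := ?_
    G := G
    indecomposable_G := hG
    L := L
    simple_L := hL
    p := p
    epi_p := epi_of_ne_zero hp
    π := π
    epi_π := hπ
    simple_top := ?_
    not_annihilates := ?_ }⟩
  · intro Z c h ⟨hcol⟩ Y S a b _ _ _ j' F' hF'
    refine isZero_act_of_rightLE k hI hF'.2.1 ?_
    have h1 := hZ Z c h (epi_of_isColimit_cofork hcol)
    have h2 : IsZero ((act i F).obj Y) := IsZero.of_mono ((act i F).map a) h1
    exact IsZero.of_epi ((act i F).map b) h2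
  · intro S f _
    by_cases hf : f = 0
    · exact ⟨0, by simp [hf]⟩
    by_cases hN : kernel.ι π ≫ f = 0
    · exact ⟨Abelian.epiDesc π f hN, (Abelian.comp_epiDesc _ _ _).symm⟩
    -- If `f` is nonzero on the kernel of `π`, then `F f` lifts through `F (kernel π)` since `F K`
    -- is projective. The resulting endomorphism of `F K` is killed by `F π` and fixed by `F f`, so
    -- locality makes `F L` or `F S` zero.
    exfalso
    have := epi_of_ne_zero hN
    let φ := Projective.factorThru ((act i F).map f) ((act i F).map (kernel.ι π ≫ f))
    have hφ : (φ ≫ (act i F).map (kernel.ι π)) ≫ (act i F).map f = (act i F).map f := by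
      rw [Category.assoc, ← Functor.map_comp]
      exact Projective.factorThru_comp _ _
    have := epi_of_ne_zero hf
    rcases hloc.2 (φ ≫ (act i F).map (kernel.ι π)) with h | h
    · refine hFL ?_
      have h0 : (φ ≫ (act i F).map (kernel.ι π)) ≫ (act i F).map π = 0 := by
        rw [Category.assoc, ← Functor.map_comp, kernel.condition, Functor.map_zero, comp_zero]
      have h1 := (Preadditive.IsIso.comp_left_eq_zero _ _).1 h0
      exact IsZero.of_epi_eq_zero _ h1
    · refine hFne S f hf ?_
      have h0 : (𝟙 _ - φ ≫ (act i F).map (kernel.ι π)) ≫ (act i F).map f = 0 := by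
        rw [Preadditive.sub_comp, hφ, Category.id_comp, sub_self]
      have h1 := (Preadditive.IsIso.comp_left_eq_zero _ _).1 h0
      exact IsZero.of_epi_eq_zero _ h1
  · intro j' F' hF' hz
    exact hFL (isZero_act_of_rightLE k hI hF'.2.2 hz)

end Existence

end Fiat

end

noncomputable section

namespace Fiat

variable {C : Type u} [Bicategory.{w, v} C] [PreadditiveBicategory C] [AdditiveBicategory C]

/-! ### Sums of elements of a right cell -/

section AddR

/-- All indecomposable summands of `F` belong to `R`. -/
def AddR (R : Set (OneMor C)) {i j : C} (F : i ⟶ j) : Prop :=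
  ∀ (J : i ⟶ j) (_ : Retract J F), Indecomposable J → (⟨J⟩ : OneMor C) ∈ R

variable {R : Set (OneMor C)}

/-- An indecomposable summand of a sum is a summand of one of the terms. -/
theorem exists_retract_of_sum {V : Type u'} [Category.{v'} V] [Preadditive V] {X S : V}
    (hS : IsLocalObj S) (r : Retract S X) {ι : Type*} [Fintype ι] {F : ι → V} (s : ∀ a, F a ⟶ X)
    (p : ∀ a, X ⟶ F a) (hs : ∑ a, p a ≫ s a = 𝟙 X) : ∃ a, Nonempty (Retract S (F a)) := by
  have h1 : ∑ a, (r.i ≫ p a) ≫ (s a ≫ r.r) = 𝟙 S := by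
    calc ∑ a, (r.i ≫ p a) ≫ (s a ≫ r.r) = r.i ≫ (∑ a, p a ≫ s a) ≫ r.r := by
          simp [Preadditive.sum_comp, Preadditive.comp_sum]
      _ = 𝟙 S := by rw [hs]; simp
  obtain ⟨a, -, ha⟩ := hS.exists_isIso_of_sum Finset.univ (fun a => (r.i ≫ p a) ≫ (s a ≫ r.r))
    (by rw [h1]; infer_instance)
  exact ⟨a, ⟨⟨r.i ≫ p a, (s a ≫ r.r) ≫ inv ((r.i ≫ p a) ≫ (s a ≫ r.r)), by
      rw [← Category.assoc]; exact IsIso.hom_inv_id _⟩⟩⟩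

theorem addR_of_sum (k : Type uk) [Field k] [LinearBicategory k C] [IsFinitary k C]
    {i j : C} {X : i ⟶ j} {ι : Type*} [Fintype ι] {F : ι → (i ⟶ j)}
    (s : ∀ a, F a ⟶ X) (p : ∀ a, X ⟶ F a) (hF : ∀ a, AddR R (F a))
    (hs : ∑ a, p a ≫ s a = 𝟙 X) : AddR R X := by
  intro J r hJ
  obtain ⟨a, ⟨r'⟩⟩ := exists_retract_of_sum (isLocalObj_of_indecomposable k hJ) r s p hs
  exact hF a J r' hJ

theorem addR_of_mem (k : Type uk) [Field k] [LinearBicategory k C] [IsFinitary k C]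
    (hR : IsRightCell R) {i j : C} {F : i ⟶ j} (hF : (⟨F⟩ : OneMor C) ∈ R) : AddR R F := by
  intro J r hJ
  have : IsIdempotentComplete (i ⟶ j) := IsFinitary.isIdempotentComplete (k := k) i j
  obtain ⟨e⟩ := (hR.indecomposable hF).iso_of_retract hJ.1 r
  exact hR.mem_of_iso hF (.mk e.symm)

theorem addR_biprod (k : Type uk) [Field k] [LinearBicategory k C] [IsFinitary k C]
    {i j : C} {F G : i ⟶ j} (hF : AddR R F) (hG : AddR R G) : AddR R (F ⊞ G) :=
  addR_of_sum k (ι := Bool) (F := fun b => cond b F G)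
    (fun b => match b with | true => biprod.inl | false => biprod.inr)
    (fun b => match b with | true => biprod.fst | false => biprod.snd)
    (fun b => match b with | true => hF | false => hG) (by simp)

theorem addR_biproduct (k : Type uk) [Field k] [LinearBicategory k C] [IsFinitary k C]
    (hR : IsRightCell R) {i j : C} {n : ℕ} {F : Fin n → (i ⟶ j)}
    (hF : ∀ a, (⟨F a⟩ : OneMor C) ∈ R) : AddR R (⨁ F) :=
  addR_of_sum k (biproduct.ι F) (biproduct.π F) (fun a => addR_of_mem k hR (hF a))
    biproduct.total

theorem AddR.exists_biproduct (k : Type uk) [Field k] [LinearBicategory k C] [IsFinitary k C]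
    {i j : C} {F : i ⟶ j} (h : AddR R F) : ∃ (n : ℕ) (F' : Fin n → (i ⟶ j)),
      (∀ a, (⟨F' a⟩ : OneMor C) ∈ R) ∧ Nonempty (Retract F (⨁ F')) := by
  obtain ⟨ι, _, F', s, p, hi, h1, -, hs⟩ := decomposition k F
  let e := Fintype.equivFin ι
  refine ⟨Fintype.card ι, fun c => F' (e.symm c), fun c => h _ ⟨s _, p _, h1 _⟩ (hi _),
    ⟨biproduct.lift fun c => p (e.symm c), biproduct.desc fun c => s (e.symm c), ?_⟩⟩
  rw [biproduct.lift_desc, ← hs, ← e.symm.sum_comp (fun a => p a ≫ s a)]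

end AddR

/-! ### The projections from `P_F` to `F L` -/

namespace CellDatum

variable {R : Set (OneMor C)} (d : CellDatum R)

instance : Mono d.ι := d.mono_ι
instance : Simple d.L := d.simple_L
instance : Epi d.p := d.epi_p
instance : Epi d.π := d.epi_π

theorem exists_mor {A : OneMor C} (hA : A ∈ R) : ∃ (j : C) (F : d.i ⟶ j), A = ⟨F⟩ := by
  obtain ⟨F⟩ := A
  rename_i i j
  have h : i = d.i := d.src_eq _ hA
  subst h
  exact ⟨j, F, rfl⟩

/-- The projection `P_F → F L`, for `F` a sum of elements of `R`. -/
def q {j : C} (F : d.i ⟶ j) : proj F ⟶ (Fiat.act d.i F).obj d.L :=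
  open Classical in
  -- The value `0` is only a default: by `isIso_act_ι` the first case holds whenever all
  -- indecomposable summands of `F` lie in `R`.
  if _h : IsIso ((Fiat.act d.i F).map d.ι) then
    (actUnitIso F).inv ≫ inv ((Fiat.act d.i F).map d.ι) ≫ (Fiat.act d.i F).map d.π else 0

/-- The action of a sum of elements of `R` in terms of its summands. -/
theorem isZero_act_of_addR (k : Type uk) [Field k] [LinearBicategory k C] [IsFinitary k C]
    {j : C} {F : d.i ⟶ j} (hF : AddR R F) {X : Preadditive.RightFreyd (d.i ⟶ d.i)}
    (h : ∀ {F' : d.i ⟶ j}, (⟨F'⟩ : OneMor C) ∈ R → IsZero ((Fiat.act d.i F').obj X)) :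
    IsZero ((Fiat.act d.i F).obj X) := by
  by_contra hc
  obtain ⟨J, r, hJ, hne⟩ := (principalRep k d.i).exists_summand_not_isZero (X := X) hc
  exact hne (h (hF J r hJ))

variable [HomAbelian C]

/-- The datum speaks only of simple subquotients. If `F` did not kill `P_𝟙 / K`, the support
criterion would give a nonzero `P_J → P_𝟙 / K` with `F* ≤_L J`, and a simple quotient of its image
would survive `F`. -/
theorem isZero_act_cokernel (k : Type uk) [Field k] [LinearBicategory k C] [IsFinitary k C]
    {I : Involution C} (hI : I.HasAdjunctions) {j : C} {F : d.i ⟶ j}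
    (hF : (⟨F⟩ : OneMor C) ∈ R) : IsZero ((Fiat.act d.i F).obj (cokernel d.ι)) := by
  by_contra hne
  obtain ⟨J, f, hJ, hle, hf⟩ := (not_isZero_act_iff k hI F _).1 hne
  have hY : ¬ IsZero (Abelian.image f) := fun hz => hf (by
    rw [← Abelian.image.fac f, hz.eq_of_tgt (Abelian.factorThruImage f) 0, zero_comp])
  obtain ⟨S, b, hS, hb⟩ := (isFiniteAbelian_principal k d.i d.i).exists_simple_quotient hY
  refine (not_isZero_act_iff k hI F S).2 ⟨J, Abelian.factorThruImage f ≫ b, hJ, hle, fun h0 => ?_⟩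
    (d.annihilates _ (cokernel.π d.ι) (cokernel.condition d.ι) ⟨cokernelIsCokernel d.ι⟩ _ S
      (Abelian.image.ι f) b inferInstance hb hS F hF)
  have h1 := (cancel_epi (Abelian.factorThruImage f)).1 (h0.trans comp_zero.symm)
  exact Simple.not_isZero S (IsZero.of_epi_eq_zero _ h1)

variable [HasBiadjoints C]

theorem isIso_act_ι (k : Type uk) [Field k] [LinearBicategory k C] [IsFinitary k C]
    {I : Involution C} (hI : I.HasAdjunctions) {j : C} {F : d.i ⟶ j} (hF : AddR R F) :
    IsIso ((Fiat.act d.i F).map d.ι) := by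
  have := epi_map_of_isZero_cokernel (Fiat.act d.i F)
    (d.isZero_act_of_addR k hF fun h => d.isZero_act_cokernel k hI h)
  exact isIso_of_mono_of_epi _

theorem ι_q (k : Type uk) [Field k] [LinearBicategory k C] [IsFinitary k C]
    {I : Involution C} (hI : I.HasAdjunctions) {j : C} {F : d.i ⟶ j} (hF : AddR R F) :
    (Fiat.act d.i F).map d.ι ≫ (actUnitIso F).hom ≫ d.q F = (Fiat.act d.i F).map d.π := by
  have h := d.isIso_act_ι k hI hF
  rw [q, dif_pos h, Iso.hom_inv_id_assoc, IsIso.hom_inv_id_assoc]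

theorem epi_q (k : Type uk) [Field k] [LinearBicategory k C] [IsFinitary k C]
    {I : Involution C} (hI : I.HasAdjunctions) {j : C} {F : d.i ⟶ j} (hF : AddR R F) :
    Epi (d.q F) := by
  have h := d.ι_q k hI hF
  rw [← Category.assoc] at h
  exact epi_of_epi_fac h

/-- Naturality along `K → L` and `K → P_𝟙`. Only `F` must be a sum of elements of `R`: allowing
arbitrary `H` is what later lets `eval_L_eq_zero` apply to a projective cover of the kernel of `P_F
→ F L`. -/
theorem π_eval (k : Type uk) [Field k] [LinearBicategory k C] [IsFinitary k C]
    {I : Involution C} (hI : I.HasAdjunctions) {j : C} {H F : d.i ⟶ j} (m : H ⟶ F)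
    (hF : AddR R F) :
    (Fiat.act d.i H).map d.π ≫ (actNat d.i m).app d.L =
      (Fiat.act d.i H).map d.ι ≫ (actUnitIso H).hom ≫ (pr _).map m ≫ d.q F := by
  rw [(actNat d.i m).naturality d.π, ← d.ι_q k hI hF, ← Category.assoc,
    ← (actNat d.i m).naturality d.ι, Category.assoc, ← Category.assoc ((actNat d.i m).app _),
    actUnitIso_naturality, Category.assoc]

theorem pr_map_q (k : Type uk) [Field k] [LinearBicategory k C] [IsFinitary k C]
    {I : Involution C} (hI : I.HasAdjunctions) {j : C} {H F : d.i ⟶ j} (m : H ⟶ F)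
    (hH : AddR R H) (hF : AddR R F) :
    (pr _).map m ≫ d.q F = d.q H ≫ (actNat d.i m).app d.L := by
  have h := d.isIso_act_ι k hI hH
  have h1 := d.π_eval k hI m hF
  rw [← d.ι_q k hI hH, Category.assoc, Category.assoc] at h1
  exact ((cancel_epi (actUnitIso H).hom).1 ((cancel_epi ((act d.i H).map d.ι)).1 h1)).symm

theorem eval_L_eq_zero (k : Type uk) [Field k] [LinearBicategory k C] [IsFinitary k C]
    {I : Involution C} (hI : I.HasAdjunctions) {j : C} {H F : d.i ⟶ j} (m : H ⟶ F)
    (hF : AddR R F) (h : (pr _).map m ≫ d.q F = 0) : (actNat d.i m).app d.L = 0 := by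
  rw [← cancel_epi ((act d.i H).map d.π), d.π_eval k hI m hF, h]
  simp

end CellDatum

end Fiat

end

noncomputable section

namespace Fiat

/-! ### Cokernels -/

section Coker

variable {D : Type u'} [Category.{w} D] [Preadditive D]

/-- `p` is a cokernel of `f`. -/
def IsCoker {X Y Z : D} (f : X ⟶ Y) (p : Y ⟶ Z) : Prop :=
  ∃ h : f ≫ p = 0, Nonempty (IsColimit (CokernelCofork.ofπ p h))

theorem isCoker_iff {X Y Z : D} {f : X ⟶ Y} {p : Y ⟶ Z} : IsCoker f p ↔
    f ≫ p = 0 ∧ Epi p ∧ ∀ (W : D) (g : Y ⟶ W), f ≫ g = 0 → ∃ l, p ≫ l = g := by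
  constructor
  · rintro ⟨h, ⟨hl⟩⟩
    exact ⟨h, epi_of_isColimit_cofork hl,
      fun W g hg => ⟨_, (CokernelCofork.IsColimit.desc' hl g hg).2⟩⟩
  · rintro ⟨h, _, hd⟩
    exact ⟨h, ⟨CokernelCofork.IsColimit.ofπ _ _ (fun g hg => (hd _ g hg).choose)
      (fun g hg => (hd _ g hg).choose_spec)
      (fun g hg m hm => (cancel_epi p).1 (hm.trans (hd _ g hg).choose_spec.symm))⟩⟩

theorem IsCoker.zero {X Y Z : D} {f : X ⟶ Y} {p : Y ⟶ Z} (h : IsCoker f p) : f ≫ p = 0 := h.1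

theorem IsCoker.epi {X Y Z : D} {f : X ⟶ Y} {p : Y ⟶ Z} (h : IsCoker f p) : Epi p :=
  (isCoker_iff.1 h).2.1

theorem IsCoker.exists_desc {X Y Z : D} {f : X ⟶ Y} {p : Y ⟶ Z} (h : IsCoker f p) {W : D}
    (g : Y ⟶ W) (hg : f ≫ g = 0) : ∃ l, p ≫ l = g :=
  (isCoker_iff.1 h).2.2 W g hg

theorem isCoker_cokernel {X Y : D} (f : X ⟶ Y) [HasCokernel f] : IsCoker f (cokernel.π f) :=
  ⟨cokernel.condition f, ⟨cokernelIsCokernel f⟩⟩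

theorem IsCoker.epi_comp {W X Y Z : D} {f : X ⟶ Y} {p : Y ⟶ Z} (h : IsCoker f p) (e : W ⟶ X)
    [Epi e] : IsCoker (e ≫ f) p := by
  refine isCoker_iff.2 ⟨by rw [Category.assoc, h.zero, comp_zero], h.epi, fun V g hg => ?_⟩
  exact h.exists_desc g ((cancel_epi e).1 (by rw [← Category.assoc, hg, comp_zero]))

theorem isCoker_zero (X Y : D) : IsCoker (0 : X ⟶ Y) (𝟙 Y) :=
  isCoker_iff.2 ⟨zero_comp, inferInstance, fun _ g _ => ⟨g, Category.id_comp g⟩⟩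

theorem IsCoker.map {D' : Type v'} [Category.{w'} D'] [Preadditive D'] (F : D ⥤ D') [F.Additive]
    [PreservesColimits F] {X Y Z : D} {f : X ⟶ Y} {p : Y ⟶ Z} (h : IsCoker f p) :
    IsCoker (F.map f) (F.map p) := by
  obtain ⟨h0, ⟨hl⟩⟩ := h
  exact ⟨by rw [← F.map_comp, h0, F.map_zero], ⟨CokernelCofork.mapIsColimit _ hl F⟩⟩

variable {A : Type u'} [Category.{w} A] [Abelian A]

/-- Lifting through a cokernel from a projective object. -/
theorem IsCoker.exists_lift {X Y Z : A} {f : X ⟶ Y} {p : Y ⟶ Z} (h : IsCoker f p) {P : A}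
    [Projective P] (t : P ⟶ Y) (ht : t ≫ p = 0) : ∃ s, s ≫ f = t := by
  obtain ⟨l, hl⟩ := h.exists_desc (cokernel.π f) (cokernel.condition f)
  have h0 : t ≫ cokernel.π f = 0 := by rw [← hl, ← Category.assoc, ht, zero_comp]
  let t' : P ⟶ Abelian.image f := kernel.lift _ t h0
  have ht' : t' ≫ Abelian.image.ι f = t := kernel.lift_ι _ _ _
  refine ⟨Projective.factorThru t' (Abelian.factorThruImage f), ?_⟩
  conv_rhs => rw [← ht', ← Projective.factorThru_comp t' (Abelian.factorThruImage f)]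
  rw [Category.assoc, Abelian.image.fac]

end Coker

variable {C : Type u} [Bicategory.{w, v} C] [PreadditiveBicategory C] [AdditiveBicategory C]

/-! ### The Duflo involution of a right cell -/

namespace CellDatum

variable {R : Set (OneMor C)} (d : CellDatum R)

theorem p_ne_zero : d.p ≠ 0 := fun h => Simple.not_isZero d.L (IsZero.of_epi_eq_zero _ h)

/-- The cover `P_G → K`. -/
def cover : proj d.G ⟶ d.K := Projective.factorThru d.p d.π

theorem cover_π : d.cover ≫ d.π = d.p := Projective.factorThru_comp _ _

/-- The `2`-morphism `G → 𝟙` given by `P_G → K → P_𝟙`. -/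
def counit : d.G ⟶ 𝟙 d.i := ((pr _).map_surjective (d.cover ≫ d.ι)).choose

theorem pr_map_counit : (pr _).map d.counit = d.cover ≫ d.ι :=
  ((pr _).map_surjective (d.cover ≫ d.ι)).choose_spec

variable [HomAbelian C]

/-- An indecomposable `J` with a nonzero map `P_J → L` is isomorphic to `G`, so the support
criterion collapses to one condition. -/
theorem not_isZero_act_L_iff (k : Type uk) [Field k] [LinearBicategory k C] [IsFinitary k C]
    {I : Involution C} (hI : I.HasAdjunctions) {j : C} (H : d.i ⟶ j) :
    ¬ IsZero ((Fiat.act d.i H).obj d.L) ↔ LeftLE ⟨I.dual H⟩ ⟨d.G⟩ := by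
  rw [not_isZero_act_iff k hI]
  constructor
  · rintro ⟨J, f, hJ, hle, hf⟩
    obtain ⟨e⟩ := iso_of_top k hJ d.indecomposable_G hf d.p_ne_zero
    exact hle.trans (Iso₁.leftLE (.mk e))
  · intro h
    exact ⟨d.G, d.p, d.indecomposable_G, h, d.p_ne_zero⟩

theorem leftLE_G (k : Type uk) [Field k] [LinearBicategory k C] [IsFinitary k C]
    {I : Involution C} (hI : I.HasAdjunctions) {j : C} {F : d.i ⟶ j}
    (hF : (⟨F⟩ : OneMor C) ∈ R) : LeftLE ⟨I.dual F⟩ ⟨d.G⟩ :=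
  (d.not_isZero_act_L_iff k hI F).1 (d.not_annihilates F hF)

/-- A simple quotient of the cokernel would be a quotient of `K`, hence factor through `L`; but
`P_G` already surjects onto `L`. -/
theorem epi_cover (k : Type uk) [Field k] [LinearBicategory k C] [IsFinitary k C] :
    Epi d.cover := by
  by_contra hc
  have hz : ¬ IsZero (cokernel d.cover) := fun hz =>
    hc (Preadditive.epi_of_cokernel_zero (hz.eq_of_tgt _ _))
  obtain ⟨S, f, hS, hf⟩ := (isFiniteAbelian_principal k d.i d.i).exists_simple_quotient hz
  obtain ⟨g, hg⟩ := d.simple_top S (cokernel.π d.cover ≫ f) hS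
  have h1 : d.p ≫ g = 0 := by
    rw [← d.cover_π, Category.assoc, ← hg, cokernel.condition_assoc, zero_comp]
  have h2 : g = 0 := (cancel_epi d.p).1 (h1.trans comp_zero.symm)
  rw [h2, comp_zero] at hg
  exact Simple.not_isZero S (IsZero.of_epi_eq_zero _ hg)

variable [HasBiadjoints C]

/-- Applying `F` to `P_G → K → P_𝟙` gives an epimorphism onto the projective `P_F`, since `F` makes
the second map invertible. It splits, and the splitting is a 2-morphism by fullness. -/
theorem exists_section (k : Type uk) [Field k] [LinearBicategory k C] [IsFinitary k C]
    {I : Involution C} (hI : I.HasAdjunctions) {j : C} {F : d.i ⟶ j} (hF : AddR R F) :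
    ∃ s : F ⟶ d.G ≫ F, s ≫ d.counit ▷ F ≫ (λ_ F).hom = 𝟙 F := by
  have := d.epi_cover k
  have := d.isIso_act_ι k hI hF
  have h : (pr _).map (d.counit ▷ F ≫ (λ_ F).hom) = (actProjIso d.G F).inv ≫
      ((Fiat.act d.i F).map d.cover ≫ (Fiat.act d.i F).map d.ι) ≫ (actUnitIso F).hom := by
    have h2 : (actUnitIso F).hom = (actProjIso (𝟙 d.i) F).hom ≫ (pr _).map (λ_ F).hom := rfl
    rw [← Functor.map_comp, ← d.pr_map_counit, h2, ← Category.assoc ((act d.i F).map _),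
      actProjIso_naturality, Category.assoc, Iso.inv_hom_id_assoc, Functor.map_comp]
  have : Epi ((pr _).map (d.counit ▷ F ≫ (λ_ F).hom)) := by rw [h]; infer_instance
  obtain ⟨s, hs⟩ := (pr _).map_surjective
    (Projective.factorThru (𝟙 (proj F)) ((pr _).map (d.counit ▷ F ≫ (λ_ F).hom)))
  refine ⟨s, (pr _).map_injective ?_⟩
  rw [Functor.map_comp, hs, CategoryTheory.Functor.map_id]
  exact Projective.factorThru_comp _ _

/-- `G` is squeezed into `Q`: `F L ≠ 0` gives `F* ≤_L G`, and the section exhibits `F` as a summand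
of `F ∘ G`, so `G ≤_R F`. Regularity then reverses the last relation. -/
theorem G_mem (k : Type uk) [Field k] [LinearBicategory k C] [IsFinitary k C]
    {I : Involution C} (hI : I.HasAdjunctions) {Q : Set (OneMor C)} (hc : CellCombinatorics I Q)
    (hR : IsRightCell R) (hRQ : R ⊆ Q) : (⟨d.G⟩ : OneMor C) ∈ R := by
  obtain ⟨A, hA⟩ : ∃ A, A ∈ R := by
    obtain ⟨A, hA, rfl⟩ := hR
    exact ⟨A, hA, RightLE.refl A, RightLE.refl A⟩
  obtain ⟨j, F, rfl⟩ := d.exists_mor hA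
  obtain ⟨s, hs⟩ := d.exists_section k hI (addR_of_mem k hR hA)
  have h1 : RightLE ⟨d.G⟩ ⟨F⟩ := rightLE_of_retract ⟨s, d.counit ▷ F ≫ (λ_ F).hom, hs⟩
  have hG : (⟨d.G⟩ : OneMor C) ∈ Q :=
    hc.convex (hc.dual_mem (hRQ hA)) (hRQ hA) d.indecomposable_G
      (d.leftLE_G k hI hA).twoSidedLE h1.twoSidedLE
  exact hR.mem hA d.indecomposable_G (hc.rightLE_symm hG (hRQ hA) h1) h1

/-- `G L ≠ 0` means `G* ≤_L G`. Reversing and dualizing gives `G* ≤_R G** ≅ G`, so `G*` and `G`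
share both their left and their right cell. -/
theorem dual_G_iso (k : Type uk) [Field k] [LinearBicategory k C] [IsFinitary k C]
    {I : Involution C} (hI : I.HasAdjunctions) {Q : Set (OneMor C)} (hc : CellCombinatorics I Q)
    (hR : IsRightCell R) (hRQ : R ⊆ Q) : Iso₁ ⟨I.dual d.G⟩ ⟨d.G⟩ := by
  have hG := d.G_mem k hI hc hR hRQ
  have hGQ := hRQ hG
  have h1 := d.leftLE_G k hI hG
  have h2 := hc.leftLE_symm (hc.dual_mem hGQ) hGQ h1
  refine hc.iso (hc.dual_mem hGQ) hGQ ?_ h1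
  exact (LeftLE.dual (I := I) h2).trans (I.dual₁_dual₁ ⟨d.G⟩).rightLE

theorem rightLE_of_act_L (k : Type uk) [Field k] [LinearBicategory k C] [IsFinitary k C]
    {I : Involution C} (hI : I.HasAdjunctions) {Q : Set (OneMor C)} (hc : CellCombinatorics I Q)
    (hR : IsRightCell R) (hRQ : R ⊆ Q) {j : C} {H : d.i ⟶ j}
    (h : ¬ IsZero ((Fiat.act d.i H).obj d.L)) : RightLE ⟨H⟩ ⟨d.G⟩ :=
  ((I.dual₁_dual₁ ⟨H⟩).symm.rightLE.trans
    (LeftLE.dual (I := I) ((d.not_isZero_act_L_iff k hI H).1 h))).trans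
    (d.dual_G_iso k hI hc hR hRQ).rightLE

/-- An element of `R` which is right below `G` and left above `F*` is `G`. -/
theorem iso_G (k : Type uk) [Field k] [LinearBicategory k C] [IsFinitary k C]
    {I : Involution C} (hI : I.HasAdjunctions) {Q : Set (OneMor C)} (hc : CellCombinatorics I Q)
    (hR : IsRightCell R) (hRQ : R ⊆ Q) {j : C} {F : d.i ⟶ j} (hF : (⟨F⟩ : OneMor C) ∈ R)
    {J : d.i ⟶ d.i} (hJ : Indecomposable J) (h : RightLE ⟨J⟩ ⟨d.G⟩)
    (h' : LeftLE ⟨I.dual F⟩ ⟨J⟩) : Nonempty (J ≅ d.G) := by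
  have hGQ := hRQ (d.G_mem k hI hc hR hRQ)
  have hFQ := hc.dual_mem (hRQ hF)
  have hJQ : (⟨J⟩ : OneMor C) ∈ Q := hc.convex hFQ hGQ hJ h'.twoSidedLE h.twoSidedLE
  exact iso₁_iff.1 (hc.iso hJQ hGQ h
    ((hc.leftLE_symm hFQ hJQ h').trans (d.leftLE_G k hI hF)))

end CellDatum

end Fiat

end

/-! ### Closure properties of the cell categories -/

noncomputable section

namespace Fiat

variable {C : Type u} [Bicategory.{w, v} C] [PreadditiveBicategory C] [AdditiveBicategory C]

/-- The part of a `1`-morphism which acts nontrivially. -/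
theorem TwoRep.exists_addR_retract {k : Type uk} [Field k] [LinearBicategory k C] [IsFinitary k C]
    (M : TwoRep.{w, v, u, u', uk} k C) {R : Set (OneMor C)} (hR : IsRightCell R) {i j : C}
    {H : i ⟶ j} {X : M.obj i} (h : ∀ (J : i ⟶ j) (_ : Retract J H), Indecomposable J →
      ¬ IsZero (M.actObj J X) → (⟨J⟩ : OneMor C) ∈ R) :
    ∃ F : i ⟶ j, AddR R F ∧ Nonempty (Retract (M.actObj H X) (M.actObj F X)) := by
  classical
  obtain ⟨ι, _, F, s, p, hi, h1, -, hs⟩ := decomposition k H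
  let κ := {a : ι // ¬ IsZero (M.actObj (F a) X)}
  let F' : κ → (i ⟶ j) := fun a => F a.1
  refine ⟨⨁ F', addR_of_sum k (biproduct.ι F') (biproduct.π F')
    (fun a => addR_of_mem k hR (h _ ⟨s a.1, p a.1, h1 a.1⟩ (hi a.1) a.2)) biproduct.total,
    ⟨⟨M.eval (biproduct.lift fun a : κ => p a.1) X,
      M.eval (biproduct.desc fun a : κ => s a.1) X, ?_⟩⟩⟩
  rw [← M.eval_comp, biproduct.lift_desc, M.eval_sum, ← M.eval_id, ← hs, M.eval_sum]
  rw [← Finset.sum_subtype (Finset.univ.filter fun a => ¬ IsZero (M.actObj (F a) X)) (by simp)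
    fun a => M.eval (p a ≫ s a) X]
  refine Finset.sum_filter_of_ne fun a _ hne hz => hne ?_
  rw [M.eval_comp, hz.eq_of_tgt (M.eval (p a) X) 0, zero_comp]

/-- Morphisms out of the image of a biproduct. -/
theorem exists_desc_map_biprod {V : Type u'} [Category.{v'} V] [Preadditive V]
    [HasBinaryBiproducts V] {D : Type u} [Category.{w} D] [Preadditive D] (E : V ⥤ D) [E.Additive]
    {F G : V} {Y : D} (t : E.obj F ⟶ Y) (t' : E.obj G ⟶ Y) : ∃ g : E.obj (F ⊞ G) ⟶ Y,
      E.map biprod.inl ≫ g = t ∧ E.map biprod.inr ≫ g = t' ∧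
      ∀ (W : D) (b : Y ⟶ W), g ≫ b = 0 ↔ t ≫ b = 0 ∧ t' ≫ b = 0 := by
  have h1 : E.map biprod.inl ≫ (E.map biprod.fst ≫ t + E.map biprod.snd ≫ t') = t := by
    rw [Preadditive.comp_add, ← Functor.map_comp_assoc, ← Functor.map_comp_assoc]
    simp
  have h2 : E.map biprod.inr ≫ (E.map biprod.fst ≫ t + E.map biprod.snd ≫ t') = t' := by
    rw [Preadditive.comp_add, ← Functor.map_comp_assoc, ← Functor.map_comp_assoc]
    simp
  refine ⟨_, h1, h2, fun W b => ⟨fun h => ⟨?_, ?_⟩, fun ⟨h, h'⟩ => ?_⟩⟩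
  · conv_lhs => rw [← h1]
    rw [Category.assoc, h, comp_zero]
  · conv_lhs => rw [← h2]
    rw [Category.assoc, h, comp_zero]
  · rw [Preadditive.add_comp, Category.assoc, Category.assoc, h, h', comp_zero, comp_zero,
      add_zero]

/-- Evaluation at an object of a principal `2`-representation. -/
def actEv {i j : C} (X : Preadditive.RightFreyd (i ⟶ j)) (l : C) :
    (j ⟶ l) ⥤ Preadditive.RightFreyd (i ⟶ l) where
  obj H := (act i H).obj X
  map a := (actNat i a).app X
  map_id H := congr($((principal i).map₂_id H).toNatTrans.app X)
  map_comp a b := congr($((principal i).map₂_comp a b).toNatTrans.app X)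

instance {i j : C} (X : Preadditive.RightFreyd (i ⟶ j)) (l : C) : (actEv X l).Additive where
  map_add {H H' a b} := cls_congr (X := (act i H).obj X) (Y := (act i H').obj X)
    (PreadditiveBicategory.whiskerLeft_add _ a b) (PreadditiveBicategory.whiskerLeft_add _ a b)

theorem exists_desc_act_biprod {i j l : C} {X : Preadditive.RightFreyd (i ⟶ j)} {F G : j ⟶ l}
    {Y : Preadditive.RightFreyd (i ⟶ l)} (t : (act i F).obj X ⟶ Y) (t' : (act i G).obj X ⟶ Y) :
    ∃ g : (act i (F ⊞ G)).obj X ⟶ Y,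
      ∀ (W : Preadditive.RightFreyd (i ⟶ l)) (b : Y ⟶ W), g ≫ b = 0 ↔ t ≫ b = 0 ∧ t' ≫ b = 0 :=
  (exists_desc_map_biprod (actEv X l) (F := F) (G := G) t t').elim fun g h => ⟨g, h.2.2⟩

namespace CellDatum

variable {R : Set (OneMor C)} (d : CellDatum R)

theorem isAddQ_of_retract (k : Type uk) [Field k] [LinearBicategory k C] [IsFinitary k C]
    {j : C} {F : d.i ⟶ j} (hF : AddR R F) {X : Preadditive.RightFreyd (d.i ⟶ j)}
    (r : Retract X ((Fiat.act d.i F).obj d.L)) : d.IsAddQ X := by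
  obtain ⟨n, F', hF', ⟨s⟩⟩ := hF.exists_biproduct k
  exact ⟨n, F', (actEv d.L j).mapBicone (biproduct.bicone F'), hF',
    ⟨isBilimitOfPreserves _ (biproduct.isBilimit F')⟩,
    ⟨r.trans (s.map (actEv d.L j))⟩⟩

theorem IsAddQ.exists_retract (k : Type uk) [Field k] [LinearBicategory k C] [IsFinitary k C]
    (hR : IsRightCell R) {d : CellDatum R} {j : C} {X : Preadditive.RightFreyd (d.i ⟶ j)}
    (h : d.IsAddQ X) : ∃ F : d.i ⟶ j, AddR R F ∧
      Nonempty (Retract X ((Fiat.act d.i F).obj d.L)) := by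
  obtain ⟨n, F, b, hF, ⟨hb⟩, ⟨r⟩⟩ := h
  let b' := (actEv d.L j).mapBicone (biproduct.bicone F)
  let hb' : b'.IsBilimit := isBilimitOfPreserves _ (biproduct.isBilimit F)
  refine ⟨⨁ F, addR_biproduct k hR hF, ⟨r.trans (retractOfIso ?_)⟩⟩
  exact hb.isLimit.conePointUniqueUpToIso hb'.isLimit

theorem cellObj_iff {j : C} {X : Preadditive.RightFreyd (d.i ⟶ j)} : d.cellObj j X ↔
    ∃ (X₁ X₀ : Preadditive.RightFreyd (d.i ⟶ j)) (f : X₁ ⟶ X₀) (p : X₀ ⟶ X),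
      d.IsAddQ X₁ ∧ d.IsAddQ X₀ ∧ IsCoker f p :=
  ⟨fun ⟨X₁, X₀, f, p, h, h1, h0, hl⟩ => ⟨X₁, X₀, f, p, h1, h0, h, hl⟩,
    fun ⟨X₁, X₀, f, p, h1, h0, h, hl⟩ => ⟨X₁, X₀, f, p, h, h1, h0, hl⟩⟩

theorem IsAddQ.cellObj {d : CellDatum R} {j : C} {X : Preadditive.RightFreyd (d.i ⟶ j)}
    (h : d.IsAddQ X) : d.cellObj j X :=
  d.cellObj_iff.2 ⟨X, X, 0, 𝟙 X, h, h, isCoker_zero X X⟩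

theorem cellObj_act_L (k : Type uk) [Field k] [LinearBicategory k C] [IsFinitary k C]
    {j : C} {F : d.i ⟶ j} (hF : AddR R F) : d.cellObj j ((Fiat.act d.i F).obj d.L) :=
  (d.isAddQ_of_retract k hF (Retract.refl _)).cellObj

variable [HomAbelian C] [HasBiadjoints C]

/-- In `H ∘ F` only the summands `J` with `J L ≠ 0` matter. They satisfy `J ≤_R G` by the support of
`L` and lie right above a summand of `F`, hence belong to `R`. Right exactness passes from `add` to
presented objects. -/
theorem stable (k : Type uk) [Field k] [LinearBicategory k C] [IsFinitary k C]
    {I : Involution C} (hI : I.HasAdjunctions) {Q : Set (OneMor C)} (hc : CellCombinatorics I Q)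
    (hR : IsRightCell R) (hRQ : R ⊆ Q) {j l : C} (H : j ⟶ l)
    (X : Preadditive.RightFreyd (d.i ⟶ j)) (hX : d.cellObj j X) :
    d.cellObj l ((Fiat.act d.i H).obj X) := by
  have key : ∀ Y : Preadditive.RightFreyd (d.i ⟶ j), d.IsAddQ Y →
      d.IsAddQ ((Fiat.act d.i H).obj Y) := by
    intro Y hY
    obtain ⟨F, hF, ⟨r⟩⟩ := hY.exists_retract k hR
    obtain ⟨F', hF', ⟨r'⟩⟩ := (principalRep k d.i).exists_addR_retract hR (H := F ≫ H)
      (X := d.L) (fun J s hJ hne => by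
        have h1 : RightLE ⟨J⟩ ⟨d.G⟩ := d.rightLE_of_act_L k hI hc hR hRQ hne
        have hG := d.G_mem k hI hc hR hRQ
        obtain ⟨ι, _, F₁, s₁, p₁, hi₁, h₁, -, hs₁⟩ := decomposition k F
        obtain ⟨a, ⟨s'⟩⟩ := exists_retract_of_sum (isLocalObj_of_indecomposable k hJ) s
          (fun a => s₁ a ▷ H) (fun a => p₁ a ▷ H) (by
            have := congrArg (postcomp d.i H).map hs₁
            rw [Functor.map_sum, CategoryTheory.Functor.map_id] at this
            simp only [Functor.map_comp] at this
            exact this)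
        have hF₁ := hF (F₁ a) ⟨s₁ a, p₁ a, h₁ a⟩ (hi₁ a)
        exact hR.mem hG hJ ((hR.rightLE hG hF₁).trans (rightLE_of_retract s')) h1)
    refine d.isAddQ_of_retract k hF' ((r.map (Fiat.act d.i H)).trans
      (Retract.trans (retractOfIso ?_) r'))
    exact ((principalRep k d.i).compIso F H d.L).symm
  obtain ⟨X₁, X₀, f, p, h1, h0, hp⟩ := d.cellObj_iff.1 hX
  exact d.cellObj_iff.2 ⟨_, _, _, _, key _ h1, key _ h0, hp.map (Fiat.act d.i H)⟩

/-- A map `P_F → F₀ L` lifts to `P_F → P_{F₀}`, that is, to a 2-morphism `F → F₀`; its evaluation at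
`L` is the required factorization. -/
theorem IsAddQ.exists_factor (k : Type uk) [Field k] [LinearBicategory k C] [IsFinitary k C]
    {I : Involution C} (hI : I.HasAdjunctions) (hR : IsRightCell R) {d : CellDatum R} {j : C}
    {F : d.i ⟶ j} (hF : AddR R F) {X : Preadditive.RightFreyd (d.i ⟶ j)} (hX : d.IsAddQ X)
    (g : proj F ⟶ X) : ∃ g' : (Fiat.act d.i F).obj d.L ⟶ X, d.q F ≫ g' = g := by
  obtain ⟨F₀, hF₀, ⟨r⟩⟩ := hX.exists_retract k hR
  have := d.epi_q k hI hF₀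
  obtain ⟨h, hh⟩ := (pr _).map_surjective (Projective.factorThru (g ≫ r.i) (d.q F₀))
  refine ⟨(actNat d.i h).app d.L ≫ r.r, ?_⟩
  have h1 : (pr _).map h ≫ d.q F₀ = g ≫ r.i := by rw [hh]; exact Projective.factorThru_comp _ _
  rw [← Category.assoc, ← d.pr_map_q k hI h hF hF₀, h1, Category.assoc, r.retract,
    Category.comp_id]

/-- Relative projectivity of `F L`. -/
theorem exists_factor (k : Type uk) [Field k] [LinearBicategory k C] [IsFinitary k C]
    {I : Involution C} (hI : I.HasAdjunctions) (hR : IsRightCell R) {j : C}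
    {F : d.i ⟶ j} (hF : AddR R F) {X : Preadditive.RightFreyd (d.i ⟶ j)} (hX : d.cellObj j X)
    (g : proj F ⟶ X) : ∃ g' : (Fiat.act d.i F).obj d.L ⟶ X, d.q F ≫ g' = g := by
  obtain ⟨X₁, X₀, f, p, h1, h0, hp⟩ := d.cellObj_iff.1 hX
  have := hp.epi
  obtain ⟨g', hg'⟩ := h0.exists_factor k hI hR hF (Projective.factorThru g p)
  exact ⟨g' ≫ p, by rw [← Category.assoc, hg', Projective.factorThru_comp]⟩

/-- The cokernel is presented by the generators `Y₀` of `Y`, with two kinds of relations: those of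
`Y`, and the images of the generators of `X`, lifted to `Y₀` by relative projectivity. -/
theorem cellObj_of_isCoker (k : Type uk) [Field k] [LinearBicategory k C] [IsFinitary k C]
    {I : Involution C} (hI : I.HasAdjunctions) (hR : IsRightCell R) {j : C}
    {X Y Z : Preadditive.RightFreyd (d.i ⟶ j)} (hX : d.cellObj j X) (hY : d.cellObj j Y)
    {f : X ⟶ Y} {c : Y ⟶ Z} (hc : IsCoker f c) : d.cellObj j Z := by
  obtain ⟨X₁, X₀, a, p, -, h0, hp⟩ := d.cellObj_iff.1 hX
  obtain ⟨Y₁, Y₀, y, p', h1', h0', hp'⟩ := d.cellObj_iff.1 hY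
  obtain ⟨F₀, hF₀, ⟨r₀⟩⟩ := h0.exists_retract k hR
  obtain ⟨F₁, hF₁, ⟨r₁⟩⟩ := h1'.exists_retract k hR
  have := hp.epi
  have := hp'.epi
  have := hc.epi
  have := d.epi_q k hI hF₀
  obtain ⟨t, ht⟩ := h0'.exists_factor k hI hR hF₀
    (Projective.factorThru (d.q F₀ ≫ r₀.r ≫ p ≫ f) p')
  have ht' : t ≫ p' = r₀.r ≫ p ≫ f := by
    rw [← cancel_epi (d.q F₀), ← Category.assoc, ht, Projective.factorThru_comp]
  obtain ⟨g, hg⟩ := exists_desc_act_biprod t (r₁.r ≫ y)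
  refine d.cellObj_iff.2 ⟨(Fiat.act d.i (F₀ ⊞ F₁)).obj d.L, Y₀, g, p' ≫ c,
    d.isAddQ_of_retract k (addR_biprod k hF₀ hF₁) (Retract.refl _), h0',
    isCoker_iff.2 ⟨(hg _ _).2 ⟨?_, ?_⟩, inferInstance, fun W b hb => ?_⟩⟩
  · rw [← Category.assoc, ht', Category.assoc, Category.assoc, hc.zero, comp_zero, comp_zero]
  · rw [Category.assoc, ← Category.assoc y, hp'.zero, zero_comp, comp_zero]
  · obtain ⟨htb, hyb⟩ := (hg _ _).1 hb
    have hy : y ≫ b = 0 := by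
      rw [← cancel_epi r₁.r, ← Category.assoc, hyb, comp_zero]
    obtain ⟨l, rfl⟩ := hp'.exists_desc b hy
    obtain ⟨l', rfl⟩ := hc.exists_desc l (by
      rw [← cancel_epi (r₀.r ≫ p), Category.assoc, ← Category.assoc p, ← Category.assoc r₀.r,
        ← ht', Category.assoc, htb, comp_zero])
    exact ⟨l', Category.assoc _ _ _⟩

end CellDatum

end Fiat

end

/-! ### Cell categories as module categories -/

noncomputable section

namespace Fiat

variable {C : Type u} [Bicategory.{w, v} C] [PreadditiveBicategory C] [AdditiveBicategory C]

namespace CellDatum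

variable {R : Set (OneMor C)} (d : CellDatum R) [HomAbelian C]

theorem finite_hom_cell (k : Type uk) [Field k] [LinearBicategory k C] [IsFinitary k C] {j : C}
    (X Y : (d.cellObj j).FullSubcategory) : Module.Finite k (X ⟶ Y) := by
  have := (isFiniteAbelian_principal k d.i j).finite_hom X.obj Y.obj
  let φ : (X ⟶ Y) →ₗ[k] (X.obj ⟶ Y.obj) :=
    { toFun := fun f => f.hom
      map_add' := fun _ _ => rfl
      map_smul' := fun _ _ => rfl }
  exact Module.Finite.of_injective φ fun f g h => ObjectProperty.hom_ext _ h

variable [HasBiadjoints C]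

/-- Lifts are found for `P_F` in the ambient abelian category, where it is projective, and descend
along `P_F → F L` by `exists_factor`. -/
theorem isExactCoker (k : Type uk) [Field k] [LinearBicategory k C] [IsFinitary k C]
    {I : Involution C} (hI : I.HasAdjunctions) (hR : IsRightCell R) {j : C}
    {F : d.i ⟶ j} (hF : AddR R F) {X Y Z : (d.cellObj j).FullSubcategory} (f : X ⟶ Y) (c : Y ⟶ Z)
    (h : IsCoker f.hom c.hom) :
    IsExactCoker (⟨_, d.cellObj_act_L k hF⟩ : (d.cellObj j).FullSubcategory) f c := by
  have := d.epi_q k hI hF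
  have := h.epi
  have h0 : f ≫ c = 0 := ObjectProperty.hom_ext _ h.zero
  refine ⟨h0, ⟨CokernelCofork.IsColimit.ofπ _ _
    (fun g hg => ObjectProperty.homMk (h.exists_desc g.hom (congrArg (·.hom) hg)).choose)
    (fun g hg => ObjectProperty.hom_ext _
      (h.exists_desc g.hom (congrArg (·.hom) hg)).choose_spec)
    (fun g hg m hm => ObjectProperty.hom_ext _ ?_)⟩, fun g => ?_, fun g hg => ?_⟩
  · rw [← cancel_epi c.hom]
    exact (congrArg (·.hom) hm).trans
      (h.exists_desc g.hom (congrArg (·.hom) hg)).choose_spec.symm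
  · obtain ⟨g', hg'⟩ := d.exists_factor k hI hR hF Y.property
      (Projective.factorThru (d.q F ≫ g.hom) c.hom)
    refine ⟨ObjectProperty.homMk g', ObjectProperty.hom_ext _ ?_⟩
    refine (cancel_epi (d.q F)).1 ?_
    change d.q F ≫ g' ≫ c.hom = _
    rw [← Category.assoc, hg', Projective.factorThru_comp]
  · obtain ⟨s, hs⟩ := h.exists_lift (d.q F ≫ g.hom) (by
      have : g.hom ≫ c.hom = 0 := congrArg (·.hom) hg
      rw [Category.assoc, this, comp_zero])
    obtain ⟨g', hg'⟩ := d.exists_factor k hI hR hF X.property s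
    refine ⟨ObjectProperty.homMk g', ObjectProperty.hom_ext _ ?_⟩
    refine (cancel_epi (d.q F)).1 ?_
    change d.q F ≫ g' ≫ f.hom = _
    rw [← Category.assoc, hg', hs]

theorem exists_coker (k : Type uk) [Field k] [LinearBicategory k C] [IsFinitary k C]
    {I : Involution C} (hI : I.HasAdjunctions) (hR : IsRightCell R) {j : C}
    {X Y : (d.cellObj j).FullSubcategory} (f : X ⟶ Y) :
    ∃ (Z : (d.cellObj j).FullSubcategory) (c : Y ⟶ Z), IsCoker f.hom c.hom :=
  ⟨⟨cokernel f.hom, d.cellObj_of_isCoker k hI hR X.property Y.property (isCoker_cokernel f.hom)⟩,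
    ObjectProperty.homMk (cokernel.π f.hom), isCoker_cokernel f.hom⟩

/-- The generator is `E L`, where `E` is the sum of the listed representatives that lie in `R`. -/
theorem isModuleCategory_cell (k : Type uk) [Field k] [LinearBicategory k C] [IsFinitary k C]
    {I : Involution C} (hI : I.HasAdjunctions) (hR : IsRightCell R) (j : C) :
    IsModuleCategory k (d.cellObj j).FullSubcategory := by
  classical
  obtain ⟨n, rep, hrep⟩ := IsFinitary.finite_indecomposables (k := k) d.i j
  let κ := {a : Fin n // (⟨rep a⟩ : OneMor C) ∈ R}
  let rep' : κ → (d.i ⟶ j) := fun a => rep a.1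
  let E : d.i ⟶ j := ⨁ rep'
  have hE : AddR R E := addR_of_sum k (biproduct.ι rep') (biproduct.π rep')
    (fun a => addR_of_mem k hR a.2) biproduct.total
  have hEn : ∀ m : ℕ, AddR R (⨁ fun _ : Fin m => E) := fun m =>
    addR_of_sum k (biproduct.ι _) (biproduct.π _) (fun _ => hE) biproduct.total
  have hret : ∀ F : d.i ⟶ j, AddR R F → ∃ m : ℕ, Nonempty (Retract F (⨁ fun _ : Fin m => E)) := by
    intro F hF
    obtain ⟨ι, _, F', s, p, hi, h1, -, hs⟩ := decomposition k F
    refine retract_of_decomposition s p hs fun a => ?_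
    have h := hrep (F' a) (hi a)
    have hm : (⟨rep h.choose⟩ : OneMor C) ∈ R :=
      hR.mem_of_iso (hF (F' a) ⟨s a, p a, h1 a⟩ (hi a)) (.mk h.choose_spec.some)
    exact (retractOfIso h.choose_spec.some).trans
      (⟨biproduct.ι rep' ⟨h.choose, hm⟩, biproduct.π rep' ⟨h.choose, hm⟩,
        biproduct.ι_π_self rep' ⟨h.choose, hm⟩⟩ :
        Retract (rep h.choose) E)
  let b : ∀ m : ℕ, Bicone fun _ : Fin m =>
      (⟨_, d.cellObj_act_L k hE⟩ : (d.cellObj j).FullSubcategory) := fun m =>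
    { pt := ⟨_, d.cellObj_act_L k (hEn m)⟩
      π := fun a => ObjectProperty.homMk ((actEv d.L j).map (biproduct.π (fun _ : Fin m => E) a))
      ι := fun a => ObjectProperty.homMk ((actEv d.L j).map (biproduct.ι (fun _ : Fin m => E) a))
      ι_π := fun a a' => by
        split_ifs with h
        · subst h
          exact ObjectProperty.hom_ext _ (((actEv d.L j).map_comp _ _).symm.trans
            ((congrArg (actEv d.L j).map (biproduct.ι_π_self (fun _ : Fin m => E) a)).trans
              ((actEv d.L j).map_id _)))
        · exact ObjectProperty.hom_ext _ (((actEv d.L j).map_comp _ _).symm.trans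
            ((congrArg (actEv d.L j).map (biproduct.ι_π_ne (fun _ : Fin m => E) h)).trans
              ((actEv d.L j).map_zero _ _))) }
  have hb : ∀ m, (b m).IsBilimit := fun m => isBilimitOfTotal _ (by
    let P := d.cellObj j
    refine ObjectProperty.hom_ext _ ((P.ι.map_sum _ _).trans ?_)
    change ∑ a, (actEv d.L j).map (biproduct.π (fun _ : Fin m => E) a) ≫
      (actEv d.L j).map (biproduct.ι (fun _ : Fin m => E) a) =
      𝟙 ((actEv d.L j).obj _)
    simp only [← Functor.map_comp]
    rw [← Functor.map_sum, biproduct.total]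
    exact (actEv d.L j).map_id _)
  refine isModuleCategory_of_generator k (d.finite_hom_cell k)
    (⟨_, d.cellObj_act_L k hE⟩ : (d.cellObj j).FullSubcategory) b hb ?_ ?_
  · intro m m' f
    obtain ⟨Z, c, hc⟩ := d.exists_coker k hI hR f
    exact ⟨Z, c, d.isExactCoker k hI hR hE f c hc⟩
  · intro X
    obtain ⟨X₁, X₀, f, p, h1, h0, hp⟩ := d.cellObj_iff.1 X.property
    obtain ⟨F₀, hF₀, ⟨r₀⟩⟩ := h0.exists_retract k hR
    obtain ⟨m, ⟨r⟩⟩ := hret F₀ hF₀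
    refine ⟨⟨X₁, h1.cellObj⟩, ⟨X₀, h0.cellObj⟩, ObjectProperty.homMk f, ObjectProperty.homMk p, m,
      d.isExactCoker k hI hR hE _ _ hp, ⟨?_⟩⟩
    let r' := r₀.trans (r.map (actEv d.L j))
    exact ⟨ObjectProperty.homMk r'.i, ObjectProperty.homMk r'.r,
      ObjectProperty.hom_ext _ r'.retract⟩

theorem isTwoRep (k : Type uk) [Field k] [LinearBicategory k C] [IsFinitary k C]
    {I : Involution C} (hI : I.HasAdjunctions) {Q : Set (OneMor C)} (hc : CellCombinatorics I Q)
    (hR : IsRightCell R) (hRQ : R ⊆ Q) : d.IsTwoRep k where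
  stable H X hX := d.stable k hI hc hR hRQ H X hX
  isModuleCategory j := d.isModuleCategory_cell k hI hR j

end CellDatum

end Fiat

end

/-! ### Cell generators -/

noncomputable section

namespace Fiat

variable {C : Type u} [Bicategory.{w, v} C] [PreadditiveBicategory C] [AdditiveBicategory C]

/-- The properties of the pair `(G, T)`, where `G` is the Duflo involution of the right cell `R`
and `T` is the simple top of `G T`, from which strong simplicity is deduced. -/
structure TwoRep.IsCellGenerator {k : Type uk} [Field k] [LinearBicategory k C]
    (M : TwoRep.{w, v, u, u', uk} k C) (R : Set (OneMor C)) {i : C} (G : i ⟶ i) (T : M.obj i) :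
    Prop where
  exists_mor {A : OneMor C} : A ∈ R → ∃ (j : C) (F : i ⟶ j), A = ⟨F⟩
  simple : Simple T
  projective {j : C} {F : i ⟶ j} : (⟨F⟩ : OneMor C) ∈ R → Projective (M.actObj F T)
  isLocalObj {j : C} {F : i ⟶ j} : (⟨F⟩ : OneMor C) ∈ R → IsLocalObj (M.actObj F T)
  exists_ne_zero {j : C} {X : M.obj j} : ¬ IsZero X →
    ∃ (F : i ⟶ j) (f : M.actObj F T ⟶ X), (⟨F⟩ : OneMor C) ∈ R ∧ f ≠ 0
  mem_of_retract {j l : C} {F : i ⟶ j} {H : j ⟶ l} {J : i ⟶ l} : (⟨F⟩ : OneMor C) ∈ R →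
    Retract J (F ≫ H) → Indecomposable J → ¬ IsZero (M.actObj J T) → (⟨J⟩ : OneMor C) ∈ R
  isZero_act {j : C} {F : i ⟶ j} {X : M.obj i} : (⟨F⟩ : OneMor C) ∈ R →
    (∀ f : M.actObj G T ⟶ X, f = 0) → IsZero (M.actObj F X)

namespace CellDatum

variable {R : Set (OneMor C)} (d : CellDatum R) [HomAbelian C] [HasBiadjoints C]

section Objects

theorem isZero_cell_iff {j : C} {X : (d.cellObj j).FullSubcategory} :
    IsZero X ↔ IsZero X.obj := by
  rw [IsZero.iff_id_eq_zero, IsZero.iff_id_eq_zero]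
  exact ⟨fun h => congrArg (·.hom) h, fun h => ObjectProperty.hom_ext _ h⟩

/-- Cell categories are closed under ambient cokernels, so an epimorphism has zero cokernel in both
senses. -/
theorem epi_hom_of_epi (k : Type uk) [Field k] [LinearBicategory k C] [IsFinitary k C]
    {I : Involution C} (hI : I.HasAdjunctions) (hR : IsRightCell R) {j : C}
    {X Y : (d.cellObj j).FullSubcategory} (f : X ⟶ Y) [Epi f] : Epi f.hom := by
  obtain ⟨Z, c, hc⟩ := d.exists_coker k hI hR f
  have h0 : f ≫ c = 0 := ObjectProperty.hom_ext _ hc.zero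
  have h1 : c = 0 := (cancel_epi f).1 (h0.trans comp_zero.symm)
  refine Preadditive.epi_of_cancel_zero _ fun {W} g hg => ?_
  obtain ⟨l, rfl⟩ := hc.exists_desc g hg
  have h2 : c.hom = 0 := congrArg (·.hom) h1
  rw [h2, zero_comp]

/-- The object `F L` of the cell `2`-representation. -/
abbrev cellQ (k : Type uk) [Field k] [LinearBicategory k C] [IsFinitary k C] {j : C}
    {F : d.i ⟶ j} (hF : AddR R F) : (d.cellObj j).FullSubcategory :=
  ⟨(Fiat.act d.i F).obj d.L, d.cellObj_act_L k hF⟩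

theorem projective_cellQ (k : Type uk) [Field k] [LinearBicategory k C] [IsFinitary k C]
    {I : Involution C} (hI : I.HasAdjunctions) (hR : IsRightCell R) {j : C} {F : d.i ⟶ j}
    (hF : AddR R F) : Projective (d.cellQ k hF) where
  factors {Y X} g e he := by
    have := d.epi_hom_of_epi k hI hR e
    have := d.epi_q k hI hF
    obtain ⟨g', hg'⟩ := d.exists_factor k hI hR hF Y.property
      (Projective.factorThru (d.q F ≫ g.hom) e.hom)
    refine ⟨ObjectProperty.homMk g', ObjectProperty.hom_ext _ ((cancel_epi (d.q F)).1 ?_)⟩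
    change d.q F ≫ g' ≫ e.hom = _
    rw [← Category.assoc, hg', Projective.factorThru_comp]

/-- Morphisms between the objects `F L` are given by `2`-morphisms. -/
theorem exists_eval_L (k : Type uk) [Field k] [LinearBicategory k C] [IsFinitary k C]
    {I : Involution C} (hI : I.HasAdjunctions) {j : C} {F F' : d.i ⟶ j}
    (hF : AddR R F) (hF' : AddR R F') (f : (Fiat.act d.i F).obj d.L ⟶ (Fiat.act d.i F').obj d.L) :
    ∃ h : F ⟶ F', (actEv d.L j).map h = f := by
  have := d.epi_q k hI hF
  have := d.epi_q k hI hF'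
  obtain ⟨h, hh⟩ := (pr _).map_surjective (Projective.factorThru (d.q F ≫ f) (d.q F'))
  refine ⟨h, (cancel_epi (d.q F)).1 ((d.pr_map_q k hI h hF hF').symm.trans ?_)⟩
  rw [hh]
  exact Projective.factorThru_comp _ _

/-- Every endomorphism of `F L` is an evaluation, so its endomorphism ring is a nonzero quotient of
the local ring `End(F)`. -/
theorem isLocalObj_cellQ (k : Type uk) [Field k] [LinearBicategory k C] [IsFinitary k C]
    {I : Involution C} (hI : I.HasAdjunctions) (hR : IsRightCell R) {j : C} {F : d.i ⟶ j}
    (hF : (⟨F⟩ : OneMor C) ∈ R) : IsLocalObj (d.cellQ k (addR_of_mem k hR hF)) := by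
  refine ⟨fun hz => d.not_annihilates F hF (d.isZero_cell_iff.1 hz), fun f => ?_⟩
  obtain ⟨h, hh⟩ := d.exists_eval_L k hI (addR_of_mem k hR hF) (addR_of_mem k hR hF) f.hom
  have hff : (d.cellObj j).ι.FullyFaithful := ObjectProperty.fullyFaithfulι _
  rcases (isLocalObj_of_indecomposable k (hR.indecomposable hF)).2 h with h1 | h1
  · left
    have : IsIso ((d.cellObj j).ι.map f) := by
      change IsIso f.hom
      exact hh ▸ inferInstanceAs (IsIso ((actEv d.L j).map h))
    exact isIso_of_reflects_iso f (d.cellObj j).ι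
  · right
    have : IsIso ((d.cellObj j).ι.map (𝟙 _ - f)) := by
      have : (actEv d.L j).map (𝟙 F - h) = (𝟙 _ - f.hom) := by
        rw [Functor.map_sub, hh, CategoryTheory.Functor.map_id]; rfl
      change IsIso (𝟙 _ - f.hom)
      exact this ▸ inferInstanceAs (IsIso ((actEv d.L j).map (𝟙 F - h)))
    exact isIso_of_reflects_iso _ (d.cellObj j).ι

theorem exists_ne_zero_cell (k : Type uk) [Field k] [LinearBicategory k C] [IsFinitary k C]
    (hR : IsRightCell R) {j : C}
    {X : Preadditive.RightFreyd (d.i ⟶ j)} (hX : d.cellObj j X) (h0 : ¬ IsZero X) :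
    ∃ (F : d.i ⟶ j) (f : (Fiat.act d.i F).obj d.L ⟶ X), (⟨F⟩ : OneMor C) ∈ R ∧ f ≠ 0 := by
  obtain ⟨X₁, X₀, f, p, h1, h0', hp⟩ := d.cellObj_iff.1 hX
  obtain ⟨F₀, hF₀, ⟨r₀⟩⟩ := h0'.exists_retract k hR
  have := hp.epi
  have hne : r₀.r ≫ p ≠ 0 := fun h => h0 (IsZero.of_epi_eq_zero _ h)
  obtain ⟨J, r, hJ, hJ0⟩ := (principalRep k d.i).exists_summand_ne_zero (H := F₀) (X := d.L) hne
  exact ⟨J, _, hF₀ J r hJ, hJ0⟩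

/-- The support of an object of the cell `2`-representation. -/
theorem rightLE_of_proj (k : Type uk) [Field k] [LinearBicategory k C] [IsFinitary k C]
    {I : Involution C} (hI : I.HasAdjunctions) (hR : IsRightCell R) {j : C}
    {X : Preadditive.RightFreyd (d.i ⟶ j)} (hX : d.cellObj j X) {J : d.i ⟶ j}
    {f : proj J ⟶ X} (hf : f ≠ 0) : RightLE ⟨J⟩ ⟨d.G⟩ := by
  obtain ⟨X₁, X₀, a, p, h1, h0', hp⟩ := d.cellObj_iff.1 hX
  obtain ⟨F₀, hF₀, ⟨r₀⟩⟩ := h0'.exists_retract k hR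
  have := hp.epi
  have hne : Projective.factorThru f (r₀.r ≫ p) ≠ 0 := fun h => hf (by
    rw [← Projective.factorThru_comp f (r₀.r ≫ p), h, zero_comp])
  obtain ⟨g, hg⟩ := (exists_ne_zero_act_iff hI F₀ J d.L).1 ⟨_, hne⟩
  obtain ⟨J', r, hJ', hne'⟩ := exists_summand_proj k hg
  obtain ⟨e⟩ := iso_of_top k hJ' d.indecomposable_G hne' d.p_ne_zero
  exact (rightLE_of_retract r).trans (Iso₁.rightLE (.mk e))

/-- `F` only detects indecomposables `J` with `F* ≤_L J`. If all those occurring in `X` also satisfy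
`J ≤_R G`, strong regularity leaves `J ≅ G` alone. -/
theorem isZero_act_of_G (k : Type uk) [Field k] [LinearBicategory k C] [IsFinitary k C]
    {I : Involution C} (hI : I.HasAdjunctions) {Q : Set (OneMor C)} (hc : CellCombinatorics I Q)
    (hR : IsRightCell R) (hRQ : R ⊆ Q) {j : C} {F : d.i ⟶ j} (hF : (⟨F⟩ : OneMor C) ∈ R)
    {X : Preadditive.RightFreyd (d.i ⟶ d.i)}
    (hX : ∀ (J : d.i ⟶ d.i) (f : proj J ⟶ X), f ≠ 0 → RightLE ⟨J⟩ ⟨d.G⟩)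
    (h : ∀ f : proj d.G ⟶ X, f = 0) : IsZero ((Fiat.act d.i F).obj X) := by
  by_contra hne
  obtain ⟨J, f, hJ, hle, hf⟩ := (not_isZero_act_iff k hI F X).1 hne
  obtain ⟨e⟩ := d.iso_G k hI hc hR hRQ hF hJ (hX J f hf) hle
  refine hf ?_
  have := h ((pr _).map e.inv ≫ f)
  exact (Preadditive.IsIso.comp_left_eq_zero _ _).1 this

/-- The simple object of the cell `2`-representation which lies above `L`. -/
theorem exists_isIso_act (k : Type uk) [Field k] [LinearBicategory k C] [IsFinitary k C]
    {I : Involution C} (hI : I.HasAdjunctions) {Q : Set (OneMor C)} (hc : CellCombinatorics I Q)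
    (hR : IsRightCell R) (hRQ : R ⊆ Q) {T : Preadditive.RightFreyd (d.i ⟶ d.i)}
    (hT : d.cellObj d.i T) (hT0 : ¬ IsZero T)
    (hepi : ∀ f : (Fiat.act d.i d.G).obj d.L ⟶ T, f ≠ 0 → Epi f)
    {t : (Fiat.act d.i d.G).obj d.L ⟶ T} (ht : t ≠ 0) :
    ∃ τ : T ⟶ d.L, ∀ {j : C} (F : d.i ⟶ j), (⟨F⟩ : OneMor C) ∈ R →
      IsIso ((Fiat.act d.i F).map τ) := by
  have hG := addR_of_mem k hR (d.G_mem k hI hc hR hRQ)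
  have := d.epi_q k hI hG
  have := hepi t ht
  obtain ⟨S, b, hS, hb⟩ := (isFiniteAbelian_principal k d.i d.i).exists_simple_quotient hT0
  have h0 : (d.q d.G ≫ t) ≫ b ≠ 0 := fun h =>
    Simple.not_isZero S (IsZero.of_epi_eq_zero ((d.q d.G ≫ t) ≫ b) h)
  obtain ⟨φ, -⟩ := exists_iso_of_top (isLocalObj_proj k d.indecomposable_G) h0 d.p_ne_zero
  have hτ : b ≫ φ.hom ≠ 0 := fun h =>
    Simple.not_isZero d.L (IsZero.of_epi_eq_zero (b ≫ φ.hom) h)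
  refine ⟨b ≫ φ.hom, fun {j} F hF => ?_⟩
  -- It suffices that `P_G` has no nonzero map to the kernel of `T → L`. Such a map factors over `G
  -- L`, whose nonzero maps to `T` are epimorphisms, so the kernel would be all of `T`.
  have : Mono ((Fiat.act d.i F).map (b ≫ φ.hom)) := by
    refine mono_map_of_isZero_kernel _ (d.isZero_act_of_G k hI hc hR hRQ hF ?_ ?_)
    · intro J f hf
      refine d.rightLE_of_proj k hI hR hT (f := f ≫ kernel.ι _) fun h => hf ?_
      exact (cancel_mono (kernel.ι (b ≫ φ.hom))).1 (h.trans zero_comp.symm)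
    · intro g
      obtain ⟨g', hg'⟩ := d.exists_factor k hI hR hG hT (g ≫ kernel.ι (b ≫ φ.hom))
      by_contra hg
      have hg0 : g' ≠ 0 := fun h => hg (by
        rw [h, comp_zero] at hg'
        exact (cancel_mono (kernel.ι (b ≫ φ.hom))).1 (hg'.symm.trans zero_comp.symm))
      have := hepi g' hg0
      have : Epi (kernel.ι (b ≫ φ.hom)) := epi_of_epi_fac hg'.symm
      exact hτ ((cancel_epi (kernel.ι (b ≫ φ.hom))).1 (by rw [kernel.condition, comp_zero]))
  exact isIso_of_mono_of_epi _

/-- The cell `2`-representation has a simple object above `L`, from which it is generated. -/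
theorem exists_isCellGenerator {k : Type uk} [Field k] [LinearBicategory k C] [IsFinitary k C]
    {I : Involution C} (hI : I.HasAdjunctions) {Q : Set (OneMor C)} (hc : CellCombinatorics I Q)
    (hR : IsRightCell R) (hRQ : R ⊆ Q) (h : d.IsTwoRep k) :
    ∃ T : (d.cellRep h).obj d.i, (d.cellRep h).IsCellGenerator R d.G T := by
  have hGR := d.G_mem k hI hc hR hRQ
  have hG := addR_of_mem k hR hGR
  have hGL : ¬ IsZero (C := (d.cellRep h).obj d.i) (d.cellQ k hG) := fun hz =>
    d.not_annihilates d.G hGR (d.isZero_cell_iff.1 hz)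
  obtain ⟨T, t, hT, ht⟩ : ∃ (T : (d.cellObj d.i).FullSubcategory) (t : d.cellQ k hG ⟶ T),
      Simple (C := (d.cellRep h).obj d.i) T ∧ Epi t :=
    ((d.cellRep h).isFiniteAbelian d.i).exists_simple_quotient hGL
  have hTobj : d.cellObj d.i T.obj := T.property
  have hT0 : ¬ IsZero T.obj := fun hz =>
    Simple.not_isZero (C := (d.cellRep h).obj d.i) T (d.isZero_cell_iff.2 hz)
  have htepi : Epi t.hom := d.epi_hom_of_epi k hI hR t
  obtain ⟨τ, hτ⟩ := d.exists_isIso_act k hI hc hR hRQ hTobj hT0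
    (fun f hf => by
      let f' : d.cellQ k hG ⟶ T := ObjectProperty.homMk f
      have : Epi f' := epi_of_ne_zero (D := (d.cellRep h).obj d.i) (X := d.cellQ k hG)
        (fun h0 => hf (congrArg (·.hom) h0))
      exact d.epi_hom_of_epi k hI hR f') (t := t.hom)
    (fun h0 => hT0 (IsZero.of_epi_eq_zero t.hom h0))
  -- `T` is simple in the cell category but need not be so in the ambient one. Still `F T ≅ F L`
  -- through `τ`, so the properties of `F L` carry over.
  have e {j : C} {F : d.i ⟶ j} (hF : (⟨F⟩ : OneMor C) ∈ R) :
      Nonempty ((d.cellRep h).actObj F T ≅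
        (show (d.cellRep h).obj j from d.cellQ k (addR_of_mem k hR hF))) := by
    have := hτ F hF
    let e₀ : (Fiat.act d.i F).obj T.obj ≅ (Fiat.act d.i F).obj d.L :=
      asIso ((Fiat.act d.i F).map τ)
    exact ⟨ObjectProperty.isoMk _ e₀⟩
  refine ⟨T, ⟨d.exists_mor, hT, fun {j F} hF => ?_, fun {j F} hF => ?_,
    fun {j} (X : (d.cellObj j).FullSubcategory) hX => ?_,
    fun {j l F H J} hF r hJ hJT => ?_, fun {j F} (X : (d.cellObj d.i).FullSubcategory) hF hX => ?_⟩⟩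
  · exact Projective.of_iso (e hF).some.symm (d.projective_cellQ k hI hR (addR_of_mem k hR hF))
  · exact IsLocalObj.of_iso (d.isLocalObj_cellQ k hI hR hF) (e hF).some.symm
  · obtain ⟨F, f, hF, hf⟩ := d.exists_ne_zero_cell k hR X.property
      (fun hz => hX (d.isZero_cell_iff.2 hz))
    have := hτ F hF
    refine ⟨F, ObjectProperty.homMk ((Fiat.act d.i F).map τ ≫ f), hF, fun h0 => hf ?_⟩
    have h1 : (Fiat.act d.i F).map τ ≫ f = 0 := congrArg (·.hom) h0
    exact (Preadditive.IsIso.comp_left_eq_zero _ _).1 h1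
  -- As `T` is a quotient of `G L`, some summand `J'` of `J ∘ G` acts nontrivially on `L` and so
  -- lies in `R`. Then `J` lies between `F` and `J'` for `≤_LR`, hence in `Q`, and right above `F`.
  · have h1 : ¬ IsZero ((Fiat.act d.i J).obj ((Fiat.act d.i d.G).obj d.L)) := fun hz => by
      have hz' : IsZero ((Fiat.act d.i J).obj T.obj) :=
        IsZero.of_epi ((Fiat.act d.i J).map t.hom) hz
      exact hJT (d.isZero_cell_iff.2 hz')
    have h2 : ¬ IsZero ((principalRep k d.i).actObj (d.G ≫ J) d.L) := fun hz =>
      h1 (hz.of_iso ((principalRep k d.i).compIso d.G J d.L).symm)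
    obtain ⟨J', r', hJ', hne⟩ := (principalRep k d.i).exists_summand_not_isZero h2
    have h3 := hR.mem hGR hJ' (rightLE_of_retract r') (d.rightLE_of_act_L k hI hc hR hRQ hne)
    exact hc.mem hR hRQ hF (hc.convex (hRQ hF) (hRQ h3) hJ (rightLE_of_retract r).twoSidedLE
      (leftLE_of_retract r').twoSidedLE) (rightLE_of_retract r)
  · refine d.isZero_cell_iff.2 (d.isZero_act_of_G k hI hc hR hRQ hF
      (fun J f hf => d.rightLE_of_proj k hI hR X.property hf) fun f => ?_)
    obtain ⟨g, rfl⟩ := d.exists_factor k hI hR hG X.property f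
    have := hτ d.G hGR
    have h0 : (Fiat.act d.i d.G).map τ ≫ g = 0 := congrArg (·.hom)
      (hX (ObjectProperty.homMk ((Fiat.act d.i d.G).map τ ≫ g)))
    have h1 : g = 0 := (Preadditive.IsIso.comp_left_eq_zero ((Fiat.act d.i d.G).map τ) _).1 h0
    rw [h1, comp_zero]

end Objects

end CellDatum

end Fiat

end

/-! ### Projective covers and Duflo involutions -/

noncomputable section

namespace Fiat

section Top

variable {k : Type uk} [Field k] {D : Type u} [Category.{w} D] [Abelian D] [Linear k D]

/-- A recognition criterion for the projective cover of a simple object. -/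
theorem IsFiniteAbelian.nonempty_iso_of_top (hD : IsFiniteAbelian k D) {P E T U : D} [Projective P]
    [Projective E] [Simple T] (hE : IsLocalObj E) {t : E ⟶ T} (ht : t ≠ 0)
    (hP : ∀ (X : D) (p : P ⟶ X), Simple X → Epi p → Nonempty (X ≅ T))
    (h1 : Module.finrank k (U ⟶ P) = 1) {f : U ⟶ E} (hf : f ≠ 0) : Nonempty (P ≅ E) := by
  have hP0 : ¬ IsZero P := fun hz => by
    have : Subsingleton (U ⟶ P) := ⟨fun a b => hz.eq_of_tgt a b⟩
    rw [Module.finrank_zero_of_subsingleton] at h1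
    exact zero_ne_one h1
  have key {K : D} (hK : ¬ IsZero K) [Projective K] (r : P ⟶ K) [Epi r] :
      ∃ b : K ⟶ E, Epi b := by
    obtain ⟨X, p, hX, hp⟩ := hD.exists_simple_quotient hK
    obtain ⟨e⟩ := hP X (r ≫ p) hX (epi_comp r p)
    have := epi_of_ne_zero ht
    refine ⟨Projective.factorThru (p ≫ e.hom) t, hD.epi_of_comp_top hE ht _ fun h0 => ?_⟩
    rw [Projective.factorThru_comp] at h0
    exact Simple.not_isZero T (IsZero.of_epi_eq_zero (p ≫ e.hom) h0)
  obtain ⟨b, hb⟩ := key hP0 (𝟙 P)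
  let s := Projective.factorThru (𝟙 E) b
  have hs : s ≫ b = 𝟙 E := Projective.factorThru_comp _ _
  let r : P ⟶ kernel b := kernel.lift b (𝟙 P - b ≫ s) (by
    rw [Preadditive.sub_comp, Category.assoc, hs, Category.comp_id, Category.id_comp, sub_self])
  have hr : kernel.ι b ≫ r = 𝟙 _ := by
    rw [← cancel_mono (kernel.ι b), Category.assoc, kernel.lift_ι, Preadditive.comp_sub,
      kernel.condition_assoc, zero_comp, sub_zero, Category.comp_id, Category.id_comp]
  suffices hz : IsZero (kernel b) by
    have : Mono b := Preadditive.mono_of_isZero_kernel _ hz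
    have := isIso_of_mono_of_epi b
    exact ⟨asIso b⟩
  by_contra hz
  have : Projective (kernel b) := Retract.projective ⟨kernel.ι b, r, hr⟩
  have : IsSplitEpi r := ⟨⟨kernel.ι b, hr⟩⟩
  obtain ⟨a, ha⟩ := key hz r
  let s' := Projective.factorThru (𝟙 E) a
  have hs' : s' ≫ a = 𝟙 E := Projective.factorThru_comp _ _
  have hne : f ≫ s' ≫ kernel.ι b ≠ 0 := fun h0 => hf (by
    rw [← Category.assoc] at h0
    have h2 : f ≫ s' = 0 := (cancel_mono (kernel.ι b)).1 (h0.trans zero_comp.symm)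
    rw [← Category.comp_id f, ← hs', ← Category.assoc, h2, zero_comp])
  -- A second copy of `E` inside `kernel b` gives two maps in the line `Hom(U, P)`, which are
  -- proportional. Composition with `b` kills one and returns `f` from the other.
  obtain ⟨c, hc⟩ := (finrank_eq_one_iff_of_nonzero' _ hne).1 h1 (f ≫ s)
  apply hf
  have := congrArg (· ≫ b) hc
  simp only [Linear.smul_comp, Category.assoc, kernel.condition, comp_zero, smul_zero, hs,
    Category.comp_id] at this
  exact this.symm

end Top

variable {C : Type u} [Bicategory.{w, v} C] [PreadditiveBicategory C]

/-- `c : G ⟶ 𝟙 i` exhibits `G` as the Duflo involution of the right cell `R`. -/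
structure IsDuflo (I : Involution C) (R : Set (OneMor C)) {i : C} {G : i ⟶ i} (c : G ⟶ 𝟙 i) :
    Prop where
  mem : (⟨G⟩ : OneMor C) ∈ R
  iso_dual : Iso₁ ⟨I.dual G⟩ ⟨G⟩
  exists_section {j : C} {F : i ⟶ j} : (⟨F⟩ : OneMor C) ∈ R →
    ∃ s : F ⟶ G ≫ F, s ≫ c ▷ F ≫ (λ_ F).hom = 𝟙 F

section Duflo

variable [AdditiveBicategory C] {R : Set (OneMor C)} {Q : Set (OneMor C)} {I : Involution C}

theorem CellDatum.isDuflo [HomAbelian C] [HasBiadjoints C] (k : Type uk) [Field k]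
    [LinearBicategory k C] [IsFinitary k C] (d : CellDatum R) (hI : I.HasAdjunctions)
    (hc : CellCombinatorics I Q) (hR : IsRightCell R) (hRQ : R ⊆ Q) : IsDuflo I R d.counit :=
  ⟨d.G_mem k hI hc hR hRQ, d.dual_G_iso k hI hc hR hRQ,
    fun hF => d.exists_section k hI (addR_of_mem k hR hF)⟩

theorem exists_isDuflo [HomAbelian C] [HasBiadjoints C] (k : Type uk) [Field k]
    [LinearBicategory k C] [IsFinitary k C] (hI : I.HasAdjunctions)
    (hc : CellCombinatorics I Q) (hR : IsRightCell R) (hRQ : R ⊆ Q) {i j : C} {F : i ⟶ j}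
    (hF : (⟨F⟩ : OneMor C) ∈ R) : ∃ (G : i ⟶ i) (c : G ⟶ 𝟙 i), IsDuflo I R c := by
  obtain ⟨d⟩ := exists_cellDatum k hI hR
  have h : ∃ (G : d.i ⟶ d.i) (c : G ⟶ 𝟙 d.i), IsDuflo I R c :=
    ⟨_, _, d.isDuflo k hI hc hR hRQ⟩
  have hi : i = d.i := d.src_eq _ hF
  rw [← hi] at h
  exact h

variable {i : C} {G : i ⟶ i} {c : G ⟶ 𝟙 i}

theorem IsDuflo.leftLE (h : IsDuflo I R c) (hR : IsRightCell R) {j : C} {F : i ⟶ j}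
    (hF : (⟨F⟩ : OneMor C) ∈ R) : LeftLE ⟨I.dual F⟩ ⟨G⟩ :=
  ((hR.rightLE hF h.mem).dual (I := I)).trans h.iso_dual.leftLE

theorem IsDuflo.leftLE' (h : IsDuflo I R c) (hR : IsRightCell R) {j : C} {F : i ⟶ j}
    (hF : (⟨F⟩ : OneMor C) ∈ R) : LeftLE ⟨G⟩ ⟨I.dual F⟩ :=
  h.iso_dual.symm.leftLE.trans ((hR.rightLE h.mem hF).dual (I := I))

/-- The Duflo involution is the only element of its `H`-cell. -/
theorem IsDuflo.iso (h : IsDuflo I R c) (hc : CellCombinatorics I Q) (hR : IsRightCell R)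
    (hRQ : R ⊆ Q) {j : C} {F : i ⟶ j} (hF : (⟨F⟩ : OneMor C) ∈ R) {J : i ⟶ i}
    (hJ : (⟨J⟩ : OneMor C) ∈ R) (hle : LeftLE ⟨I.dual F⟩ ⟨J⟩) : Nonempty (J ≅ G) :=
  iso₁_iff.1 (hc.iso (hRQ hJ) (hRQ h.mem) (hR.rightLE hJ h.mem)
    (hc.leftLE_symm (hRQ h.mem) (hRQ hJ) ((h.leftLE' hR hF).trans hle)))

end Duflo

namespace TwoRep

variable {k : Type uk} [Field k] [LinearBicategory k C] (M : TwoRep.{w, v, u, u', uk} k C)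

/-- The value at an object of the counit `c : G ⟶ 𝟙 i`. -/
theorem eval_ne_zero_of_section {i j : C} {G : i ⟶ i} {c : G ⟶ 𝟙 i} {F : i ⟶ j}
    {s : F ⟶ G ≫ F} (hs : s ≫ c ▷ F ≫ (λ_ F).hom = 𝟙 F) {X : M.obj i}
    (hX : ¬ IsZero (M.actObj F X)) : M.eval c X ≠ 0 := fun h0 => hX <| by
  have := congrArg (fun a => M.eval a X) hs
  rw [eval_comp, eval_comp, eval_whiskerRight, h0, Functor.map_zero, zero_comp, comp_zero,
    zero_comp, comp_zero, eval_id] at this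
  exact (IsZero.iff_id_eq_zero _).2 this.symm

/-- If `J X` is only nonzero for copies `J` of `G` and if `Hom(G X, X)` is one dimensional and
spanned by the evaluation of a `2`-morphism, then all morphisms `H X → H' X` are evaluations. -/
theorem exists_eval_of_duflo [AdditiveBicategory C] [IsFinitary k C] {I : Involution C}
    (hI : I.HasAdjunctions) {i j : C} {H H' : i ⟶ j} {X : M.obj i} {G : i ⟶ i} {c : G ⟶ 𝟙 i}
    (h1 : Module.finrank k (M.actObj G X ⟶ X) = 1) (hcX : M.eval c X ≠ 0)
    (hJ : ∀ (J : i ⟶ i) (_ : Retract J (H ≫ I.dual H')), Indecomposable J →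
      ¬ IsZero (M.actObj J X) → Nonempty (J ≅ G)) (φ : M.actObj H X ⟶ M.actObj H' X) :
    ∃ β : H ⟶ H', M.eval β X = φ := by
  obtain ⟨a⟩ := hI.dual_adj H'
  -- Transposing moves `H'` to the source as `H'* ∘ H`; only its summands isomorphic to `G`
  -- contribute, and on these the map is a multiple of `c`.
  refine M.exists_eval_of_transpose a (fun ψ => M.exists_eval_of_summands ψ fun J r hJi => ?_) φ
  by_cases hz : IsZero (M.actObj J X)
  · exact ⟨0, hz.eq_of_src _ _⟩
  obtain ⟨e⟩ := hJ J r hJi hz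
  have hne : M.eval c X ≫ (M.idIso X).hom ≠ 0 := fun h0 =>
    hcX ((Preadditive.IsIso.comp_right_eq_zero _ _).1 h0)
  obtain ⟨a, ha⟩ := (finrank_eq_one_iff_of_nonzero' _ hne).1 h1
    (M.eval e.inv X ≫ (M.eval r.i X ≫ ψ) ≫ (M.idIso X).hom)
  refine ⟨a • (e.hom ≫ c), ?_⟩
  have h2 : M.eval (a • (e.hom ≫ c)) X = a • M.eval (e.hom ≫ c) X := M.map₂_smul _ _ _
  rw [h2, eval_comp, ← cancel_mono (M.idIso X).hom, Linear.smul_comp, Category.assoc,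
    ← Linear.comp_smul, ha, ← Category.assoc, ← eval_comp, Iso.hom_inv_id, eval_id,
    Category.id_comp]

end TwoRep

end Fiat

end

/-! ### Projectivity and adjoints on simple tops -/

noncomputable section

namespace Fiat

variable {C : Type u} [Bicategory.{w, v} C] [PreadditiveBicategory C] [AdditiveBicategory C]

namespace TwoRep.IsCellGenerator

variable {k : Type uk} [Field k] [LinearBicategory k C]
  {M : TwoRep.{w, v, u, u', uk} k C} {R : Set (OneMor C)} {i : C} {G : i ⟶ i} {T : M.obj i}

theorem not_isZero (g : M.IsCellGenerator R G T) {j : C} {F : i ⟶ j}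
    (hF : (⟨F⟩ : OneMor C) ∈ R) : ¬ IsZero (M.actObj F T) :=
  (g.isLocalObj hF).1

theorem exists_top (g : M.IsCellGenerator R G T) (hG : (⟨G⟩ : OneMor C) ∈ R) :
    ∃ t : M.actObj G T ⟶ T, t ≠ 0 := by
  by_contra! h
  exact g.not_isZero hG (g.isZero_act hG h)

theorem finrank_top [IsAlgClosed k] (g : M.IsCellGenerator R G T) (hG : (⟨G⟩ : OneMor C) ∈ R) :
    Module.finrank k (M.actObj G T ⟶ T) = 1 := by
  obtain ⟨t, ht⟩ := g.exists_top hG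
  have := g.simple
  have := g.projective hG
  exact (M.isFiniteAbelian i).finrank_top (g.isLocalObj hG) ht

/-- The `1`-morphisms of `R` annihilate all simple objects but `T`. -/
theorem isZero_or_iso (g : M.IsCellGenerator R G T) (hG : (⟨G⟩ : OneMor C) ∈ R) {j : C} {F : i ⟶ j}
    (hF : (⟨F⟩ : OneMor C) ∈ R) (X : M.obj i) [Simple X] :
    IsZero (M.actObj F X) ∨ Nonempty (X ≅ T) := by
  by_cases h : ∀ f : M.actObj G T ⟶ X, f = 0
  · exact .inl (g.isZero_act hF h)
  · push Not at h
    obtain ⟨f, hf⟩ := h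
    obtain ⟨t, ht⟩ := g.exists_top hG
    have := g.simple
    have := g.projective hG
    obtain ⟨e, -⟩ := exists_iso_of_top (g.isLocalObj hG) hf ht
    exact .inr ⟨e⟩

variable [HasBiadjoints C]

/-- The `1`-morphisms of `R` send all objects to projective objects. -/
theorem projective_act (g : M.IsCellGenerator R G T) (hG : (⟨G⟩ : OneMor C) ∈ R) {j : C} {F : i ⟶ j}
    (hF : (⟨F⟩ : OneMor C) ∈ R) (X : M.obj i) : Projective (M.actObj F X) := by
  have hD := M.isFiniteAbelian i
  obtain ⟨E, _, hE⟩ := hD.exists_generator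
  induction hn : Module.finrank k (E ⟶ X) using Nat.strong_induction_on generalizing X with
  | _ n ih =>
    by_cases hX : IsZero X
    · exact ((M.act F).map_isZero hX).projective
    obtain ⟨S, p, hS, hp⟩ := hD.exists_simple_quotient hX
    have hFS : Projective (M.actObj F S) := by
      rcases g.isZero_or_iso hG hF S with h | ⟨⟨e⟩⟩
      · exact h.projective
      · exact Projective.of_iso ((M.act F).mapIso e).symm (g.projective hF)
    -- Induction on length: `F` is exact, and an extension of projectives splits.
    have hex : (ShortComplex.mk (kernel.ι p) p (kernel.condition p)).ShortExact :=
      { exact := ShortComplex.exact_kernel p }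
    have hlt := hD.finrank_lt_of_mono hE (kernel.ι p) fun hi =>
      Simple.not_isZero S (IsZero.of_epi_eq_zero p
        ((cancel_epi (kernel.ι p)).1 (by rw [kernel.condition, comp_zero])))
    have hK := ih _ (hn ▸ hlt) (kernel p) rfl
    have hex' := hex.map_of_exact (M.act F)
    have : Projective (((ShortComplex.mk (kernel.ι p) p (kernel.condition p)).map (M.act F)).X₃) :=
      hFS
    have : Projective (((ShortComplex.mk (kernel.ι p) p (kernel.condition p)).map (M.act F)).X₁) :=
      hK
    exact Projective.of_iso hex'.splittingOfProjective.isoBinaryBiproduct.symm inferInstance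

variable [IsFinitary k C] {Q : Set (OneMor C)} {I : Involution C}

/-- The `1`-morphisms of `Q` send all objects to projective objects. -/
theorem projective_act_of_mem (g : M.IsCellGenerator R G T) (hc : CellCombinatorics I Q)
    (hR : IsRightCell R) (hRQ : R ⊆ Q) (hG : (⟨G⟩ : OneMor C) ∈ R) {j l : C} {H : j ⟶ l}
    (hH : (⟨H⟩ : OneMor C) ∈ Q) (X : M.obj j) : Projective (M.actObj H X) := by
  -- `D` lies in `R` and in the left cell of `H`, so `H` is a summand of some `D ∘ U` and inherits
  -- projectivity from `D`.
  obtain ⟨D, hD, h1, h2⟩ := hc.exists_meet (hRQ hG) hH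
  have hDR := hc.mem hR hRQ hG hD h1
  obtain ⟨l', D, rfl⟩ := g.exists_mor hDR
  obtain rfl : l = l' := h2.tgt_eq
  obtain ⟨U, ⟨r⟩⟩ := leftLE_iff.1 (hc.leftLE_symm hH hD h2)
  have : Projective (M.actObj (U ≫ D) X) :=
    Projective.of_iso (M.compIso U D X).symm (g.projective_act hG hDR _)
  exact (M.evalRetract r X).projective

/-- A `1`-morphism which does not annihilate a quotient of `F T` lies below the cell. -/
theorem exists_leftLE (g : M.IsCellGenerator R G T) {j l : C} {F : i ⟶ j}
    (hF : (⟨F⟩ : OneMor C) ∈ R) {S : M.obj j} (p : M.actObj F T ⟶ S) [Epi p] {J : j ⟶ l}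
    (hJ : ¬ IsZero (M.actObj J S)) : ∃ J' : i ⟶ l, (⟨J'⟩ : OneMor C) ∈ R ∧
      Nonempty (Retract J' (F ≫ J)) := by
  have h1 : ¬ IsZero (M.actObj (F ≫ J) T) := fun hz =>
    hJ (IsZero.of_epi ((M.act J).map p) (hz.of_iso (M.compIso F J T).symm))
  obtain ⟨J', r, hJ', hne⟩ := M.exists_summand_not_isZero h1
  exact ⟨J', g.mem_of_retract hF r hJ' hne, ⟨r⟩⟩

variable {R' : Set (OneMor C)}

/-- `J` lies above `H` as a summand of `U ∘ H` and below an element of `R` because it acts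
nontrivially on `S`; convexity puts it in `Q`, hence in `R'`. -/
theorem mem_of_retract_of_quotient (g : M.IsCellGenerator R G T) (hc : CellCombinatorics I Q)
    (hRQ : R ⊆ Q) (hR' : IsRightCell R') (hRQ' : R' ⊆ Q) {j l m : C} {F : i ⟶ j}
    (hF : (⟨F⟩ : OneMor C) ∈ R) {S : M.obj j} (p : M.actObj F T ⟶ S) [Epi p]
    {H : j ⟶ l} (hH : (⟨H⟩ : OneMor C) ∈ R') {U : l ⟶ m} {J : j ⟶ m} (r : Retract J (H ≫ U))
    (hJ : Indecomposable J) (hne : ¬ IsZero (M.actObj J S)) : (⟨J⟩ : OneMor C) ∈ R' := by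
  obtain ⟨J', hJ', ⟨r'⟩⟩ := g.exists_leftLE hF p hne
  exact hc.mem hR' hRQ' hH (hc.convex (hRQ' hH) (hRQ hJ') hJ (rightLE_of_retract r).twoSidedLE
    (leftLE_of_retract r').twoSidedLE) (rightLE_of_retract r)

/-- Adjoint `1`-morphisms send the simple tops of the objects `F T` to `G T`. -/
theorem nonempty_iso_dual [IsAlgClosed k] (g : M.IsCellGenerator R G T) (hI : I.HasAdjunctions)
    (hc : CellCombinatorics I Q) (hR : IsRightCell R) (hRQ : R ⊆ Q) {c : G ⟶ 𝟙 i}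
    (hG : IsDuflo I R c) {j : C} {F : i ⟶ j}
    (hF : (⟨F⟩ : OneMor C) ∈ R) {S : M.obj j} [Simple S] {p : M.actObj F T ⟶ S} (hp : p ≠ 0) :
    Nonempty (M.actObj (I.dual F) S ≅ M.actObj G T) := by
  obtain ⟨a⟩ := hI F
  obtain ⟨a'⟩ := hI.dual_adj F
  obtain ⟨b⟩ := hI.dual_adj G
  have := g.simple
  have := g.projective hG.mem
  have := g.projective hF
  have := g.projective_act_of_mem hc hR hRQ hG.mem (hc.dual_mem (hRQ hF)) S
  obtain ⟨t, ht⟩ := g.exists_top hG.mem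
  obtain ⟨e⟩ := iso₁_iff.1 hG.iso_dual
  obtain ⟨f, hf⟩ := (M.exists_ne_zero_adj b (X := T) (Y := T)).1
    ⟨M.eval e.hom T ≫ t, fun h0 => ht ((Preadditive.IsIso.comp_left_eq_zero _ _).1 h0)⟩
  -- Test on `U = T`: `Hom(T, F* S) ≅ Hom(F T, S)` is a line, while `Hom(T, G T) ≅ Hom(G* T, T)` is
  -- nonzero because `G* ≅ G`. A simple quotient `X` of `F* S` has `F X ≠ 0` and is therefore `T`.
  refine (M.isFiniteAbelian i).nonempty_iso_of_top (U := T) (g.isLocalObj hG.mem) ht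
    (fun X q hX hq => ?_) ?_ hf
  · refine (g.isZero_or_iso hG.mem hF X).resolve_left fun hz => ?_
    obtain ⟨f, hf⟩ := (M.exists_ne_zero_adj a' (X := S) (Y := X)).1
      ⟨q, fun h0 => Simple.not_isZero X (IsZero.of_epi_eq_zero q h0)⟩
    exact hf (hz.eq_of_tgt _ _)
  · rw [← M.finrank_adj a]
    exact (M.isFiniteAbelian j).finrank_top (g.isLocalObj hF) hp

end TwoRep.IsCellGenerator

end Fiat

end

/-! ### Multiplicities -/

noncomputable section

namespace Fiat

variable {C : Type u} [Bicategory.{w, v} C] [PreadditiveBicategory C] [AdditiveBicategory C]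

section Mult

variable {Q : Set (OneMor C)} {I : Involution C}

theorem inCellIdeal_of_sum (k : Type uk) [Field k] [LinearBicategory k C] [IsFinitary k C]
    {i j : C} {X Y : i ⟶ j} {κ : Type} [Fintype κ] {J : κ → (i ⟶ j)}
    (hJ : ∀ a, Indecomposable (J a))
    (hQ : ∀ a, ∀ A ∈ Q, ¬ TwoSidedLE ⟨J a⟩ A) (p : ∀ a, X ⟶ J a) (s : ∀ a, J a ⟶ Y) :
    InCellIdeal Q (∑ a, p a ≫ s a) := by
  have := IsFinitary.isIdempotentComplete (k := k) i j
  refine ⟨⨁ J, biproduct.lift p, biproduct.desc s, biproduct.lift_desc.symm, ?_⟩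
  rintro S hS ⟨r⟩ A hA hle
  obtain ⟨a, ⟨r'⟩⟩ := exists_retract_of_sum (isLocalObj_of_indecomposable k hS) r (biproduct.ι J)
    (biproduct.π J) biproduct.total
  obtain ⟨e⟩ := (hJ a).iso_of_retract hS.1 r'
  exact hQ a A hA ((Iso₁.rightLE (.mk e.symm)).twoSidedLE.trans hle)

/-- Every indecomposable summand `J` of `F* ∘ F` satisfies `F ≤_R J` and `F* ≤_L J`. Those in `Q`
are all isomorphic to the one `G` in the intersection of cells; by convexity the others are not
below `Q` and fall into the ideal. The explicit splitting is kept for counting dimensions. -/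
theorem exists_hasMult (k : Type uk) [Field k] [LinearBicategory k C] [IsFinitary k C]
    (hc : CellCombinatorics I Q) {i j : C} {F : i ⟶ j} (hF : (⟨F⟩ : OneMor C) ∈ Q) :
    ∃ (m : ℕ) (G : i ⟶ i) (s : Fin m → (G ⟶ F ≫ I.dual F)) (p : Fin m → (F ≫ I.dual F ⟶ G))
      (κ : Type) (_ : Fintype κ) (J : κ → (i ⟶ i)) (s' : ∀ a, J a ⟶ F ≫ I.dual F)
      (p' : ∀ a, F ≫ I.dual F ⟶ J a), HasMult I Q F m ∧ (⟨G⟩ : OneMor C) ∈ Q ∧ RightLE ⟨F⟩ ⟨G⟩ ∧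
        LeftLE ⟨I.dual F⟩ ⟨G⟩ ∧ (∀ a b, s a ≫ p b = if a = b then 𝟙 G else 0) ∧
        (∀ a, Indecomposable (J a) ∧ (⟨J a⟩ : OneMor C) ∉ Q ∧ s' a ≫ p' a = 𝟙 _) ∧
        ∑ a, p a ≫ s a + ∑ a, p' a ≫ s' a = 𝟙 _ := by
  classical
  obtain ⟨@⟨i', i'', G⟩, hG, hr, hl⟩ := hc.exists_meet hF (hc.dual_mem hF)
  obtain rfl : i = i' := hr.src_eq
  obtain rfl : i = i'' := hl.tgt_eq
  obtain ⟨ι, _, J, s, p, hi, h1, h2, hs⟩ := decomposition k (F ≫ I.dual F)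
  have hle (a : ι) : RightLE ⟨F⟩ ⟨J a⟩ := rightLE_of_retract ⟨s a, p a, h1 a⟩
  have hle' (a : ι) : LeftLE ⟨I.dual F⟩ ⟨J a⟩ := leftLE_of_retract ⟨s a, p a, h1 a⟩
  have hiso (a : {a // (⟨J a⟩ : OneMor C) ∈ Q}) : Nonempty (J a ≅ G) :=
    iso₁_iff.1 (hc.iso a.2 hG ((hc.rightLE_symm hF a.2 (hle a)).trans hr)
      ((hc.leftLE_symm (hc.dual_mem hF) a.2 (hle' a)).trans hl))
  let φ a := (hiso a).some
  let e := (Fintype.equivFin {a // (⟨J a⟩ : OneMor C) ∈ Q}).symm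
  let s₁ (a : Fin (Fintype.card {a // (⟨J a⟩ : OneMor C) ∈ Q})) := (φ (e a)).inv ≫ s (e a)
  let p₁ (a : Fin (Fintype.card {a // (⟨J a⟩ : OneMor C) ∈ Q})) := p (e a) ≫ (φ (e a)).hom
  have horth (a b) : s₁ a ≫ p₁ b = if a = b then 𝟙 G else 0 := by
    split_ifs with hab
    · subst hab
      simp only [s₁, p₁, Category.assoc, reassoc_of% (h1 (e a)), Iso.inv_hom_id]
    · have : (e a : ι) ≠ e b := fun h => hab (e.injective (Subtype.ext h))
      simp only [s₁, p₁, Category.assoc, reassoc_of% (h2 _ _ this), zero_comp, comp_zero]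
  have hsum : ∑ a, p₁ a ≫ s₁ a + ∑ a : {a // ¬ (⟨J a⟩ : OneMor C) ∈ Q}, p a ≫ s a = 𝟙 _ := by
    have h3 : ∑ a, p₁ a ≫ s₁ a = ∑ a : {a // (⟨J a⟩ : OneMor C) ∈ Q}, p a ≫ s a := by
      rw [← e.sum_comp]
      refine Finset.sum_congr rfl fun a _ => ?_
      simp only [s₁, p₁, Category.assoc, Iso.hom_inv_id_assoc]
    rw [h3, Fintype.sum_subtype_add_sum_subtype (fun a => (⟨J a⟩ : OneMor C) ∈ Q)
      (fun a => p a ≫ s a), hs]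
  refine ⟨_, G, s₁, p₁, {a // ¬ (⟨J a⟩ : OneMor C) ∈ Q}, inferInstance, fun a => J a,
    fun a => s a, fun a => p a, ?_, hG, hr, hl, horth, fun a => ⟨hi a, a.2, h1 a⟩, hsum⟩
  refine ⟨G, ⟨⟨hc.indecomposable hG, hr, hc.rightLE_symm hF hG hr⟩, hc.indecomposable hG, hl,
    hc.leftLE_symm (hc.dual_mem hF) hG hl⟩, biproduct.lift p₁, biproduct.desc s₁, ?_, ?_⟩
  · have h4 := inCellIdeal_of_sum k (Q := Q) (fun a : {a // ¬ (⟨J a⟩ : OneMor C) ∈ Q} => hi a)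
      (fun a A hA h => a.2 (hc.convex hF hA (hi a) (hle a).twoSidedLE h)) (fun a => - p a)
      (fun a => s a)
    rw [biproduct.lift_desc, ← hsum, sub_add_cancel_left]
    simpa only [Preadditive.neg_comp, Finset.sum_neg_distrib] using h4
  · have h4 : biproduct.desc s₁ ≫ biproduct.lift p₁ = 𝟙 _ := by
      ext a b
      simp [horth, biproduct.ι_π]
    rw [h4, sub_self]
    simpa using inCellIdeal_of_sum k (Q := Q) (X := ⨁ fun _ => G) (Y := ⨁ fun _ => G)
      (κ := Empty) (J := Empty.elim) (fun a => a.elim) (fun a => a.elim) (fun a => a.elim)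
      (fun a => a.elim)

end Mult

namespace TwoRep

variable {k : Type uk} [Field k] [LinearBicategory k C] (M : TwoRep.{w, v, u, u', uk} k C)

theorem finrank_of_sum {i j : C} {H G : i ⟶ j} {m : ℕ} {s : Fin m → (G ⟶ H)}
    {p : Fin m → (H ⟶ G)} (h1 : ∀ a b, s a ≫ p b = if a = b then 𝟙 G else 0) {X : M.obj i}
    (h2 : M.eval (∑ a, p a ≫ s a) X = 𝟙 _) (Y : M.obj j) :
    Module.finrank k (M.actObj H X ⟶ Y) = m * Module.finrank k (M.actObj G X ⟶ Y) := by
  have := (M.isFiniteAbelian j).finite_hom (M.actObj G X) Y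
  have e : (M.actObj H X ⟶ Y) ≃ₗ[k] (Fin m → (M.actObj G X ⟶ Y)) :=
    { toFun := fun f a => M.eval (s a) X ≫ f
      invFun := fun f => ∑ a, M.eval (p a) X ≫ f a
      map_add' := fun f f' => by ext a; exact Preadditive.comp_add _ _ _ _ _ _
      map_smul' := fun c f => by ext a; exact Linear.comp_smul _ _ _ _ _ _
      left_inv := fun f => by
        change ∑ a, M.eval (p a) X ≫ M.eval (s a) X ≫ f = f
        simp_rw [← Category.assoc, ← eval_comp]
        rw [← Preadditive.sum_comp, ← eval_sum, h2, Category.id_comp]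
      right_inv := fun f => by
        ext a
        change M.eval (s a) X ≫ ∑ b, M.eval (p b) X ≫ f b = f a
        rw [Preadditive.comp_sum, Finset.sum_eq_single a]
        · rw [← Category.assoc, ← eval_comp, h1, if_pos rfl, eval_id, Category.id_comp]
        · intro b _ hb
          rw [← Category.assoc, ← eval_comp, h1, if_neg hb.symm, eval_zero, zero_comp]
        · simp }
  rw [e.finrank_eq, Module.finrank_pi_fintype]
  simp

end TwoRep

end Fiat

end

/-! ### The dimension count and change of simple object -/

noncomputable section

namespace Fiat

variable {C : Type u} [Bicategory.{w, v} C] [PreadditiveBicategory C] [AdditiveBicategory C]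

namespace TwoRep

variable {k : Type uk} [Field k] [LinearBicategory k C] [IsFinitary k C]
  {M : TwoRep.{w, v, u, u', uk} k C} {Q : Set (OneMor C)} {I : Involution C}

theorem finrank_congr {D : Type u'} [Category.{v'} D] [Preadditive D] [Linear k D] {X X' Y Y' : D}
    (e : X ≅ X') (e' : Y ≅ Y') : Module.finrank k (X ⟶ Y) = Module.finrank k (X' ⟶ Y') :=
  (Linear.homCongr k e e').finrank_eq

/-- `End(H X) ≅ Hom(H* H X, X)`, and on `X` the 1-morphism `H* ∘ H` acts as `m` copies of `G`, since
its summands outside `Q` annihilate `X`. -/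
theorem exists_finrank_end (M : TwoRep.{w, v, u, u', uk} k C) (hI : I.HasAdjunctions)
    (hc : CellCombinatorics I Q) {i j : C} {H : i ⟶ j} (hH : (⟨H⟩ : OneMor C) ∈ Q) {X : M.obj i}
    (hX : ∀ (J : i ⟶ i) (_ : Retract J (H ≫ I.dual H)), Indecomposable J →
      ¬ IsZero (M.actObj J X) → (⟨J⟩ : OneMor C) ∈ Q) :
    ∃ (m : ℕ) (G : i ⟶ i), HasMult I Q H m ∧ (⟨G⟩ : OneMor C) ∈ Q ∧ RightLE ⟨H⟩ ⟨G⟩ ∧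
      LeftLE ⟨I.dual H⟩ ⟨G⟩ ∧
      Module.finrank k (M.actObj H X ⟶ M.actObj H X) =
        m * Module.finrank k (M.actObj G X ⟶ X) := by
  obtain ⟨m, G, s, p, κ, _, J, s', p', hm, hG, hr, hl, h1, h2, h3⟩ := exists_hasMult k hc hH
  refine ⟨m, G, hm, hG, hr, hl, ?_⟩
  obtain ⟨a⟩ := hI.dual_adj H
  rw [← M.finrank_adj a, ← finrank_congr (M.compIso H (I.dual H) X) (Iso.refl _)]
  refine M.finrank_of_sum h1 ?_ X
  have h4 : M.eval (∑ a, p' a ≫ s' a) X = 0 := by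
    rw [eval_sum]
    refine Finset.sum_eq_zero fun a _ => ?_
    have hz : IsZero (M.actObj (J a) X) := by
      by_contra hz
      exact (h2 a).2.1 (hX (J a) ⟨s' a, p' a, (h2 a).2.2⟩ (h2 a).1 hz)
    rw [eval_comp, hz.eq_of_src (M.eval (s' a) X) 0, comp_zero]
  rw [← eval_id, ← h3, eval_add, h4, add_zero]

end TwoRep

namespace TwoRep.IsCellGenerator

variable {k : Type uk} [Field k] [LinearBicategory k C] [IsFinitary k C] [HasBiadjoints C]
  [IsAlgClosed k] {M : TwoRep.{w, v, u, u', uk} k C} {R R' : Set (OneMor C)} {i j : C} {G : i ⟶ i}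
  {c : G ⟶ 𝟙 i} {T : M.obj i} {Q : Set (OneMor C)} {I : Involution C} {G' : j ⟶ j} {c' : G' ⟶ 𝟙 j}
  {F : i ⟶ j} {S : M.obj j} [Simple S] {p : M.actObj F T ⟶ S}

/-- The dimension of `End(G T) ≅ End(F* S)` is `m_{G,G} · 1` on one side and `m_{F*,F*} · dim Hom(G'
S, S)` on the other. `G` and `F*` lie in one left cell, so the multiplicities agree and cancel,
being nonzero because `G T ≠ 0`. This is where constancy on left cells enters. -/
theorem finrank_quotient (g : M.IsCellGenerator R G T) (hI : I.HasAdjunctions)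
    (hc : CellCombinatorics I Q) (hm : MultConstant I Q) (hR : IsRightCell R) (hRQ : R ⊆ Q)
    (hG : IsDuflo I R c) (hF : (⟨F⟩ : OneMor C) ∈ R) (hp : p ≠ 0)
    (hR' : IsRightCell R') (hRQ' : R' ⊆ Q) (hG' : IsDuflo I R' c')
    (hF' : (⟨I.dual F⟩ : OneMor C) ∈ R') : Module.finrank k (M.actObj G' S ⟶ S) = 1 := by
  have := epi_of_ne_zero hp
  obtain ⟨m, G₀, h1, h2, h3, h4, h5⟩ := exists_finrank_end M hI hc (hRQ hG.mem) (X := T)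
    (fun J r hJ hne => hRQ (g.mem_of_retract hG.mem r hJ hne))
  obtain ⟨m', G₀', h1', h2', h3', h4', h5'⟩ := exists_finrank_end M hI hc (hRQ' hF') (X := S)
    (fun J r hJ hne => hRQ' (g.mem_of_retract_of_quotient hc hRQ hR' hRQ' hF p hF' r hJ hne))
  obtain ⟨e⟩ := hG.iso hc hR hRQ hG.mem (hc.mem hR hRQ hG.mem h2 h3) h4
  obtain ⟨e'⟩ := hG'.iso hc hR' hRQ' hF' (hc.mem hR' hRQ' hF' h2' h3') h4'
  obtain ⟨φ⟩ := g.nonempty_iso_dual hI hc hR hRQ hG hF hp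
  have hLR : (⟨I.dual F⟩ : OneMor C) ∈ cellOf LeftLE ⟨G⟩ :=
    ⟨hc.indecomposable (hRQ' hF'), hG.leftLE' hR hF, hG.leftLE hR hF⟩
  have hmm : m = m' := hm (cellOf LeftLE ⟨G⟩) ⟨_, hc.indecomposable (hRQ hG.mem), rfl⟩
    (fun A hA => hc.convex (hRQ hG.mem) (hRQ hG.mem) hA.1 hA.2.1.twoSidedLE hA.2.2.twoSidedLE)
    ⟨G⟩ ⟨hc.indecomposable (hRQ hG.mem), LeftLE.refl _, LeftLE.refl _⟩ _ hLR m m' h1 h1'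
  subst hmm
  rw [finrank_congr (show M.actObj G₀ T ≅ M.actObj G T from (M.evFunctor i T).mapIso e)
    (Iso.refl T), g.finrank_top hG.mem, mul_one] at h5
  rw [finrank_congr φ φ, h5, finrank_congr (show M.actObj G₀' S ≅ M.actObj G' S from
    (M.evFunctor j S).mapIso e') (Iso.refl S)] at h5'
  have hm0 : m ≠ 0 := by
    rintro rfl
    have := (M.isFiniteAbelian i).finite_hom (M.actObj G T) (M.actObj G T)
    have := Module.finrank_zero_iff.1 h5
    exact g.not_isZero hG.mem ((IsZero.iff_id_eq_zero _).2 (Subsingleton.elim _ _))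
  exact (Nat.eq_of_mul_eq_mul_left (Nat.pos_of_ne_zero hm0) ((mul_one m).trans h5')).symm

/-- `F*` is a summand of some `U ∘ H`, so `H S = 0` would kill `F* S ≅ G T`. -/
theorem not_isZero_act_quotient (g : M.IsCellGenerator R G T) (hI : I.HasAdjunctions)
    (hc : CellCombinatorics I Q) (hR : IsRightCell R) (hRQ : R ⊆ Q)
    (hG : IsDuflo I R c) (hF : (⟨F⟩ : OneMor C) ∈ R) (hp : p ≠ 0) (hR' : IsRightCell R')
    (hF' : (⟨I.dual F⟩ : OneMor C) ∈ R') {l : C} {H : j ⟶ l} (hH : (⟨H⟩ : OneMor C) ∈ R') :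
    ¬ IsZero (M.actObj H S) := fun hz => by
  obtain ⟨φ⟩ := g.nonempty_iso_dual hI hc hR hRQ hG hF hp
  obtain ⟨U, ⟨r⟩⟩ := rightLE_iff.1 (hR'.rightLE hH hF')
  have h1 : IsZero (M.actObj (H ≫ U) S) :=
    ((M.act U).map_isZero hz).of_iso (M.compIso H U S)
  have h2 : IsZero (M.actObj (I.dual F) S) := by
    rw [IsZero.iff_id_eq_zero, ← (M.evalRetract r S).retract,
      h1.eq_of_tgt (M.evalRetract r S).i 0, zero_comp]
  exact g.not_isZero hG.mem (h2.of_iso φ.symm)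

/-- The simple top of `F T` generates with respect to the right cell of the adjoint of `F`. -/
theorem quotient (g : M.IsCellGenerator R G T) (hI : I.HasAdjunctions)
    (hc : CellCombinatorics I Q) (hm : MultConstant I Q) (hR : IsRightCell R) (hRQ : R ⊆ Q)
    (hG : IsDuflo I R c) (hF : (⟨F⟩ : OneMor C) ∈ R) (hp : p ≠ 0)
    (hR' : IsRightCell R') (hRQ' : R' ⊆ Q) (hG' : IsDuflo I R' c')
    (hF' : (⟨I.dual F⟩ : OneMor C) ∈ R') : M.IsCellGenerator R' G' S := by
  have := epi_of_ne_zero hp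
  obtain ⟨φ⟩ := g.nonempty_iso_dual hI hc hR hRQ hG hF hp
  have h1 := g.finrank_quotient hI hc hm hR hRQ hG hF hp hR' hRQ' hG' hF'
  have h0 {l : C} {H : j ⟶ l} (hH : (⟨H⟩ : OneMor C) ∈ R') : ¬ IsZero (M.actObj H S) :=
    g.not_isZero_act_quotient hI hc hR hRQ hG hF hp hR' hF' hH
  have hmem {l m : C} {H : j ⟶ l} {U : l ⟶ m} {J : j ⟶ m} (hH : (⟨H⟩ : OneMor C) ∈ R')
      (r : Retract J (H ≫ U)) (hJ : Indecomposable J) (hne : ¬ IsZero (M.actObj J S)) :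
      (⟨J⟩ : OneMor C) ∈ R' :=
    g.mem_of_retract_of_quotient hc hRQ hR' hRQ' hF p hH r hJ hne
  have hiso {l : C} {H : j ⟶ l} {H' : j ⟶ l} (hH : (⟨H⟩ : OneMor C) ∈ R')
      (hH' : (⟨H'⟩ : OneMor C) ∈ R') {J : j ⟶ j} (r : Retract J (H ≫ I.dual H'))
      (hJ : Indecomposable J) (hne : ¬ IsZero (M.actObj J S)) : Nonempty (J ≅ G') :=
    hG'.iso hc hR' hRQ' hH' (hmem hH r hJ hne) (leftLE_of_retract r)
  obtain ⟨s, hs⟩ := hG'.exists_section hF'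
  have hc0 := eval_ne_zero_of_section M hs (h0 hF')
  -- A nonzero map `F₁ T → X` extends over the split epimorphism `F₁ G T → F₁ T`; since `G T ≅ F*
  -- S`, this is a map from `(F₁ ∘ F*) S`, nonzero on some summand.
  have hex {l : C} {X : M.obj l} (hX : ¬ IsZero X) :
      ∃ (H : j ⟶ l) (f : M.actObj H S ⟶ X), (⟨H⟩ : OneMor C) ∈ R' ∧ f ≠ 0 := by
    obtain ⟨F₁, f, hF₁, hf⟩ := g.exists_ne_zero hX
    obtain ⟨s₁, hs₁⟩ := hG.exists_section hF₁
    let ψ : M.actObj (I.dual F ≫ F₁) S ≅ M.actObj (G ≫ F₁) T :=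
      M.compIso _ _ _ ≪≫ (M.act F₁).mapIso φ ≪≫ (M.compIso _ _ _).symm
    have hne : ψ.hom ≫ M.eval (c ▷ F₁ ≫ (λ_ F₁).hom) T ≫ f ≠ 0 := fun h => hf <| by
      have h2 := (Preadditive.IsIso.comp_left_eq_zero _ _).1 h
      rw [← Category.id_comp f, ← eval_id, ← hs₁, eval_comp, Category.assoc, h2, comp_zero]
    obtain ⟨J, r, hJ, hJ0⟩ := M.exists_summand_ne_zero hne
    exact ⟨J, _, hmem hF' r hJ (fun hz => hJ0 (hz.eq_of_src _ _)), hJ0⟩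
  refine ⟨fun {A} hA => ?_, inferInstance, fun {l H} hH => ?_, fun {l H} hH => ⟨h0 hH, fun f => ?_⟩,
    fun {l X} hX => ?_, hmem, fun {l H X} hH hX => ?_⟩
  · rcases A with @⟨a, l, H⟩
    obtain rfl : j = a := (hR'.rightLE hF' hA).src_eq
    exact ⟨l, H, rfl⟩
  · exact g.projective_act_of_mem hc hR hRQ hG.mem (hRQ' hH) S
  · obtain ⟨β, rfl⟩ := M.exists_eval_of_duflo hI h1 hc0 (fun J r hJ hne => hiso hH hH r hJ hne) f
    rcases (isLocalObj_of_indecomposable k (hR'.indecomposable hH)).2 β with h | h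
    · exact .inl inferInstance
    · right
      rw [← eval_id, ← eval_sub]
      infer_instance
  · exact hex hX
  -- A nonzero `H' S → H X` transposes to a nonzero map on a summand of `H* ∘ H'`, which can only be
  -- `G'`.
  · by_contra hz
    obtain ⟨H', f, hH', hf⟩ := hex hz
    obtain ⟨a⟩ := hI.dual_adj H
    obtain ⟨f', hf'⟩ := (M.exists_ne_zero_adj a).2 ⟨f, hf⟩
    have hne : (M.compIso H' (I.dual H) S).hom ≫ f' ≠ 0 := fun h =>
      hf' ((Preadditive.IsIso.comp_left_eq_zero _ _).1 h)
    obtain ⟨J, r, hJ, hJ0⟩ := M.exists_summand_ne_zero hne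
    obtain ⟨e⟩ := hiso hH' hH r hJ (fun hz => hJ0 (hz.eq_of_src _ _))
    exact hJ0 ((Preadditive.IsIso.comp_left_eq_zero (M.eval e.inv S) _).1 (hX _))

end TwoRep.IsCellGenerator

end Fiat

end

/-! ### Cell generators generate -/

noncomputable section

namespace Fiat

variable {C : Type u} [Bicategory.{w, v} C] [PreadditiveBicategory C] [AdditiveBicategory C]

/-- Approximation by sums of elements of a right cell. -/
theorem exists_addR_approx {k : Type uk} [Field k] [LinearBicategory k C] [IsFinitary k C]
    {R : Set (OneMor C)} (hR : IsRightCell R) {i l : C} {D : Type u'} [Category.{v'} D]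
    [Preadditive D] [Linear k D] (E : (i ⟶ l) ⥤ D) [E.Additive] [E.Linear k] {Y : D}
    (hfin : ∀ H, Module.Finite k (E.obj H ⟶ Y)) (W : ∀ H : i ⟶ l, Submodule k (E.obj H ⟶ Y))
    (hW : ∀ {H H' : i ⟶ l} (a : H ⟶ H') {h : E.obj H' ⟶ Y}, h ∈ W H' → E.map a ≫ h ∈ W H) :
    ∃ H₁ : i ⟶ l, AddR R H₁ ∧ ∃ β ∈ W H₁, ∀ (H : i ⟶ l) (h : E.obj H ⟶ Y), AddR R H → h ∈ W H →
      ∃ a : H ⟶ H₁, E.map a ≫ β = h := by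
  classical
  obtain ⟨n, F, hF⟩ := IsFinitary.finite_indecomposables (k := k) i l
  let A := {a : Fin n // (⟨F a⟩ : OneMor C) ∈ R}
  let κ := Σ a : A, Fin (Module.finrank k (W (F a)))
  let b (a : A) := Module.finBasis k (W (F a))
  -- One copy of each representative in `R` for every basis vector of its space `W`, so that linear
  -- combinations of basis vectors factor through `β`.
  let H₁ : i ⟶ l := ⨁ fun x : κ => F x.1
  let β : E.obj H₁ ⟶ Y := ∑ x : κ, E.map (biproduct.π (fun x : κ => F x.1) x) ≫ (b x.1 x.2 : _ ⟶ Y)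
  have hβ (x : κ) : E.map (biproduct.ι (fun x : κ => F x.1) x) ≫ β = b x.1 x.2 := by
    rw [Preadditive.comp_sum, Finset.sum_eq_single x]
    · rw [← Category.assoc, ← E.map_comp, biproduct.ι_π_self, E.map_id, Category.id_comp]
    · intro y _ hy
      rw [← Category.assoc, ← E.map_comp, biproduct.ι_π_ne _ hy.symm, E.map_zero, zero_comp]
    · simp
  refine ⟨H₁, addR_of_sum k _ _ (fun x : κ => addR_of_mem k hR x.1.2) biproduct.total, β,
    Submodule.sum_mem _ fun x _ => hW _ (b x.1 x.2).2, fun H h hH hh => ?_⟩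
  have key (J : i ⟶ l) (h : E.obj J ⟶ Y) (hJ : (⟨J⟩ : OneMor C) ∈ R) (hh : h ∈ W J) :
      ∃ a : J ⟶ H₁, E.map a ≫ β = h := by
    obtain ⟨a, ⟨e⟩⟩ := hF J (hR.indecomposable hJ)
    let a' : A := ⟨a, hR.mem_of_iso hJ (.mk e)⟩
    let w : W (F a') := ⟨E.map e.inv ≫ h, hW _ hh⟩
    refine ⟨e.hom ≫ ∑ j, (b a').repr w j • biproduct.ι (fun x : κ => F x.1) ⟨a', j⟩, ?_⟩
    have h1 : ∑ j, (b a').repr w j • (b a' j : E.obj (F a') ⟶ Y) = E.map e.inv ≫ h := by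
      have := congrArg (W (F a')).subtype ((b a').sum_repr w)
      exact (map_sum (W (F a')).subtype _ _).symm.trans this
    rw [E.map_comp, Category.assoc, E.map_sum, Preadditive.sum_comp]
    simp only [E.map_smul, Linear.smul_comp, hβ]
    rw [h1, ← Category.assoc, ← E.map_comp, e.hom_inv_id, E.map_id, Category.id_comp]
  obtain ⟨ι, _, J, s, p, hi, h1, -, hs⟩ := decomposition k H
  choose a ha using fun x => key (J x) (E.map (s x) ≫ h) (hH _ ⟨s x, p x, h1 x⟩ (hi x)) (hW _ hh)
  refine ⟨∑ x, p x ≫ a x, ?_⟩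
  have h2 : E.map (∑ x, p x ≫ s x) ≫ h = h := by rw [hs, E.map_id, Category.id_comp]
  simp only [E.map_sum, Preadditive.sum_comp, E.map_comp, Category.assoc, ha] at h2 ⊢
  exact h2

namespace TwoRep.IsCellGenerator

variable {k : Type uk} [Field k] [LinearBicategory k C] [IsFinitary k C]
  [IsAlgClosed k] {M : TwoRep.{w, v, u, u', uk} k C} {R : Set (OneMor C)} {i : C} {G : i ⟶ i}
  {c : G ⟶ 𝟙 i} {T : M.obj i} {Q : Set (OneMor C)} {I : Involution C}

/-- The morphisms between the objects `F T` are evaluations of `2`-morphisms. -/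
theorem exists_eval (g : M.IsCellGenerator R G T) (hI : I.HasAdjunctions)
    (hc : CellCombinatorics I Q) (hR : IsRightCell R) (hRQ : R ⊆ Q) (hG : IsDuflo I R c) {l : C}
    {H H' : i ⟶ l} (hH : AddR R H) (hH' : AddR R H') (φ : M.actObj H T ⟶ M.actObj H' T) :
    ∃ β : H ⟶ H', M.eval β T = φ := by
  obtain ⟨s, hs⟩ := hG.exists_section hG.mem
  have hc0 := eval_ne_zero_of_section M hs (g.not_isZero hG.mem)
  obtain ⟨ι, _, J', s, p, hi, h1, -, hs⟩ := decomposition k H'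
  refine M.exists_eval_of_summands φ fun J r hJ => ?_
  have hJR := hH J r hJ
  choose β hβ using fun x => M.exists_eval_of_duflo hI (H := J) (H' := J' x) (g.finrank_top hG.mem)
    hc0 (fun J'' r' hJ'' hne => hG.iso hc hR hRQ (hH' _ ⟨s x, p x, h1 x⟩ (hi x))
      (g.mem_of_retract hJR r' hJ'' hne) (leftLE_of_retract r'))
      ((M.eval r.i T ≫ φ) ≫ M.eval (p x) T)
  refine ⟨∑ x, β x ≫ s x, ?_⟩
  simp only [eval_sum, eval_comp, hβ, Category.assoc]
  simp only [← eval_comp, ← Preadditive.comp_sum, ← eval_sum, hs]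
  rw [eval_id, Category.comp_id]

/-- The elements of `Q` outside `R` annihilate `T`. -/
theorem mem_of_act [HasBiadjoints C] (g : M.IsCellGenerator R G T) (hI : I.HasAdjunctions)
    (hc : CellCombinatorics I Q) (hR : IsRightCell R) (hRQ : R ⊆ Q) (hG : IsDuflo I R c) {l : C}
    {J : i ⟶ l} (hJ : (⟨J⟩ : OneMor C) ∈ Q) (hne : ¬ IsZero (M.actObj J T)) :
    (⟨J⟩ : OneMor C) ∈ R := by
  have := g.simple
  obtain ⟨b⟩ := hI.dual_adj J
  -- A simple subobject `X` of `J T` transposes to a nonzero map `J* X → T`. Covering `X` by some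
  -- `F₁ T` yields a summand `J'` of `J* ∘ F₁` with `T` as a quotient of `J' T`.
  obtain ⟨X, m, hX, hm⟩ := (M.isFiniteAbelian l).exists_simple_sub hne
  obtain ⟨u, hu⟩ := (M.exists_ne_zero_adj b).2
    ⟨m, fun h => Simple.not_isZero X (IsZero.of_mono_eq_zero m h)⟩
  obtain ⟨F₁, f, hF₁, hf⟩ := g.exists_ne_zero (Simple.not_isZero X)
  have := epi_of_ne_zero hf
  have hne' : (M.compIso F₁ (I.dual J) T).hom ≫ (M.act (I.dual J)).map f ≫ u ≠ 0 := fun h =>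
    hu ((cancel_epi ((M.act (I.dual J)).map f)).1
      (((Preadditive.IsIso.comp_left_eq_zero _ _).1 h).trans comp_zero.symm))
  obtain ⟨J', r, hJ', ht'⟩ := M.exists_summand_ne_zero hne'
  have hJR : (⟨J'⟩ : OneMor C) ∈ R :=
    g.mem_of_retract hF₁ r hJ' (fun hz => ht' (hz.eq_of_src _ _))
  obtain ⟨t, ht⟩ := g.exists_top hG.mem
  have h1 : LeftLE (⟨J'⟩ : OneMor C) ⟨G⟩ := by
    set t' := M.eval r.i T ≫ (M.compIso F₁ (I.dual J) T).hom ≫ (M.act (I.dual J)).map f ≫ u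
    have := epi_of_ne_zero ht
    have := epi_of_ne_zero ht'
    have := g.projective hG.mem
    have := g.projective hJR
    -- The comparison maps between the two covers `G T` and `J' T` of `T` are evaluations. Their
    -- composite fixes `t`, so by locality of `End(G)` it is invertible and `J' ≅ G`.
    obtain ⟨β, hβ⟩ := g.exists_eval hI hc hR hRQ hG (addR_of_mem k hR hJR)
      (addR_of_mem k hR hG.mem) (Projective.factorThru t' t)
    obtain ⟨γ, hγ⟩ := g.exists_eval hI hc hR hRQ hG (addR_of_mem k hR hG.mem)
      (addR_of_mem k hR hJR) (Projective.factorThru t t')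
    have h2 : M.eval (γ ≫ β) T ≫ t = t := by
      rw [eval_comp, hβ, hγ, Category.assoc, Projective.factorThru_comp,
        Projective.factorThru_comp]
    rcases (isLocalObj_of_indecomposable k (hR.indecomposable hG.mem)).2 (γ ≫ β) with h | h
    · have := IsFinitary.isIdempotentComplete (k := k) i i
      obtain ⟨e⟩ := hJ'.iso_of_retract (hR.indecomposable hG.mem).1
        ⟨γ, β ≫ inv (γ ≫ β), by rw [← Category.assoc, IsIso.hom_inv_id]⟩
      exact Iso₁.leftLE (.mk e.symm)
    · refine absurd ?_ ht
      refine (Preadditive.IsIso.comp_left_eq_zero (M.eval (𝟙 _ - γ ≫ β) T) _).1 ?_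
      rw [eval_sub, eval_id, Preadditive.sub_comp, h2, Category.id_comp, sub_self]
  have h2 : LeftLE (I.dual₁ ⟨J⟩) (I.dual₁ ⟨G⟩) :=
    ((leftLE_of_retract r).trans h1).trans hG.iso_dual.symm.leftLE
  exact hc.mem hR hRQ hG.mem hJ (hc.rightLE_symm hJ (hRQ hG.mem) (rightLE_of_dual h2))

/-- The cover of an object by some `H T`. -/
theorem exists_cover (g : M.IsCellGenerator R G T) (hR : IsRightCell R) {l : C}
    (X : M.obj l) : ∃ (H : i ⟶ l) (q : M.actObj H T ⟶ X), AddR R H ∧ Epi q := by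
  obtain ⟨H, hH, q, -, hq⟩ := exists_addR_approx (k := k) hR (M.evFunctor l T) (Y := X)
    (fun H => (M.isFiniteAbelian l).finite_hom _ _) (fun _ => ⊤) (fun _ _ _ => trivial)
  refine ⟨H, q, hH, ?_⟩
  change M.actObj H T ⟶ X at q
  refine Preadditive.epi_of_isZero_cokernel q ?_
  by_contra hz
  obtain ⟨F, f, hF, hf⟩ := g.exists_ne_zero hz
  have := g.projective hF
  let f' : M.actObj F T ⟶ X := Projective.factorThru f (cokernel.π q)
  obtain ⟨a, ha⟩ := hq F f' (addR_of_mem k hR hF) trivial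
  have ha' : M.eval a T ≫ q = f' := ha
  apply hf
  rw [← Projective.factorThru_comp f (cokernel.π q)]
  change f' ≫ _ = _
  rw [← ha', Category.assoc, cokernel.condition, comp_zero]

theorem projective_addR (g : M.IsCellGenerator R G T) {l : C} {H : i ⟶ l} (hH : AddR R H) :
    Projective (M.actObj H T) where
  factors {X Y} f e he := by
    obtain ⟨ι, _, J, s, p, hi, h1, -, hs⟩ := decomposition k H
    have (a : ι) : Projective (M.actObj (J a) T) :=
      g.projective (hH _ ⟨s a, p a, h1 a⟩ (hi a))
    refine ⟨∑ a, M.eval (p a) T ≫ Projective.factorThru (M.eval (s a) T ≫ f) e, ?_⟩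
    simp only [Preadditive.sum_comp, Category.assoc, Projective.factorThru_comp]
    simp only [← Category.assoc, ← eval_comp, ← Preadditive.sum_comp, ← eval_sum, hs]
    rw [eval_id, Category.id_comp]

/-- The relations approximate all 2-morphisms into `α.right` whose evaluation is killed by `q`. The
resulting factorization holds between 2-morphisms, not only between their values at `T`; commutative
squares in `generates` depend on it. -/
theorem exists_presentation (g : M.IsCellGenerator R G T) (hI : I.HasAdjunctions)
    (hc : CellCombinatorics I Q) (hR : IsRightCell R) (hRQ : R ⊆ Q) (hG : IsDuflo I R c) {l : C}
    (X : M.obj l) : ∃ (α : Arrow (i ⟶ l)) (q : M.actObj α.right T ⟶ X), AddR R α.left ∧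
      AddR R α.right ∧ M.IsCokerValue T α q ∧ ∀ (H : i ⟶ l) (h : H ⟶ α.right), AddR R H →
        M.eval h T ≫ q = 0 → ∃ a, a ≫ α.hom = h := by
  obtain ⟨H₀, q, hH₀, hq⟩ := g.exists_cover hR X
  let W (H : i ⟶ l) : Submodule k (H ⟶ H₀) :=
    { carrier := {h | M.eval h T ≫ q = 0}
      add_mem' := fun {a b} ha hb => by
        change M.eval (a + b) T ≫ q = 0
        rw [eval_add, Preadditive.add_comp, ha, hb, add_zero]
      zero_mem' := by
        change M.eval 0 T ≫ q = 0
        rw [eval_zero, zero_comp]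
      smul_mem' := fun x a ha => by
        change M.eval (x • a) T ≫ q = 0
        rw [show M.eval (x • a) T = x • M.eval a T from M.map₂_smul _ _ _, Linear.smul_comp, ha,
          smul_zero] }
  obtain ⟨H₁, hH₁, β, hβ, hf⟩ := exists_addR_approx (k := k) hR (𝟭 (i ⟶ l)) (Y := H₀)
    (fun H => IsFinitary.finite_hom _ _) W (fun {H H'} a {h} hh => by
      change M.eval (a ≫ h) T ≫ q = 0
      rw [eval_comp, Category.assoc, hh, comp_zero])
  refine ⟨Arrow.mk (show H₁ ⟶ H₀ from β), q, hH₁, hH₀, isCoker_iff.2 ⟨hβ, hq, fun Y b hb => ?_⟩, hf⟩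
  obtain ⟨H, q₁, hH, hq₁⟩ := g.exists_cover hR (kernel q)
  obtain ⟨h, hh⟩ := g.exists_eval hI hc hR hRQ hG hH hH₀ (q₁ ≫ kernel.ι q)
  obtain ⟨a, ha⟩ := hf H h hH (by
    change M.eval h T ≫ q = 0
    rw [hh, Category.assoc, kernel.condition, comp_zero])
  have h0 : kernel.ι q ≫ b = 0 := by
    rw [← cancel_epi q₁, ← Category.assoc, ← hh, ← ha, comp_zero]
    change M.eval (a ≫ β) T ≫ b = 0
    rw [eval_comp, Category.assoc]
    exact (congrArg _ hb).trans comp_zero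
  exact ⟨Abelian.epiDesc q b h0, Abelian.comp_epiDesc q b h0⟩

/-- `φ` lifts to the projective covers and the lift is an evaluation `ξ₀`. Then `α.hom ≫ ξ₀` dies in
`Y`, so it factors strictly through the relations of `Y`, which completes the square. -/
theorem generates (g : M.IsCellGenerator R G T) (hI : I.HasAdjunctions)
    (hc : CellCombinatorics I Q) (hR : IsRightCell R) (hRQ : R ⊆ Q) (hG : IsDuflo I R c) :
    M.Generates T := by
  intro l X Y
  obtain ⟨α, p, hα, hα', hp, -⟩ := g.exists_presentation hI hc hR hRQ hG X
  obtain ⟨β, q, hβ, hβ', hq, hf⟩ := g.exists_presentation hI hc hR hRQ hG Y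
  refine ⟨α, β, p, q, hp, hq, fun φ => ?_⟩
  have := g.projective_addR hα'
  have : Epi q := IsCoker.epi hq
  obtain ⟨ξ₀, hξ₀⟩ := g.exists_eval hI hc hR hRQ hG hα' hβ' (Projective.factorThru (p ≫ φ) q)
  obtain ⟨ξ₁, hξ₁⟩ := hf _ (α.hom ≫ ξ₀) hα (by
    rw [eval_comp, hξ₀, Category.assoc, Projective.factorThru_comp, ← Category.assoc,
      IsCoker.zero hp, zero_comp])
  refine ⟨Arrow.homMk ξ₁ ξ₀ hξ₁, ?_⟩
  change p ≫ φ = M.eval ξ₀ T ≫ q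
  rw [hξ₀, Projective.factorThru_comp]

end TwoRep.IsCellGenerator

end Fiat

end

/-! ### Strong simplicity and comparison of evaluations -/

noncomputable section

namespace Fiat

variable {C : Type u} [Bicategory.{w, v} C] [PreadditiveBicategory C] [AdditiveBicategory C]

variable {k : Type uk} [Field k] [LinearBicategory k C] [IsFinitary k C]
  {R : Set (OneMor C)} {i : C} {G : i ⟶ i} {c : G ⟶ 𝟙 i} {Q : Set (OneMor C)} {I : Involution C}

/-- Each simple object is a quotient of some `F T` with `F ∈ R`, hence a cell generator for the
right cell of `F*`. -/
theorem TwoRep.IsCellGenerator.stronglySimple [IsAlgClosed k] [HasBiadjoints C] [HomAbelian C]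
    {M : TwoRep.{w, v, u, u', uk} k C} {T : M.obj i} (g : M.IsCellGenerator R G T)
    (hI : I.HasAdjunctions) (hc : CellCombinatorics I Q) (hm : MultConstant I Q)
    (hR : IsRightCell R) (hRQ : R ⊆ Q) (hG : IsDuflo I R c) : M.StronglySimple := by
  have := g.simple
  refine ⟨⟨i, T, Simple.not_isZero T⟩, ⟨i, T, g.generates hI hc hR hRQ hG⟩, fun j S hS => ?_⟩
  obtain ⟨F, p, hF, hp⟩ := g.exists_ne_zero (Simple.not_isZero S)
  have hFQ : (⟨I.dual F⟩ : OneMor C) ∈ Q := hc.dual_mem (hRQ hF)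
  have hR' : IsRightCell (cellOf RightLE (⟨I.dual F⟩ : OneMor C)) :=
    ⟨_, hc.indecomposable hFQ, rfl⟩
  have hF' : (⟨I.dual F⟩ : OneMor C) ∈ cellOf RightLE (⟨I.dual F⟩ : OneMor C) :=
    ⟨hc.indecomposable hFQ, RightLE.refl _, RightLE.refl _⟩
  have hRQ' : cellOf RightLE (⟨I.dual F⟩ : OneMor C) ⊆ Q := fun A hA =>
    hc.convex hFQ hFQ hA.1 hA.2.1.twoSidedLE hA.2.2.twoSidedLE
  obtain ⟨G', c', hG'⟩ := exists_isDuflo k hI hc hR' hRQ' hF'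
  exact (g.quotient hI hc hm hR hRQ hG hF hp hR' hRQ' hG' hF').generates hI hc hR' hRQ' hG'

/-- Evaluations of `2`-morphisms `G ⟶ 𝟙 i` at two different objects vanish simultaneously. -/
theorem eval_duflo_eq_zero (hR : IsRightCell R) (hG : IsDuflo I R c)
    (M : TwoRep.{w, v, u, u', uk} k C) (N : TwoRep.{w, v, u, v', uk} k C)
    {X : M.obj i} {Y : N.obj i}
    (hX : ¬ IsZero (M.actObj G X)) (hY : ¬ IsZero (N.actObj G Y))
    (h1 : ∀ e : G ⟶ 𝟙 i, ∃ a : k, M.eval e X = a • M.eval c X) {e : G ⟶ 𝟙 i}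
    (he : N.eval e Y = 0) : M.eval e X = 0 := by
  obtain ⟨a, ha⟩ := h1 e
  by_cases ha0 : a = 0
  · rw [ha, ha0, zero_smul]
  exfalso
  -- Put `a⁻¹ • e` in place of `c` in the split composite. The resulting endomorphism of `G` is the
  -- identity at `X` and zero at `Y`, yet it or its complement is invertible.
  obtain ⟨s, hs⟩ := hG.exists_section hG.mem
  have hθX : M.eval (s ≫ (a⁻¹ • e) ▷ G ≫ (λ_ G).hom) X = 𝟙 _ := by
    have h2 : M.eval (a⁻¹ • e) X = M.eval c X := by
      rw [show M.eval (a⁻¹ • e) X = a⁻¹ • M.eval e X from M.map₂_smul _ _ _, ha, smul_smul,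
        inv_mul_cancel₀ ha0, one_smul]
    rw [← M.eval_id, ← hs]
    simp only [TwoRep.eval_comp, TwoRep.eval_whiskerRight, h2]
  have hθY : N.eval (s ≫ (a⁻¹ • e) ▷ G ≫ (λ_ G).hom) Y = 0 := by
    have h2 : N.eval (a⁻¹ • e) Y = 0 := by
      rw [show N.eval (a⁻¹ • e) Y = a⁻¹ • N.eval e Y from N.map₂_smul _ _ _, he, smul_zero]
    simp only [TwoRep.eval_comp, TwoRep.eval_whiskerRight, h2, Functor.map_zero, zero_comp,
      comp_zero]
  rcases (isLocalObj_of_indecomposable k (hR.indecomposable hG.mem)).2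
    (s ≫ (a⁻¹ • e) ▷ G ≫ (λ_ G).hom) with h | h
  · refine hY ((IsZero.iff_id_eq_zero _).2 ?_)
    exact (Preadditive.IsIso.comp_left_eq_zero
      (N.eval (s ≫ (a⁻¹ • e) ▷ G ≫ (λ_ G).hom) Y) _).1 (by rw [hθY, zero_comp])
  · refine hX ((IsZero.iff_id_eq_zero _).2 ?_)
    have h2 : M.eval (𝟙 _ - s ≫ (a⁻¹ • e) ▷ G ≫ (λ_ G).hom) X = 0 := by
      rw [TwoRep.eval_sub, hθX, TwoRep.eval_id, sub_self]
    exact (Preadditive.IsIso.comp_left_eq_zero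
      (M.eval (𝟙 _ - s ≫ (a⁻¹ • e) ▷ G ≫ (λ_ G).hom) X) _).1 (by rw [h2, zero_comp])

/-- Vanishing of evaluations at `Y` implies vanishing of evaluations at `X`. -/
theorem eval_eq_zero_of_eval_eq_zero (hI : I.HasAdjunctions) (hR : IsRightCell R)
    (hG : IsDuflo I R c) (M : TwoRep.{w, v, u, u', uk} k C) (N : TwoRep.{w, v, u, v', uk} k C)
    {X : M.obj i} {Y : N.obj i}
    (hX : ¬ IsZero (M.actObj G X)) (hY : ¬ IsZero (N.actObj G Y))
    (h1 : ∀ e : G ⟶ 𝟙 i, ∃ a : k, M.eval e X = a • M.eval c X)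
    {l : C} {H F : i ⟶ l} (hF : AddR R F)
    (hJ : ∀ (F' : i ⟶ l) (J J' : _), Indecomposable J → Nonempty (Retract J H) →
      (⟨F'⟩ : OneMor C) ∈ R → Retract J' (J ≫ I.dual F') → Indecomposable J' →
      ¬ IsZero (M.actObj J' X) → Nonempty (J' ≅ G))
    {m : H ⟶ F} (hm : N.eval m Y = 0) : M.eval m X = 0 := by
  refine M.eval_eq_zero_of_summands m fun J r hJi => ?_
  obtain ⟨ι, _, F', s, p, hi, h2, -, hs⟩ := decomposition k F
  suffices h : ∀ a, M.eval (r.i ≫ m ≫ p a) X = 0 by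
    have h3 : r.i ≫ m = ∑ a, (r.i ≫ m ≫ p a) ≫ s a := by
      simp only [Category.assoc, ← Preadditive.comp_sum, hs, Category.comp_id]
    rw [h3, TwoRep.eval_sum]
    exact Finset.sum_eq_zero fun a _ => by rw [TwoRep.eval_comp, h a, zero_comp]
  intro a
  -- Transposing turns the component into a 2-morphism to the identity; among the summands of its
  -- source only copies of `G` act nontrivially on `X`.
  obtain ⟨b⟩ := hI.dual_adj (F' a)
  obtain ⟨e, he⟩ := (TwoRep.transpose b).surjective (r.i ≫ m ≫ p a)
  rw [← he, M.eval_transpose_eq_zero_iff b]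
  have heY : N.eval e Y = 0 := by
    rw [← N.eval_transpose_eq_zero_iff b, he, TwoRep.eval_comp, TwoRep.eval_comp, hm, zero_comp,
      comp_zero]
  refine M.eval_eq_zero_of_summands e fun J' r' hJ' => ?_
  by_cases hz : IsZero (M.actObj J' X)
  · exact hz.eq_of_src _ _
  obtain ⟨φ⟩ := hJ (F' a) J J' hJi ⟨r⟩ (hF _ ⟨s a, p a, h2 a⟩ (hi a)) r' hJ' hz
  have h3 := eval_duflo_eq_zero hR hG M N hX hY h1 (e := φ.inv ≫ r'.i ≫ e) (by
    rw [TwoRep.eval_comp, TwoRep.eval_comp, heY, comp_zero, comp_zero])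
  rw [TwoRep.eval_comp] at h3
  exact (Preadditive.IsIso.comp_left_eq_zero _ _).1 h3

end Fiat

end

noncomputable section

namespace Fiat

/-! ### Right exact extension to the right Freyd category -/

section Extension

variable {V : Type u} [Category.{v} V] [Preadditive V] {A : Type u'} [Category.{v'} A] [Abelian A]
  (Φ : V ⥤ A) [Φ.Additive]

/-- The right exact extension of an additive functor, sending `a` to the cokernel of `Φ a`. -/
def freydExt : Preadditive.RightFreyd V ⥤ A :=
  CategoryTheory.Quotient.lift _ (Φ.mapArrow ⋙ coker A) (by
    rintro X Y f g ⟨h⟩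
    refine (cancel_epi (cokernel.π (Φ.map X.hom))).1 ?_
    have h1 := congrArg Φ.map h.comm
    rw [Φ.map_sub, Φ.map_comp] at h1
    have h2 : Φ.map f.right ≫ cokernel.π (Φ.map Y.hom) =
        Φ.map g.right ≫ cokernel.π (Φ.map Y.hom) := by
      rw [← sub_eq_zero, ← Preadditive.sub_comp, h1, Category.assoc, cokernel.condition, comp_zero]
    exact (cokernel.π_desc _ _ _).trans (h2.trans (cokernel.π_desc _ _ _).symm))

/-- The projection to the cokernel. -/
def freydExtπ (X : Preadditive.RightFreyd V) : Φ.obj (arr X).right ⟶ (freydExt Φ).obj X :=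
  cokernel.π (Φ.map (arr X).hom)

instance (X : Preadditive.RightFreyd V) : Epi (freydExtπ Φ X) :=
  inferInstanceAs (Epi (cokernel.π (Φ.map (arr X).hom)))

theorem isCoker_freydExtπ (X : Preadditive.RightFreyd V) :
    IsCoker (Φ.map (arr X).hom) (freydExtπ Φ X) :=
  isCoker_cokernel _

theorem freydExtπ_naturality {X Y : Preadditive.RightFreyd V} (f : arr X ⟶ arr Y) :
    freydExtπ Φ X ≫ (freydExt Φ).map (cls f) = Φ.map f.right ≫ freydExtπ Φ Y :=
  cokernel.π_desc _ _ _

instance : (freydExt Φ).Additive where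
  map_add {X Y f g} := by
    obtain ⟨f, rfl⟩ := cls_surj f
    obtain ⟨g, rfl⟩ := cls_surj g
    rw [← cancel_epi (freydExtπ Φ X), Preadditive.comp_add, cls_add, freydExtπ_naturality,
      freydExtπ_naturality, freydExtπ_naturality, ← Preadditive.add_comp, ← Φ.map_add]
    rfl

instance (k : Type uk) [Field k] [Linear k V] [Linear k A] [Φ.Linear k] :
    (freydExt Φ).Linear k where
  map_smul {X Y} f a := by
    obtain ⟨f, rfl⟩ := cls_surj f
    rw [← cancel_epi (freydExtπ Φ X), Linear.comp_smul, cls_smul, freydExtπ_naturality,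
      freydExtπ_naturality, ← Linear.smul_comp, ← Φ.map_smul]
    rfl

variable [HasZeroObject V]

instance isIso_freydExtπ (B : V) : IsIso (freydExtπ Φ ((pr V).obj B)) := by
  have h : Φ.map (arr ((pr V).obj B)).hom = 0 :=
    (Φ.map_isZero (isZero_zero V)).eq_of_src _ _
  have : Mono (freydExtπ Φ ((pr V).obj B)) := by
    refine Preadditive.mono_of_cancel_zero _ fun {W} a ha => ?_
    obtain ⟨l, hl⟩ := (isCoker_freydExtπ Φ ((pr V).obj B)).exists_desc (𝟙 _)
      (by rw [h, zero_comp])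
    rw [← Category.comp_id a, ← hl, ← Category.assoc, ha, zero_comp]
  exact isIso_of_mono_of_epi _

/-- The extension extends the functor. -/
def freydExtPr (B : V) : Φ.obj B ≅ (freydExt Φ).obj ((pr V).obj B) :=
  @asIso _ _ (Φ.obj B) _ (freydExtπ Φ ((pr V).obj B)) (isIso_freydExtπ Φ B)

theorem freydExtPr_naturality {B B' : V} (b : B ⟶ B') :
    Φ.map b ≫ (freydExtPr Φ B').hom = (freydExtPr Φ B).hom ≫ (freydExt Φ).map ((pr V).map b) :=
  (freydExtπ_naturality Φ (X := (pr V).obj B) (Y := (pr V).obj B') (Arrow.homMk (𝟙 _) b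
    ((isZero_zero V).eq_of_src _ _))).symm

theorem freydExtPr_fromPr (X : Preadditive.RightFreyd V) :
    (freydExtPr Φ (arr X).right).hom ≫ (freydExt Φ).map (fromPr X) = freydExtπ Φ X := by
  refine (freydExtπ_naturality Φ (X := (pr V).obj (arr X).right) (Y := X) _).trans ?_
  exact (congrArg (· ≫ freydExtπ Φ X) (CategoryTheory.Functor.map_id Φ _)).trans
    (Category.id_comp _)

instance (X : Preadditive.RightFreyd V) : Epi ((freydExt Φ).map (fromPr X)) := by
  have : Epi ((freydExtPr Φ (arr X).right).hom ≫ (freydExt Φ).map (fromPr X)) := by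
    rw [freydExtPr_fromPr]; infer_instance
  exact epi_of_epi (freydExtPr Φ (arr X).right).hom _

end Extension

variable {C : Type u} [Bicategory.{w, v} C] [PreadditiveBicategory C] [AdditiveBicategory C]
  [HomAbelian C]

/-- The extension is right exact. -/
theorem IsCoker.freydExt {i j : C} {A : Type u'} [Category.{v'} A] [Abelian A] (Φ : (i ⟶ j) ⥤ A)
    [Φ.Additive] {X Y Z : Preadditive.RightFreyd (i ⟶ j)} {f : X ⟶ Y} {p : Y ⟶ Z}
    (h : IsCoker f p) : IsCoker ((freydExt Φ).map f) ((freydExt Φ).map p) := by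
  have := h.epi
  have hP (B : i ⟶ j) : Projective ((pr (i ⟶ j)).obj B) := pr_projective B
  let s := Projective.factorThru (fromPr Z) p
  have hs : s ≫ p = fromPr Z := Projective.factorThru_comp _ _
  have hepi : Epi ((Fiat.freydExt Φ).map p) := by
    have : Epi ((Fiat.freydExt Φ).map s ≫ (Fiat.freydExt Φ).map p) := by
      rw [← Functor.map_comp, hs]; infer_instance
    exact epi_of_epi ((Fiat.freydExt Φ).map s) _
  refine isCoker_iff.2 ⟨by rw [← Functor.map_comp, h.zero, Functor.map_zero], hepi,
    fun W g hg => ?_⟩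
  -- Maps from projectives that die in `Z` lift through `f`, so `g` ignores them. Hence `g` does not
  -- depend on the choice of lifts along `p`, such as `s`.
  have hvan {B : i ⟶ j} (t : (pr (i ⟶ j)).obj B ⟶ Y) (ht : t ≫ p = 0) :
      (Fiat.freydExt Φ).map t ≫ g = 0 := by
    obtain ⟨t', rfl⟩ := h.exists_lift t ht
    rw [Functor.map_comp, Category.assoc, hg, comp_zero]
  obtain ⟨l, hl⟩ := (isCoker_freydExtπ Φ Z).exists_desc
    ((freydExtPr Φ (arr Z).right).hom ≫ (Fiat.freydExt Φ).map s ≫ g) (by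
      rw [← Category.assoc, freydExtPr_naturality, Category.assoc, ← Functor.map_comp_assoc,
        hvan _ (by rw [Category.assoc, hs, fromPr_zero]), comp_zero])
  refine ⟨l, ?_⟩
  obtain ⟨p₀, hp₀⟩ := exists_pr_map_fromPr (fromPr Y ≫ p)
  rw [← cancel_epi ((Fiat.freydExt Φ).map (fromPr Y)), ← Functor.map_comp_assoc, ← hp₀,
    ← cancel_epi (freydExtPr Φ (arr Y).right).hom, Functor.map_comp, Category.assoc,
    ← Category.assoc, ← freydExtPr_naturality, Category.assoc, ← Category.assoc _ _ l,
    freydExtPr_fromPr, hl, ← Category.assoc, freydExtPr_naturality, Category.assoc,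
    ← Functor.map_comp_assoc]
  congr 1
  rw [← sub_eq_zero, ← Preadditive.sub_comp, ← Functor.map_sub]
  exact hvan _ (by rw [Preadditive.sub_comp, Category.assoc, hs, hp₀, sub_self])

end Fiat

end

/-! ### Vanishing at `L` and at a cell generator -/

noncomputable section

namespace Fiat

variable {C : Type u} [Bicategory.{w, v} C] [PreadditiveBicategory C] [AdditiveBicategory C]
  [HomAbelian C] [HasBiadjoints C] {R : Set (OneMor C)} {Q : Set (OneMor C)} {I : Involution C}

/-- A presentation by retracts of values of a functor yields a presentation by values. -/
theorem IsCoker.of_retracts {V : Type u'} [Category.{v'} V] [Preadditive V]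
    [HasBinaryBiproducts V] {D : Type u} [Category.{v} D] [Preadditive D] (E : V ⥤ D) [E.Additive]
    {A₁ A₀ : V} {X₁ X₀ X : D} {f : X₁ ⟶ X₀} {p : X₀ ⟶ X} (hp : IsCoker f p)
    (r₁ : Retract X₁ (E.obj A₁)) (r₀ : Retract X₀ (E.obj A₀)) {b : A₁ ⟶ A₀}
    (hb : E.map b = r₁.r ≫ f ≫ r₀.i) {b' : A₀ ⟶ A₀} (hb' : E.map b' = 𝟙 _ - r₀.r ≫ r₀.i) :
    IsCoker (E.map (biprod.desc b b')) (r₀.r ≫ p) := by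
  have := hp.epi
  have : Epi r₀.r := (SplitEpi.mk r₀.i r₀.retract).epi
  have hl : E.map biprod.inl ≫ E.map (biprod.desc b b') = r₁.r ≫ f ≫ r₀.i := by
    rw [← Functor.map_comp, biprod.inl_desc, hb]
  -- The extra relations remove the complement of `X₀` in `E.obj A₀`.
  have hr : E.map biprod.inr ≫ E.map (biprod.desc b b') = 𝟙 _ - r₀.r ≫ r₀.i := by
    rw [← Functor.map_comp, biprod.inr_desc, hb']
  have htot : E.map (biprod.fst : A₁ ⊞ A₀ ⟶ A₁) ≫ E.map biprod.inl +
      E.map (biprod.snd : A₁ ⊞ A₀ ⟶ A₀) ≫ E.map biprod.inr = 𝟙 _ := by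
    rw [← Functor.map_comp, ← Functor.map_comp, ← Functor.map_add, biprod.total,
      CategoryTheory.Functor.map_id]
  refine isCoker_iff.2 ⟨?_, CategoryTheory.epi_comp _ _, fun W g hg => ?_⟩
  · rw [← Category.id_comp (E.map (biprod.desc b b')), ← htot, Preadditive.add_comp,
      Preadditive.add_comp, Category.assoc, Category.assoc, Category.assoc, Category.assoc,
      reassoc_of% hl, reassoc_of% hr]
    simp [hp.zero]
  · have h1 := congrArg (E.map (biprod.inl : A₁ ⟶ A₁ ⊞ A₀) ≫ ·) hg
    have h2 := congrArg (E.map (biprod.inr : A₀ ⟶ A₁ ⊞ A₀) ≫ ·) hg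
    simp only [comp_zero, reassoc_of% hl] at h1
    simp only [comp_zero, reassoc_of% hr] at h2
    rw [Preadditive.sub_comp, Category.id_comp, sub_eq_zero] at h2
    obtain ⟨l, hl⟩ := hp.exists_desc (r₀.i ≫ g) (by
      have h3 := congrArg (r₁.i ≫ ·) h1
      simpa using h3)
    exact ⟨l, by rw [Category.assoc, hl, ← Category.assoc, ← h2]⟩

namespace CellDatum

variable (d : CellDatum R)

/-- A presentation of an object of the cell `2`-representation by a `2`-morphism. -/
theorem exists_presentation (k : Type uk) [Field k] [LinearBicategory k C] [IsFinitary k C]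
    (hI : I.HasAdjunctions) (hR : IsRightCell R) {j : C}
    {X : Preadditive.RightFreyd (d.i ⟶ j)} (hX : d.cellObj j X) :
    ∃ (H₁ H₀ : d.i ⟶ j) (β : H₁ ⟶ H₀) (p : (Fiat.act d.i H₀).obj d.L ⟶ X), AddR R H₁ ∧ AddR R H₀ ∧
      IsCoker ((actNat d.i β).app d.L) p := by
  obtain ⟨X₁, X₀, f, p, hX₁, hX₀, hp⟩ := d.cellObj_iff.1 hX
  obtain ⟨H₁, hH₁, ⟨r₁⟩⟩ := hX₁.exists_retract k hR
  obtain ⟨H₀, hH₀, ⟨r₀⟩⟩ := hX₀.exists_retract k hR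
  obtain ⟨b, hb⟩ := d.exists_eval_L k hI hH₁ hH₀ (r₁.r ≫ f ≫ r₀.i)
  obtain ⟨b', hb'⟩ := d.exists_eval_L k hI hH₀ hH₀ (𝟙 _ - r₀.r ≫ r₀.i)
  exact ⟨H₁ ⊞ H₀, H₀, biprod.desc b b', r₀.r ≫ p, addR_biprod k hH₁ hH₀, hH₀,
    hp.of_retracts (actEv d.L j) r₁ r₀ hb hb'⟩

/-- The space of morphisms `G L → L` is at most one dimensional. -/
theorem exists_smul_eq (k : Type uk) [Field k] [IsAlgClosed k] [LinearBicategory k C]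
    [IsFinitary k C] (hI : I.HasAdjunctions) (hG : AddR R d.G)
    {x : (Fiat.act d.i d.G).obj d.L ⟶ d.L} (hx : x ≠ 0) (y : (Fiat.act d.i d.G).obj d.L ⟶ d.L) :
    ∃ a : k, a • x = y := by
  have := d.epi_q k hI hG
  have h1 := (isFiniteAbelian_principal k d.i d.i).finrank_top
    (isLocalObj_proj k d.indecomposable_G) d.p_ne_zero
  obtain ⟨a, ha⟩ := (finrank_eq_one_iff_of_nonzero' (d.q d.G ≫ x) (fun h => hx
    ((cancel_epi (d.q d.G)).1 (h.trans comp_zero.symm)))).1 h1 (d.q d.G ≫ y)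
  exact ⟨a, (cancel_epi (d.q d.G)).1 (by rw [Linear.comp_smul, ha])⟩

/-- Lifting morphisms along presentations. -/
theorem exists_lift_L (k : Type uk) [Field k] [LinearBicategory k C] [IsFinitary k C]
    (hI : I.HasAdjunctions) {j : C} {H H' : d.i ⟶ j} (hH : AddR R H)
    (hH' : AddR R H') {Y : Preadditive.RightFreyd (d.i ⟶ j)}
    (p : (Fiat.act d.i H').obj d.L ⟶ Y) [Epi p] (f : (Fiat.act d.i H).obj d.L ⟶ Y) :
    ∃ m : H ⟶ H', (actNat d.i m).app d.L ≫ p = f := by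
  have := d.epi_q k hI hH
  have := d.epi_q k hI hH'
  have := CategoryTheory.epi_comp (d.q H') p
  obtain ⟨m, hm⟩ := (pr _).map_surjective (Projective.factorThru (d.q H ≫ f) (d.q H' ≫ p))
  refine ⟨m, (cancel_epi (d.q H)).1 ?_⟩
  rw [← Category.assoc, ← d.pr_map_q k hI m hH hH', hm, Category.assoc, Projective.factorThru_comp]

end CellDatum

variable {k : Type uk} [Field k] [IsAlgClosed k] [LinearBicategory k C] [IsFinitary k C]

namespace TwoRep

/-- The right exact extension of the evaluation at an object. -/
abbrev evExt (M : TwoRep.{w, v, u, u', uk} k C) {i : C} (S : M.obj i) (l : C) :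
    Preadditive.RightFreyd (i ⟶ l) ⥤ M.obj l :=
  freydExt (M.evFunctor l S)

namespace IsCellGenerator

variable {d : CellDatum R} {M : TwoRep.{w, v, u, u', uk} k C} {S : M.obj d.i}

/-- The source `H` is arbitrary, so membership of the relevant summands in `R` cannot come from `H`.
They lie left above some `F'*` and left below an element of `R`, hence in `Q`, and `mem_of_act`
concludes. -/
theorem eval_eq_zero (g : M.IsCellGenerator R d.G S) (hI : I.HasAdjunctions)
    (hc : CellCombinatorics I Q) (hR : IsRightCell R) (hRQ : R ⊆ Q) {l : C} {H F : d.i ⟶ l}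
    (hF : AddR R F) {m : H ⟶ F} (hm : (actNat d.i m).app d.L = 0) : M.eval m S = 0 := by
  have hG := d.isDuflo k hI hc hR hRQ
  have := g.simple
  obtain ⟨s, hs⟩ := hG.exists_section hG.mem
  have hc0 := eval_ne_zero_of_section M hs (g.not_isZero hG.mem)
  have hc1 : M.eval d.counit S ≫ (M.idIso S).hom ≠ 0 := fun h0 =>
    hc0 ((Preadditive.IsIso.comp_right_eq_zero _ _).1 h0)
  refine eval_eq_zero_of_eval_eq_zero hI hR hG M (principalRep k d.i) (X := S) (Y := d.L)
    (g.not_isZero hG.mem) (d.not_annihilates _ hG.mem) (fun e => ?_) hF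
    (fun F' J J' hJ _ hF' r hJ' hne => ?_) hm
  · obtain ⟨a, ha⟩ := (finrank_eq_one_iff_of_nonzero' _ hc1).1 (g.finrank_top hG.mem)
      (M.eval e S ≫ (M.idIso S).hom)
    refine ⟨a, (cancel_mono (M.idIso S).hom).1 ?_⟩
    rw [Linear.smul_comp, ha]
  · obtain ⟨t, ht⟩ := g.exists_top hG.mem
    have := epi_of_ne_zero ht
    obtain ⟨J'', hJ'', ⟨r'⟩⟩ := g.exists_leftLE hG.mem t hne
    have hQ := hc.convex (hc.dual_mem (hRQ hF')) (hRQ hJ'') hJ' (leftLE_of_retract r).twoSidedLE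
      (leftLE_of_retract r').twoSidedLE
    exact hG.iso hc hR hRQ hF' (g.mem_of_act hI hc hR hRQ hG hQ hne) (leftLE_of_retract r)

/-- The reverse transfer. At `L` the relevant summands are placed in `R` from the right, using that
`H` is a sum of elements of `R`. -/
theorem eval_L_eq_zero (g : M.IsCellGenerator R d.G S) (hI : I.HasAdjunctions)
    (hc : CellCombinatorics I Q) (hR : IsRightCell R) (hRQ : R ⊆ Q) {l : C} {H F : d.i ⟶ l}
    (hH : AddR R H) (hF : AddR R F) {m : H ⟶ F} (hm : M.eval m S = 0) :
    (actNat d.i m).app d.L = 0 := by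
  have hG := d.isDuflo k hI hc hR hRQ
  obtain ⟨s, hs⟩ := hG.exists_section hG.mem
  have hc0 := eval_ne_zero_of_section (principalRep k d.i) hs (X := d.L)
    (d.not_annihilates _ hG.mem)
  refine eval_eq_zero_of_eval_eq_zero hI hR hG (principalRep k d.i) M (X := d.L) (Y := S)
    (d.not_annihilates _ hG.mem) (g.not_isZero hG.mem) (fun e => ?_) hF
    (fun F' J J' hJ hJH hF' r hJ' hne => ?_) hm
  · let L : (principalRep k d.i).obj d.i := d.L
    have hc1 : (principalRep k d.i).eval d.counit L ≫
        ((principalRep k d.i).idIso L).hom ≠ 0 := fun h0 =>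
      hc0 ((Preadditive.IsIso.comp_right_eq_zero _ _).1 h0)
    obtain ⟨a, ha⟩ : ∃ a : k, a • ((principalRep k d.i).eval d.counit L ≫
        ((principalRep k d.i).idIso L).hom) = (principalRep k d.i).eval e L ≫
        ((principalRep k d.i).idIso L).hom :=
      d.exists_smul_eq k hI (addR_of_mem k hR hG.mem) hc1 _
    refine ⟨a, (cancel_mono ((principalRep k d.i).idIso L).hom).1 ?_⟩
    rw [Linear.smul_comp, ha]
  · have h1 : (⟨J'⟩ : OneMor C) ∈ R := by
      obtain ⟨rJ⟩ := hJH
      exact hR.mem (hH J rJ hJ) hJ' (rightLE_of_retract r)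
        ((d.rightLE_of_act_L k hI hc hR hRQ hne).trans (hR.rightLE hG.mem (hH J rJ hJ)))
    exact hG.iso hc hR hRQ hF' h1 (leftLE_of_retract r)

end IsCellGenerator

end TwoRep

end Fiat

end

/-! ### Evaluation at a cell generator as an equivalence on cell categories -/

noncomputable section

namespace Fiat

variable {C : Type u} [Bicategory.{w, v} C] [PreadditiveBicategory C] [AdditiveBicategory C]
  [HomAbelian C] [HasBiadjoints C] {R : Set (OneMor C)} {Q : Set (OneMor C)} {I : Involution C}

theorem IsCoker.isIso_of_eq_zero {D : Type u'} [Category.{v'} D] [Abelian D] {X Y Z : D}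
    {f : X ⟶ Y} {p : Y ⟶ Z} (h : IsCoker f p) (hf : f = 0) : IsIso p := by
  have := h.epi
  obtain ⟨l, hl⟩ := h.exists_desc (𝟙 Y) (by rw [hf, zero_comp])
  exact ⟨l, hl, (cancel_epi p).1 (by rw [← Category.assoc, hl, Category.id_comp, Category.comp_id])⟩

/-- Cokernels of isomorphic morphisms are isomorphic. -/
theorem IsCoker.exists_iso {D : Type u'} [Category.{v'} D] [Preadditive D] {X Y Z Z' : D}
    {f : X ⟶ Y} {p : Y ⟶ Z} {p' : Y ⟶ Z'} (h : IsCoker f p) (h' : IsCoker f p') :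
    ∃ e : Z ≅ Z', p ≫ e.hom = p' := by
  have := h.epi
  have := h'.epi
  obtain ⟨a, ha⟩ := h.exists_desc p' h'.zero
  obtain ⟨b, hb⟩ := h'.exists_desc p h.zero
  exact ⟨⟨a, b, (cancel_epi p).1 (by rw [← Category.assoc, ha, hb, Category.comp_id]),
    (cancel_epi p').1 (by rw [← Category.assoc, hb, ha, Category.comp_id])⟩, ha⟩

theorem IsCoker.comp_iso {D : Type u'} [Category.{v'} D] [Preadditive D] {X Y Y' Z : D}
    {f : X ⟶ Y} {f' : X ⟶ Y'} {p : Y' ⟶ Z} (h : IsCoker f' p) (e : Y ≅ Y') (he : f ≫ e.hom = f') :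
    IsCoker f (e.hom ≫ p) := by
  have := h.epi
  refine isCoker_iff.2 ⟨by rw [← Category.assoc, he, h.zero], CategoryTheory.epi_comp _ _,
    fun W g hg => ?_⟩
  obtain ⟨l, hl⟩ := h.exists_desc (e.inv ≫ g) (by rw [← he, Category.assoc,
    Iso.hom_inv_id_assoc, hg])
  exact ⟨l, by rw [Category.assoc, hl, Iso.hom_inv_id_assoc]⟩

variable {k : Type uk} [Field k] [IsAlgClosed k] [LinearBicategory k C] [IsFinitary k C]

namespace TwoRep.IsCellGenerator

variable {d : CellDatum R} {M : TwoRep.{w, v, u, u', uk} k C} {S : M.obj d.i}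

/-- `F L` is the cokernel of a map `P_H → P_F`, i.e. of a 2-morphism that vanishes at `L`. It then
vanishes at `S`, so the right exact extension sends `P_F → F L` to the cokernel of zero. Here `H`
need not be a sum of elements of `R`. -/
theorem isIso_evExt_q (g : M.IsCellGenerator R d.G S) (hI : I.HasAdjunctions)
    (hc : CellCombinatorics I Q) (hR : IsRightCell R) (hRQ : R ⊆ Q) {l : C} {F : d.i ⟶ l}
    (hF : AddR R F) : IsIso ((M.evExt S l).map (d.q F)) := by
  have := d.epi_q k hI hF
  let K := kernel (d.q F)
  obtain ⟨n, hn⟩ := (pr _).map_surjective (fromPr K ≫ kernel.ι (d.q F))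
  have hq : IsCoker (kernel.ι (d.q F)) (d.q F) :=
    isCoker_iff.2 ⟨kernel.condition _, inferInstance, fun W g hg =>
      ⟨Abelian.epiDesc (d.q F) g hg, Abelian.comp_epiDesc (d.q F) g hg⟩⟩
  have hq' : IsCoker ((pr _).map n) (d.q F) := by
    rw [hn]
    exact hq.epi_comp _
  refine (hq'.freydExt (M.evFunctor l S)).isIso_of_eq_zero ?_
  have h0 := g.eval_eq_zero hI hc hR hRQ hF (d.eval_L_eq_zero k hI n hF hq'.zero)
  have h1 := freydExtPr_naturality (M.evFunctor l S) n
  rw [← cancel_epi (freydExtPr (M.evFunctor l S) _).hom, ← h1]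
  exact (congrArg (· ≫ _) h0).trans (zero_comp.trans comp_zero.symm)

/-- The value of the extension at `F L`. -/
def evExtIso (g : M.IsCellGenerator R d.G S) (hI : I.HasAdjunctions)
    (hc : CellCombinatorics I Q) (hR : IsRightCell R) (hRQ : R ⊆ Q) {l : C} {F : d.i ⟶ l}
    (hF : AddR R F) : M.actObj F S ≅ (M.evExt S l).obj ((Fiat.act d.i F).obj d.L) :=
  freydExtPr (M.evFunctor l S) F ≪≫
    @asIso _ _ _ _ ((M.evExt S l).map (d.q F)) (g.isIso_evExt_q hI hc hR hRQ hF)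

theorem evExtIso_naturality (g : M.IsCellGenerator R d.G S) (hI : I.HasAdjunctions)
    (hc : CellCombinatorics I Q) (hR : IsRightCell R) (hRQ : R ⊆ Q) {l : C} {H F : d.i ⟶ l}
    (hH : AddR R H) (hF : AddR R F) (m : H ⟶ F) :
    M.eval m S ≫ (g.evExtIso hI hc hR hRQ hF).hom =
      (g.evExtIso hI hc hR hRQ hH).hom ≫ (M.evExt S l).map ((actNat d.i m).app d.L) := by
  have h1 := freydExtPr_naturality (M.evFunctor l S) m
  change M.eval m S ≫ (freydExtPr (M.evFunctor l S) F).hom ≫ (M.evExt S l).map (d.q F) =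
    ((freydExtPr (M.evFunctor l S) H).hom ≫ (M.evExt S l).map (d.q H)) ≫ _
  rw [Category.assoc, ← Functor.map_comp, ← d.pr_map_q k hI m hH hF, Functor.map_comp]
  exact (Category.assoc _ _ _).symm.trans ((congrArg (· ≫ _) h1).trans (Category.assoc _ _ _))

/-- The presentation of the value of the extension. -/
theorem isCoker_evExt (g : M.IsCellGenerator R d.G S) (hI : I.HasAdjunctions)
    (hc : CellCombinatorics I Q) (hR : IsRightCell R) (hRQ : R ⊆ Q) {l : C} {H F : d.i ⟶ l}
    (hH : AddR R H) (hF : AddR R F) {m : H ⟶ F} {X : Preadditive.RightFreyd (d.i ⟶ l)}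
    {p : (Fiat.act d.i F).obj d.L ⟶ X} (h : IsCoker ((actNat d.i m).app d.L) p) :
    IsCoker (M.eval m S) ((g.evExtIso hI hc hR hRQ hF).hom ≫ (M.evExt S l).map p) :=
  ((h.freydExt (M.evFunctor l S)).epi_comp (g.evExtIso hI hc hR hRQ hH).hom).comp_iso _
    (g.evExtIso_naturality hI hc hR hRQ hH hF m)

variable {l : C}

/-- Lift `f` to a 2-morphism `m` between generators. At `S` it factors through the relations of `Y`
by some `n`; the difference vanishes at `S`, hence at `L`, so `m` dies in `Y`. -/
theorem evExt_faithful (g : M.IsCellGenerator R d.G S) (hI : I.HasAdjunctions)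
    (hc : CellCombinatorics I Q) (hR : IsRightCell R) (hRQ : R ⊆ Q)
    {X Y : Preadditive.RightFreyd (d.i ⟶ l)} (hX : d.cellObj l X) (hY : d.cellObj l Y)
    {f : X ⟶ Y} (hf : (M.evExt S l).map f = 0) : f = 0 := by
  have hG := d.isDuflo k hI hc hR hRQ
  obtain ⟨H₁, H₀, β, p, hH₁, hH₀, hp⟩ := d.exists_presentation k hI hR hX
  obtain ⟨H₁', H₀', β', p', hH₁', hH₀', hp'⟩ := d.exists_presentation k hI hR hY
  have := hp.epi
  have := hp'.epi
  have := g.projective_addR hH₀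
  obtain ⟨m, hm⟩ := d.exists_lift_L k hI hH₀ hH₀' p' (p ≫ f)
  have h0 : M.eval m S ≫ (g.evExtIso hI hc hR hRQ hH₀').hom ≫ (M.evExt S l).map p' = 0 := by
    rw [← Category.assoc, g.evExtIso_naturality hI hc hR hRQ hH₀ hH₀', Category.assoc,
      ← Functor.map_comp, hm, Functor.map_comp, hf, comp_zero, comp_zero]
  obtain ⟨b, hb⟩ := (g.isCoker_evExt hI hc hR hRQ hH₁' hH₀' hp').exists_lift _ h0
  obtain ⟨n, rfl⟩ := g.exists_eval hI hc hR hRQ hG hH₀ hH₁' b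
  have h1 := g.eval_L_eq_zero hI hc hR hRQ hH₀ hH₀' (m := m - n ≫ β') (by
    rw [eval_sub, eval_comp, hb, sub_self])
  have h2 : (actNat d.i m).app d.L = (actNat d.i n).app d.L ≫ (actNat d.i β').app d.L := by
    have h3 : (actEv d.L l).map (m - n ≫ β') = 0 := h1
    rw [Functor.map_sub, Functor.map_comp, sub_eq_zero] at h3
    exact h3
  rw [← cancel_epi p, ← hm, h2, Category.assoc, hp'.zero, comp_zero, comp_zero]

/-- Lift `b` to the generators and then to the relations by projectivity. Both lifts are
evaluations, and the square they form commutes at `S`, hence also at `L`, where it induces `f` on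
cokernels. -/
theorem evExt_full (g : M.IsCellGenerator R d.G S) (hI : I.HasAdjunctions)
    (hc : CellCombinatorics I Q) (hR : IsRightCell R) (hRQ : R ⊆ Q)
    {X Y : Preadditive.RightFreyd (d.i ⟶ l)} (hX : d.cellObj l X) (hY : d.cellObj l Y)
    (b : (M.evExt S l).obj X ⟶ (M.evExt S l).obj Y) : ∃ f : X ⟶ Y, (M.evExt S l).map f = b := by
  have hG := d.isDuflo k hI hc hR hRQ
  obtain ⟨H₁, H₀, β, p, hH₁, hH₀, hp⟩ := d.exists_presentation k hI hR hX
  obtain ⟨H₁', H₀', β', p', hH₁', hH₀', hp'⟩ := d.exists_presentation k hI hR hY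
  have hEp := g.isCoker_evExt hI hc hR hRQ hH₁ hH₀ hp
  have hEp' := g.isCoker_evExt hI hc hR hRQ hH₁' hH₀' hp'
  have := hEp.epi
  have := hEp'.epi
  have := g.projective_addR hH₀
  have := g.projective_addR hH₁
  obtain ⟨m, hm⟩ := g.exists_eval hI hc hR hRQ hG hH₀ hH₀' (Projective.factorThru
    (((g.evExtIso hI hc hR hRQ hH₀).hom ≫ (M.evExt S l).map p) ≫ b)
    ((g.evExtIso hI hc hR hRQ hH₀').hom ≫ (M.evExt S l).map p'))
  have hm' := (congrArg (· ≫ (g.evExtIso hI hc hR hRQ hH₀').hom ≫ (M.evExt S l).map p') hm).trans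
    (Projective.factorThru_comp _ _)
  obtain ⟨a, ha⟩ := hEp'.exists_lift (M.eval (β ≫ m) S) (by
    rw [eval_comp, Category.assoc, hm', ← Category.assoc, hEp.zero, zero_comp])
  obtain ⟨n, rfl⟩ := g.exists_eval hI hc hR hRQ hG hH₁ hH₁' a
  have h1 := g.eval_L_eq_zero hI hc hR hRQ hH₁ hH₀' (m := β ≫ m - n ≫ β') (by
    rw [eval_sub, eval_comp _ n β', ha, sub_self])
  have h2 : (actNat d.i β).app d.L ≫ (actNat d.i m).app d.L =
      (actNat d.i n).app d.L ≫ (actNat d.i β').app d.L := by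
    have h3 : (actEv d.L l).map (β ≫ m - n ≫ β') = 0 := h1
    rw [Functor.map_sub, Functor.map_comp, Functor.map_comp, sub_eq_zero] at h3
    exact h3
  obtain ⟨f, hf⟩ := hp.exists_desc ((actNat d.i m).app d.L ≫ p') (by
    rw [← Category.assoc, h2, Category.assoc, hp'.zero, comp_zero])
  refine ⟨f, (cancel_epi ((g.evExtIso hI hc hR hRQ hH₀).hom ≫ (M.evExt S l).map p)).1 ?_⟩
  rw [← hm', Category.assoc, ← Functor.map_comp, hf, Functor.map_comp, ← Category.assoc,
    ← g.evExtIso_naturality hI hc hR hRQ hH₀ hH₀', Category.assoc]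

/-- Present `X` by a 2-morphism evaluated at `S`; the preimage is the cokernel of the same
2-morphism at `L`. -/
theorem evExt_essSurj (g : M.IsCellGenerator R d.G S) (hI : I.HasAdjunctions)
    (hc : CellCombinatorics I Q) (hR : IsRightCell R) (hRQ : R ⊆ Q) (X : M.obj l) :
    ∃ Y : Preadditive.RightFreyd (d.i ⟶ l), d.cellObj l Y ∧ Nonempty ((M.evExt S l).obj Y ≅ X) := by
  obtain ⟨α, q, h1, h0, hq, -⟩ :=
    g.exists_presentation hI hc hR hRQ (d.isDuflo k hI hc hR hRQ) X
  have hY := isCoker_cokernel ((actNat d.i α.hom).app d.L)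
  refine ⟨_, d.cellObj_of_isCoker k hI hR (d.cellObj_act_L k h1) (d.cellObj_act_L k h0) hY, ?_⟩
  obtain ⟨e, -⟩ := (g.isCoker_evExt hI hc hR hRQ h1 h0 hY).exists_iso hq
  exact ⟨e⟩

end TwoRep.IsCellGenerator

end Fiat

end

/-! ### Compatibility of the extended evaluation with the action -/

noncomputable section

namespace Fiat

variable {C : Type u} [Bicategory.{w, v} C] [PreadditiveBicategory C] [AdditiveBicategory C]
  [HasBiadjoints C] {k : Type uk} [Field k] [LinearBicategory k C]

/-- A cube argument: coherence for the extension is tested on the epimorphisms from presentations,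
where it becomes coherence of the action on `M`. -/
theorem comm_of_epi_of_comm {D : Type u'} [Category.{v'} D] {A A' B B' X X' Y Y' : D}
    {p : A ⟶ X} {p' : A' ⟶ X'} {c : A ⟶ B} {c' : A' ⟶ B'} {q : B ⟶ Y} {q' : B' ⟶ Y'}
    {e : X ⟶ Y} {e' : X' ⟶ Y'} {a : A ⟶ A'} {b : B ⟶ B'} {f : X ⟶ X'} {g : Y ⟶ Y'} (hp : Epi p)
    (h : p ≫ e = c ≫ q) (h' : p' ≫ e' = c' ≫ q') (hf : p ≫ f = a ≫ p') (hc : a ≫ c' = c ≫ b)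
    (hg : b ≫ q' = q ≫ g) : f ≫ e' = e ≫ g := by
  rw [← cancel_epi p, ← Category.assoc, hf, Category.assoc, h', ← Category.assoc, hc,
    Category.assoc, hg, ← Category.assoc, ← h, Category.assoc]

namespace TwoRep

variable (M : TwoRep.{w, v, u, u', uk} k C) {i : C} (S : M.obj i)

theorem map_eval_compIso {l m : C} {A B : i ⟶ l} (a : A ⟶ B) (F : l ⟶ m) :
    M.eval (a ▷ F) S ≫ (M.compIso B F S).hom =
      (M.compIso A F S).hom ≫ (M.act F).map (M.eval a S) := by
  rw [eval_whiskerRight, Category.assoc, Category.assoc, Iso.inv_hom_id, Category.comp_id]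

/-- The value of the extension at `X`, as a quotient of the value at its presentation. -/
abbrev evπ {l : C} (X : Preadditive.RightFreyd (i ⟶ l)) :
    M.actObj (arr X).right S ⟶ (M.evExt S l).obj X :=
  freydExtπ (M.evFunctor l S) X

theorem epi_evπ {l : C} (X : Preadditive.RightFreyd (i ⟶ l)) : Epi (M.evπ S X) :=
  inferInstanceAs (Epi (freydExtπ (M.evFunctor l S) X))

theorem isCoker_act_evπ {l m : C} (F : l ⟶ m) (X : Preadditive.RightFreyd (i ⟶ l)) :
    IsCoker (M.eval ((arr X).hom ▷ F) S)
      ((M.compIso (arr X).right F S).hom ≫ (M.act F).map (M.evπ S X)) := by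
  have h : IsCoker (M.eval (arr X).hom S) (M.evπ S X) := isCoker_freydExtπ (M.evFunctor l S) X
  have h₁ : IsCoker ((M.act F).map (M.eval (arr X).hom S)) ((M.act F).map (M.evπ S X)) :=
    h.map (M.act F)
  have : Epi (M.compIso (arr X).left F S).hom := inferInstance
  exact (h₁.epi_comp (M.compIso (arr X).left F S).hom).comp_iso _ (M.map_eval_compIso S _ F)

theorem exists_evExtActIso {l m : C} (F : l ⟶ m) (X : Preadditive.RightFreyd (i ⟶ l)) :
    ∃ e : (M.evExt S m).obj ((Fiat.act i F).obj X) ≅ M.actObj F ((M.evExt S l).obj X),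
      M.evπ S ((Fiat.act i F).obj X) ≫ e.hom =
        (M.compIso (arr X).right F S).hom ≫ (M.act F).map (M.evπ S X) :=
  (isCoker_freydExtπ (M.evFunctor m S) ((Fiat.act i F).obj X)).exists_iso (M.isCoker_act_evπ S F X)

/-- The extension commutes with the action. -/
def evExtActIso {l m : C} (F : l ⟶ m) (X : Preadditive.RightFreyd (i ⟶ l)) :
    (M.evExt S m).obj ((Fiat.act i F).obj X) ≅ M.actObj F ((M.evExt S l).obj X) :=
  (M.exists_evExtActIso S F X).choose

theorem evπ_evExtActIso {l m : C} (F : l ⟶ m) (X : Preadditive.RightFreyd (i ⟶ l)) :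
    M.evπ S ((Fiat.act i F).obj X) ≫ (M.evExtActIso S F X).hom =
      (M.compIso (arr X).right F S).hom ≫ (M.act F).map (M.evπ S X) :=
  (M.exists_evExtActIso S F X).choose_spec

theorem evπ_naturality {l : C} {X Y : Preadditive.RightFreyd (i ⟶ l)} (f : arr X ⟶ arr Y) :
    M.evπ S X ≫ (M.evExt S l).map (cls f) = M.eval f.right S ≫ M.evπ S Y :=
  freydExtπ_naturality _ _

theorem evExtActIso_naturality {l m : C} (F : l ⟶ m) {X Y : Preadditive.RightFreyd (i ⟶ l)}
    (f : X ⟶ Y) : (M.evExt S m).map ((Fiat.act i F).map f) ≫ (M.evExtActIso S F Y).hom =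
      (M.evExtActIso S F X).hom ≫ (M.act F).map ((M.evExt S l).map f) := by
  obtain ⟨f, rfl⟩ := cls_surj f
  exact comm_of_epi_of_comm (M.epi_evπ S _) (M.evπ_evExtActIso S F X) (M.evπ_evExtActIso S F Y)
    (M.evπ_naturality S (X := (Fiat.act i F).obj X) (Y := (Fiat.act i F).obj Y) _)
    (M.map_eval_compIso S f.right F)
    (((M.act F).map_comp _ _).symm.trans ((congrArg (M.act F).map (M.evπ_naturality S f).symm).trans
      ((M.act F).map_comp _ _)))

theorem evExtActIso_naturality₂ {l m : C} {F F' : l ⟶ m} (η : F ⟶ F')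
    (X : Preadditive.RightFreyd (i ⟶ l)) :
    (M.evExt S m).map ((actNat i η).app X) ≫ (M.evExtActIso S F' X).hom =
      (M.evExtActIso S F X).hom ≫ M.eval η ((M.evExt S l).obj X) := by
  refine comm_of_epi_of_comm (M.epi_evπ S _) (M.evπ_evExtActIso S F X) (M.evπ_evExtActIso S F' X)
    (M.evπ_naturality S (X := (Fiat.act i F).obj X) (Y := (Fiat.act i F').obj X) _)
    (b := M.eval η (M.actObj (arr X).right S)) ?_ (M.eval_naturality _ _).symm
  have h : M.eval ((arr X).right ◁ η) S ≫ (M.compIso (arr X).right F' S).hom =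
      (M.compIso (arr X).right F S).hom ≫ M.eval η (M.actObj (arr X).right S) := by
    rw [eval_whiskerLeft, Category.assoc, Category.assoc, Iso.inv_hom_id, Category.comp_id]
  exact h

theorem eval_rightUnitor_hom {l : C} (A : i ⟶ l) :
    M.eval (ρ_ A).hom S = (M.compIso A (𝟙 l) S).hom ≫ (M.idIso (M.actObj A S)).hom := by
  have h1 : M.eval (ρ_ A).hom S ≫ M.eval (ρ_ A).inv S = 𝟙 _ := by
    rw [← eval_comp, Iso.hom_inv_id, eval_id]
  rw [eval_rightUnitor_inv] at h1
  rw [← cancel_mono ((M.idIso (M.actObj A S)).inv ≫ (M.compIso A (𝟙 l) S).inv), h1]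
  simp

theorem evExtActIso_id {l : C} (X : Preadditive.RightFreyd (i ⟶ l)) :
    (M.evExtActIso S (𝟙 l) X).hom ≫ (M.idIso ((M.evExt S l).obj X)).hom =
      (M.evExt S l).map ((actId i l).hom.app X) := by
  refine ((Category.comp_id _).symm.trans (comm_of_epi_of_comm (M.epi_evπ S _)
    (M.evπ_evExtActIso S (𝟙 l) X) (p' := M.evπ S X) (c' := 𝟙 _) (q' := M.evπ S X) ?_
    (M.evπ_naturality S (X := (Fiat.act i (𝟙 l)).obj X) (Y := X) _)
    (b := (M.idIso (M.actObj (arr X).right S)).hom) ?_ ?_)).symm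
  · exact (Category.comp_id _).trans (Category.id_comp _).symm
  · exact (Category.comp_id _).trans (M.eval_rightUnitor_hom S _)
  · exact (M.idIso_naturality _).symm

theorem eval_associator_inv_compIso {l m n : C} (A : i ⟶ l) (F : l ⟶ m) (H : m ⟶ n) :
    M.eval (α_ A F H).inv S ≫ (M.compIso (A ≫ F) H S).hom ≫ (M.act H).map (M.compIso A F S).hom =
      (M.compIso A (F ≫ H) S).hom ≫ (M.compIso F H (M.actObj A S)).hom := by
  rw [eval_associator_inv]
  simp [← Functor.map_comp]

theorem evExtActIso_comp {l m n : C} (F : l ⟶ m) (H : m ⟶ n)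
    (X : Preadditive.RightFreyd (i ⟶ l)) :
    (M.evExt S n).map ((actComp i F H).hom.app X) ≫
        (M.evExtActIso S H ((Fiat.act i F).obj X)).hom ≫
          (M.act H).map (M.evExtActIso S F X).hom =
      (M.evExtActIso S (F ≫ H) X).hom ≫ (M.compIso F H ((M.evExt S l).obj X)).hom := by
  have h₁ := M.evπ_evExtActIso S F X
  have h₂ := M.evπ_evExtActIso S H ((Fiat.act i F).obj X)
  have h₃ : (M.act H).map (M.evπ S ((Fiat.act i F).obj X)) ≫ (M.act H).map (M.evExtActIso S F X).hom
      = (M.act H).map (M.compIso (arr X).right F S).hom ≫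
        (M.act H).map ((M.act F).map (M.evπ S X)) :=
    ((M.act H).map_comp _ _).symm.trans ((congrArg (M.act H).map h₁).trans ((M.act H).map_comp _ _))
  refine comm_of_epi_of_comm (M.epi_evπ S _) (M.evπ_evExtActIso S (F ≫ H) X)
    (p' := M.evπ S ((Fiat.act i H).obj ((Fiat.act i F).obj X)))
    (c' := (M.compIso ((arr X).right ≫ F) H S).hom ≫
      (M.act H).map (M.compIso (arr X).right F S).hom)
    (q' := (M.act H).map ((M.act F).map (M.evπ S X))) ?_
    (M.evπ_naturality S (X := (Fiat.act i (F ≫ H)).obj X)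
      (Y := (Fiat.act i H).obj ((Fiat.act i F).obj X)) _)
    (M.eval_associator_inv_compIso S (arr X).right F H) (M.compIso_naturality _ _ _).symm
  exact (Category.assoc _ _ _).symm.trans ((congrArg (· ≫ (M.act H).map (M.evExtActIso S F X).hom)
    h₂).trans ((Category.assoc _ _ _).trans ((congrArg (_ ≫ ·) h₃).trans
      (Category.assoc _ _ _).symm)))

end TwoRep

end Fiat

end

/-! ### Equivalence of cell 2-representations -/

noncomputable section

namespace Fiat

variable {C : Type u} [Bicategory.{w, v} C] [PreadditiveBicategory C] [AdditiveBicategory C]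
  [HomAbelian C] [HasBiadjoints C] {R : Set (OneMor C)} {Q : Set (OneMor C)} {I : Involution C}
  {k : Type uk} [Field k] [LinearBicategory k C]

namespace TwoRep

variable (M : TwoRep.{w, v, u, max v w, uk} k C) {i : C} (S : M.obj i)

/-- The transformation from a subrepresentation of the principal `2`-representation which is given
by the right exact extension of the evaluation at an object. -/
def evTrans (P : ∀ j, ObjectProperty ((principal i).obj j))
    (h : ∀ {j l : C} (H : j ⟶ l) (X : (principal i).obj j), P j X →
      P l (((principal i).map H).toFunctor.obj X)) :
    Pseudofunctor.StrongTrans (restrict (principal i) P h) M.functor where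
  app l := Functor.toCatHom (C := (P l).FullSubcategory) (D := M.obj l) ((P l).ι ⋙ M.evExt S l)
  naturality {l m} F := Cat.Hom.isoMk (NatIso.ofComponents (fun X => M.evExtActIso S F X.obj)
    (fun f => M.evExtActIso_naturality S F f.hom))
  naturality_naturality η := by
    ext X
    exact M.evExtActIso_naturality₂ S η X.obj
  naturality_id l := by
    ext X
    refine (M.evExtActIso_id S X.obj).trans ?_
    exact ((congrArg (_ ≫ ·) (Category.comp_id _)).trans (Category.comp_id _)).symm
  naturality_comp F H := by
    ext X
    refine (M.evExtActIso_comp S F H X.obj).symm.trans ?_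
    exact congrArg (_ ≫ ·) (((Category.id_comp _).trans (congrArg (_ ≫ ·)
      ((Category.id_comp _).trans (Category.comp_id _)))).symm)

end TwoRep

variable [IsAlgClosed k] [IsFinitary k C]

/-- A cell `2`-representation is determined by a simple object which generates in the same way. -/
theorem TwoRep.IsCellGenerator.equivalent {d : CellDatum R}
    {M : TwoRep.{w, v, u, max v w, uk} k C} {S : M.obj d.i} (g : M.IsCellGenerator R d.G S)
    (hI : I.HasAdjunctions) (hc : CellCombinatorics I Q) (hR : IsRightCell R) (hRQ : R ⊆ Q)
    (h : d.IsTwoRep k) : (d.cellRep h).Equivalent M := by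
  refine ⟨M.evTrans S d.cellObj (fun H X hX => h.stable H X hX), fun l => ?_⟩
  let E : (d.cellObj l).FullSubcategory ⥤ M.obj l := (d.cellObj l).ι ⋙ M.evExt S l
  have hlin : E.Linear k :=
    ⟨fun f a => (M.evExt S l).map_smul a f.hom⟩
  have hadd : E.Additive := ⟨fun {_ _ f f'} => (M.evExt S l).map_add (f := f.hom) (g := f'.hom)⟩
  have : E.Faithful := ⟨fun {X Y f f'} hf => by
    refine ObjectProperty.hom_ext _ (sub_eq_zero.1
      (g.evExt_faithful hI hc hR hRQ X.property Y.property ?_))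
    rw [Functor.map_sub, sub_eq_zero]
    exact hf⟩
  have : E.Full := ⟨fun {X Y} b => by
    obtain ⟨f, hf⟩ := g.evExt_full hI hc hR hRQ X.property Y.property b
    exact ⟨ObjectProperty.homMk f, hf⟩⟩
  have : E.EssSurj := ⟨fun X => by
    obtain ⟨Y, hY, e⟩ := g.evExt_essSurj hI hc hR hRQ X
    exact ⟨⟨Y, hY⟩, e⟩⟩
  have hE : E.IsEquivalence := {}
  exact ⟨hadd, hlin, hE⟩

end Fiat

end

noncomputable section

namespace Fiat

variable {C : Type u} [Bicategory.{w, v} C] [PreadditiveBicategory C] [AdditiveBicategory C]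
  [HomAbelian C] [HasBiadjoints C] {R R' : Set (OneMor C)} {Q : Set (OneMor C)} {I : Involution C}
  {k : Type uk} [Field k] [LinearBicategory k C] [IsAlgClosed k] [IsFinitary k C]

theorem CellDatum.stronglySimple (d : CellDatum R) (hI : I.HasAdjunctions)
    (hc : CellCombinatorics I Q) (hm : MultConstant I Q) (hR : IsRightCell R) (hRQ : R ⊆ Q)
    (h : d.IsTwoRep k) : (d.cellRep h).StronglySimple := by
  obtain ⟨T, g⟩ := d.exists_isCellGenerator hI hc hR hRQ h
  exact g.stronglySimple hI hc hm hR hRQ (d.isDuflo k hI hc hR hRQ)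

theorem CellDatum.equivalent (d : CellDatum R) (d' : CellDatum R') (hI : I.HasAdjunctions)
    (hc : CellCombinatorics I Q) (hm : MultConstant I Q) (hR : IsRightCell R) (hRQ : R ⊆ Q)
    (hR' : IsRightCell R') (hRQ' : R' ⊆ Q) (h : d.IsTwoRep k) (h' : d'.IsTwoRep k) :
    (d.cellRep h).Equivalent (d'.cellRep h') := by
  obtain ⟨T, g⟩ := d'.exists_isCellGenerator hI hc hR' hRQ' h'
  have hG' := d'.isDuflo k hI hc hR' hRQ'
  have hG := d.isDuflo k hI hc hR hRQ
  -- An element of `R'` in the left cell of `G*`: its dual lies in the right cell of `G** ≅ G`,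
  -- which is `R`.
  obtain ⟨A, hA, h1, h2⟩ := hc.exists_meet (hRQ' hG'.mem) (hc.dual_mem (hRQ hG.mem))
  have hAR' := hc.mem hR' hRQ' hG'.mem hA h1
  obtain ⟨j, F, rfl⟩ := d'.exists_mor hAR'
  have hF : (⟨I.dual F⟩ : OneMor C) ∈ R := hc.mem hR hRQ hG.mem (hc.dual_mem hA)
    ((I.dual₁_dual₁ _).symm.rightLE.trans h2.dual)
  obtain rfl : j = d.i := d.src_eq _ hF
  obtain ⟨S, p, hS, hp⟩ := ((d'.cellRep h').isFiniteAbelian d.i).exists_simple_quotient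
    (g.not_isZero hAR')
  have hp0 : p ≠ 0 := fun h0 => Simple.not_isZero S (IsZero.of_epi_eq_zero p h0)
  exact (g.quotient hI hc hm hR' hRQ' hG' hAR' hp0 hR hRQ hG hF).equivalent hI hc hR hRQ h

end Fiat

end

theorem theorem4 {k : Type uk} [Field k] [IsAlgClosed k]
    {C : Type u} [CategoryTheory.Bicategory.{w, v} C] [Fiat.PreadditiveBicategory C]
    [Fiat.AdditiveBicategory C] [Fiat.LinearBicategory k C] [Fiat.IsFinitary k C]
    (I : Fiat.Involution C) (hI : I.HasAdjunctions)
    (Q : Set (Fiat.OneMor C)) (hQ : Fiat.IsTwoSidedCell Q) (hreg : Fiat.IsStronglyRegularCell Q)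
    (hm : Fiat.MultConstant I Q) :
    (∀ R : Set (Fiat.OneMor C), Fiat.IsRightCell R → R ⊆ Q →
      Nonempty (Fiat.CellDatum R) ∧
      ∀ d : Fiat.CellDatum R, ∃ h : d.IsTwoRep k, (d.cellRep h).StronglySimple) ∧
    (∀ R R' : Set (Fiat.OneMor C), Fiat.IsRightCell R → Fiat.IsRightCell R' → R ⊆ Q → R' ⊆ Q →
      ∀ (d : Fiat.CellDatum R) (d' : Fiat.CellDatum R') (h : d.IsTwoRep k) (h' : d'.IsTwoRep k),
        (d.cellRep h).Equivalent (d'.cellRep h')) := by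
  have := Fiat.homAbelian k (C := C)
  have := hI.hasBiadjoints
  have hc := Fiat.cellCombinatorics k hI hQ hreg
  exact ⟨fun R hR hRQ => ⟨Fiat.exists_cellDatum k hI hR, fun d =>
    ⟨d.isTwoRep k hI hc hR hRQ, d.stronglySimple hI hc hm hR hRQ _⟩⟩,
    fun R R' hR hR' hRQ hRQ' d d' h h' => d.equivalent d' hI hc hm hR hRQ hR' hRQ' h h'⟩
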